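/- For an integer $y\ge 2$ let $\alpha_y(n)=1$ if every prime dividing $n$ is $>y$ and $\alpha_y(n)=0$ otherwise, and let $P_y=\prod_{p\le y}(1-1/p)$, the product running over primes. For integers $y,H\ge 2$ put $$M(H,y)=\prod_{2<p\le y}\Bigl(1-\frac2p\Bigr)\sum_{n\ge 1} g_y(n)\Bigl\{\frac{H}{2n}\Bigr\}\Bigl(1-\Bigl\{\frac{H}{2n}\Bigr\}\Bigr),$$ where $\{\cdot\}$ is the fractional part and $g_y$ is the multiplicative function supported on squarefree integers with $g_y(p)=\frac{p}{p-2}$ for primes $2<p\le y$ and $g_y(p)=0$ for all other primes. There is an absolute constant $C>0$ with the following property. Let $w:\mathbb R\to\mathbb R$ satisfy $w(x)\to\infty$ as $x\to\infty$, and let $\varepsilon,\delta>0$ be fixed. Let the integers $y,H,X$ run through sequences tending together to infinity, with $1<y\le X$ and $1<H\le X$, such that (from some point on) $$y\ge(\log H)^{1+\varepsilon}\qquad\text{and}\qquad \Bigl(1+\frac{\log\log H}{\log y}\Bigr)\frac{\log H}{\log\log H}\le(1-\delta)\frac{\log X}{\log y}.$$ Then for almost all real $x\in[0,X]$ one has $$\Bigl|\sum_{x<n\le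 x+H}\alpha_y(n)-H P_y\Bigr|\le C\,M(H,y)^{1/2}\,w(x),$$ that is, the Lebesgue measure of the set of $x\in[0,X]$ for which this inequality fails is $o(X)$ in the limit. (If $w$ is not measurable, outer Lebesgue measure is meant.) -/

import Mathlib

noncomputable section

namespace SiftedIntervals

open Classical in
/-- The indicator of the integers all of whose prime factors exceed `y`. -/
def alpha (y n : ℕ) : ℝ :=
  if ∀ p : ℕ, p.Prime → p ∣ n → y < p then 1 else 0

/-- The number of `y`-rough integers `n` with `x < n ≤ x + H` (meant for `0 ≤ x`, where
`x < n ≤ x + H` says the same as `⌊x⌋₊ < n ≤ ⌊x + H⌋₊`). -/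
def roughCount (y H : ℕ) (x : ℝ) : ℝ :=
  ∑ n ∈ Finset.Ioc ⌊x⌋₊ ⌊x + (H : ℝ)⌋₊, alpha y n

/-- The mean value of `alpha y`: the product of `1 - 1 / p` over the primes `p ≤ y`. -/
def P (y : ℕ) : ℝ :=
  ∏ p ∈ (Finset.Icc 1 y).filter Nat.Prime, (1 - 1 / (p : ℝ))

/-- The multiplicative function supported on squarefree integers whose value at a prime `p` is
`p / (p - 2)` if `2 < p ≤ y`, and `0` otherwise. -/
def g (y n : ℕ) : ℝ :=
  if Squarefree n then
    ∏ p ∈ n.primeFactors, (if 2 < p ∧ p ≤ y then (p : ℝ) / ((p : ℝ) - 2) else 0)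
  else 0

/-- The main term of the variance. The series has finitely many nonzero terms, and its term at
`n = 0` vanishes because `g y 0 = 0`. -/
def M (H y : ℕ) : ℝ :=
  (∏ p ∈ (Finset.Icc 3 y).filter Nat.Prime, (1 - 2 / (p : ℝ))) *
    ∑' n : ℕ, g y n *
      (Int.fract ((H : ℝ) / (2 * (n : ℝ))) * (1 - Int.fract ((H : ℝ) / (2 * (n : ℝ)))))

theorem g_zero (y : ℕ) : g y 0 = 0 := by
  simp [g]

theorem g_support_finite (y : ℕ) : (Function.support (g y)).Finite := by
  refine ((Finset.Icc 1 y).powerset.image fun s => ∏ p ∈ s, p).finite_toSet.subset ?_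
  intro n hn
  have hsq : Squarefree n := by
    by_contra h
    exact hn (by simp [g, h])
  have hp : ∀ p ∈ n.primeFactors, 2 < p ∧ p ≤ y := by
    intro p hp
    by_contra h
    refine hn ?_
    simp only [g, hsq, if_true]
    exact Finset.prod_eq_zero hp (by simp only [h, if_false])
  simp only [Finset.coe_image, Set.mem_image, Finset.mem_coe, Finset.mem_powerset]
  refine ⟨n.primeFactors, ?_, Nat.prod_primeFactors_of_squarefree hsq⟩
  intro p h
  have := hp p h
  exact Finset.mem_Icc.2 ⟨by omega, this.2⟩

/-- The series in the definition of `M` converges, being a finite sum. -/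
theorem summable_M (H y : ℕ) : Summable fun n : ℕ => g y n *
    (Int.fract ((H : ℝ) / (2 * (n : ℝ))) * (1 - Int.fract ((H : ℝ) / (2 * (n : ℝ))))) := by
  refine summable_of_hasFiniteSupport ((g_support_finite y).subset ?_)
  intro n hn h
  exact hn (by simp [h])

end SiftedIntervals

end

/-!
The indicator of the integers `n` without prime factors up to `y` is `P y * ∏ p ≤ y, (1 + φ p n)`,
where each `φ p` has mean zero over a period. Expanding the product gives one term for every set of
primes; these terms are orthogonal over a full period, and the total variance is `M H y`. If the
expansion is cut down to sets of primes of small product, a large sieve inequality transfers this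
variance bound from the full period to `[0, X]`, while Rankin's trick bounds the terms that were
dropped. The hypothesis on `log X / log y` lets this bound save a factor of about
`exp ((1 + log log H / log y) log H)` over the trivial one. This is small enough in comparison with
`M H y`, because many integers composed of primes near `y` contribute to its series. Only when
`log y` exceeds `H ^ 4` does this break down, but then the count and its mean are both so small on
average that the triangle inequality suffices. The first absolute moment of the deviation is thus
`O(X * √(M H y))`, and Markov's inequality together with `w x → ∞` finishes the proof.
-/

namespace SiftedIntervals

open Finset
open scoped BigOperators

/-! ### Means of periodic functions -/

theorem sum_range_add_of_periodic {A : Type*} [AddCommGroup A] {f : ℕ → A} {N : ℕ}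
    (hf : Function.Periodic f N) (h : ℕ) :
    ∑ n ∈ range N, f (n + h) = ∑ n ∈ range N, f n := by
  induction h with
  | zero => rfl
  | succ h ih =>
    have hends : f (N + h) = f (0 + h) := by rw [add_comm N h, zero_add, hf h]
    have hshift := (sum_range_succ' (fun n => f (n + h)) N).symm.trans
      (sum_range_succ (fun n => f (n + h)) N)
    rw [hends] at hshift
    rw [← ih, ← add_right_cancel hshift]
    exact sum_congr rfl fun n _ => by rw [add_right_comm, add_assoc]

theorem expect_range_add_of_periodic {f : ℕ → ℝ} {N : ℕ} (hf : Function.Periodic f N) (h : ℕ) :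
    𝔼 n ∈ range N, f (n + h) = 𝔼 n ∈ range N, f n := by
  simp only [expect_eq_sum_div_card, sum_range_add_of_periodic hf]

theorem sum_range_mul_of_periodic {f : ℕ → ℝ} {N : ℕ} (hf : Function.Periodic f N) (k : ℕ) :
    ∑ n ∈ range (k * N), f n = k * ∑ n ∈ range N, f n := by
  induction k with
  | zero => simp
  | succ k ih =>
    have hblock (n : ℕ) : f (k * N + n) = f n := by rw [add_comm]; exact hf.nat_mul k n
    simp only [Nat.succ_mul, sum_range_add, ih, hblock]
    push_cast
    ring

theorem sum_range_mul_of_coprime {a b : ℕ → ℝ} {m k : ℕ} (ha : Function.Periodic a m)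
    (hb : Function.Periodic b k) (h : m.Coprime k) :
    ∑ n ∈ range (m * k), a n * b n = (∑ n ∈ range m, a n) * ∑ n ∈ range k, b n := by
  rcases m.eq_zero_or_pos with rfl | hm
  · simp
  rcases k.eq_zero_or_pos with rfl | hk
  · simp
  rw [sum_mul_sum, ← sum_product']
  refine sum_bij' (fun n _ => (n % m, n % k))
    (fun x _ => (Nat.chineseRemainder h x.1 x.2 : ℕ)) ?_ ?_ ?_ ?_ ?_
  · intro n _
    simp only [mem_product, mem_range]
    exact ⟨Nat.mod_lt _ hm, Nat.mod_lt _ hk⟩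
  · intro x _
    exact mem_range.2 (Nat.chineseRemainder_lt_mul h _ _ hm.ne' hk.ne')
  · intro n hn
    have hcrt := (Nat.chineseRemainder h (n % m) (n % k)).2
    have hmod : (Nat.chineseRemainder h (n % m) (n % k) : ℕ) ≡ n [MOD m * k] :=
      (Nat.modEq_and_modEq_iff_modEq_mul h).1
        ⟨hcrt.1.trans (Nat.mod_modEq _ _), hcrt.2.trans (Nat.mod_modEq _ _)⟩
    exact hmod.eq_of_lt_of_lt (Nat.chineseRemainder_lt_mul h _ _ hm.ne' hk.ne') (mem_range.1 hn)
  · rintro ⟨i, j⟩ hx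
    simp only [mem_product, mem_range] at hx
    have hcrt := (Nat.chineseRemainder h i j).2
    exact Prod.ext (Nat.mod_eq_of_modEq hcrt.1 hx.1) (Nat.mod_eq_of_modEq hcrt.2 hx.2)
  · intro n _
    simp only [ha.map_mod_nat, hb.map_mod_nat]

theorem periodic_of_dvd {A : Type*} {f : ℕ → A} {m N : ℕ} (hf : Function.Periodic f m)
    (h : m ∣ N) : Function.Periodic f N := by
  obtain ⟨k, rfl⟩ := h
  rw [mul_comm]
  exact hf.nat_mul k

theorem periodic_prod_prod {s : Finset ℕ} {f : ℕ → ℕ → ℝ}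
    (hf : ∀ p ∈ s, Function.Periodic (f p) p) :
    Function.Periodic (fun n => ∏ p ∈ s, f p n) (∏ p ∈ s, p) := fun n =>
  prod_congr rfl fun p hp => periodic_of_dvd (hf p hp) (dvd_prod_of_mem (fun p => p) hp) n

theorem expect_prod_eq_prod_expect {s : Finset ℕ} (hs : (s : Set ℕ).Pairwise Nat.Coprime)
    {f : ℕ → ℕ → ℝ} (hf : ∀ p ∈ s, Function.Periodic (f p) p) :
    𝔼 n ∈ range (∏ p ∈ s, p), ∏ p ∈ s, f p n = ∏ p ∈ s, 𝔼 a ∈ range p, f p a := by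
  simp only [expect_eq_sum_div_card, card_range, prod_div_distrib, Nat.cast_prod]
  congr 1
  induction s using Finset.induction_on with
  | empty => simp
  | insert q s hq ih =>
    rw [coe_insert, Set.pairwise_insert_of_symm] at hs
    simp only [forall_mem_insert] at hf
    simp only [prod_insert hq]
    rw [← ih hs.1 hf.2]
    exact sum_range_mul_of_coprime hf.1 (periodic_prod_prod hf.2)
      (Nat.Coprime.prod_right fun p hp => hs.2 p hp fun h => hq (h ▸ hp))

theorem pairwise_coprime_of_prime {s : Finset ℕ} (hs : ∀ p ∈ s, p.Prime) :
    (s : Set ℕ).Pairwise Nat.Coprime :=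
  fun p hp q hq hne => (Nat.coprime_primes (hs p hp) (hs q hq)).2 hne

/-! ### A large sieve inequality for nonnegative functions -/

section LargeSieve

open Complex

theorem sum_range_mul_pow_eq_zero {f : ℕ → ℂ} {m N : ℕ} (hf : Function.Periodic f m)
    (hm : m ∣ N) {ζ : ℂ} (hN : ζ ^ N = 1) (hζ : ζ ^ m ≠ 1) :
    ∑ n ∈ range N, f n * ζ ^ n = 0 := by
  have hper : Function.Periodic (fun n => f n * ζ ^ n) N := fun n => by
    simp only [periodic_of_dvd hf hm n, pow_add, hN, mul_one]
  have hshift : (∑ n ∈ range N, f n * ζ ^ n) * ζ ^ m = ∑ n ∈ range N, f n * ζ ^ n := by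
    rw [sum_mul, ← sum_range_add_of_periodic hper m]
    exact sum_congr rfl fun n _ => by rw [hf n, pow_add, mul_assoc]
  exact (mul_right_eq_self₀.1 hshift).resolve_left hζ

theorem zpow_pow_ne_one {ζ : ℂ} {N m : ℕ} {l : ℤ} (hζ : IsPrimitiveRoot ζ N) (hm : 0 < m)
    (hl : l ≠ 0) (h : |l| * m < N) : (ζ ^ l) ^ m ≠ 1 := by
  rw [← zpow_natCast, ← zpow_mul, Ne, hζ.zpow_eq_one_iff_dvd]
  intro hdvd
  have hlm : l * m = 0 := Int.eq_zero_of_abs_lt_dvd hdvd (by rwa [abs_mul, Nat.abs_cast])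
  exact hl ((mul_eq_zero.1 hlm).resolve_right (by exact_mod_cast hm.ne'))

/-- The Dirichlet kernel `∑ j < Q, e(jn / N)`. -/
noncomputable def dirichletKernel (N Q n : ℕ) : ℂ :=
  ∑ j ∈ range Q, (exp (2 * Real.pi * I / N) ^ j) ^ n

theorem norm_dirichletKernel_sq {N : ℕ} (hN : N ≠ 0) (Q n : ℕ) :
    (‖dirichletKernel N Q n‖ : ℂ) ^ 2 =
      ∑ j ∈ range Q, ∑ i ∈ range Q, (exp (2 * Real.pi * I / N) ^ ((j : ℤ) - i)) ^ n := by
  have hnorm : ‖exp (2 * Real.pi * I / N)‖ = 1 :=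
    (isPrimitiveRoot_exp N hN).norm'_eq_one hN
  rw [← Complex.ofReal_pow, ← normSq_eq_norm_sq, normSq_eq_conj_mul_self, dirichletKernel]
  simp only [map_sum, map_pow, ← Complex.inv_eq_conj hnorm]
  rw [sum_mul_sum, sum_comm]
  refine sum_congr rfl fun j _ => sum_congr rfl fun i _ => ?_
  rw [zpow_sub₀ (exp_ne_zero _), zpow_natCast, zpow_natCast, div_pow, inv_pow, inv_pow,
    ← div_eq_inv_mul]

/-- Only the diagonal frequencies survive, since the others exceed the spectrum of `f`. -/
theorem sum_mul_norm_dirichletKernel_sq {f : ℕ → ℝ} {m N Q : ℕ} (hf : Function.Periodic f m)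
    (hN : 0 < N) (hmN : m ∣ N) (hQ : Q * m ≤ N) :
    ∑ n ∈ range N, f n * ‖dirichletKernel N Q n‖ ^ 2 = Q * ∑ n ∈ range N, f n := by
  have hζ := isPrimitiveRoot_exp N hN.ne'
  set ζ := exp (2 * Real.pi * I / N)
  have hm : 0 < m := Nat.pos_of_dvd_of_pos hmN hN
  have hdiag : ∀ j ∈ range Q, ∑ i ∈ range Q, ∑ n ∈ range N, (f n : ℂ) * (ζ ^ ((j : ℤ) - i)) ^ n =
      ∑ n ∈ range N, (f n : ℂ) := by
    intro j hj
    rw [sum_eq_single_of_mem j hj]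
    · simp
    · intro i hi hne
      rw [mem_range] at hi hj
      have hlt : |(j : ℤ) - i| * m < N := by
        have : |(j : ℤ) - i| < Q := by rw [abs_lt]; lia
        exact (mul_lt_mul_of_pos_right this (by exact_mod_cast hm)).trans_le (by exact_mod_cast hQ)
      refine sum_range_mul_pow_eq_zero (fun n => by simp only [hf n]) hmN ?_
        (zpow_pow_ne_one hζ hm (by lia) hlt)
      rw [← zpow_natCast, ← zpow_mul, mul_comm, zpow_mul, zpow_natCast, hζ.pow_eq_one, one_zpow]
  have hcomplex : ∑ n ∈ range N, (f n : ℂ) * (‖dirichletKernel N Q n‖ : ℂ) ^ 2 =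
      Q * ∑ n ∈ range N, (f n : ℂ) := by
    simp only [norm_dirichletKernel_sq hN.ne', mul_sum]
    rw [sum_comm, sum_congr rfl fun j hj => sum_comm.trans (hdiag j hj), sum_const, card_range,
      nsmul_eq_mul, mul_sum]
  exact_mod_cast hcomplex

theorem half_le_norm_dirichletKernel {N Q n : ℕ} (hN : 0 < N) (h : 6 * (Q * n) ≤ N) :
    (Q : ℝ) / 2 ≤ ‖dirichletKernel N Q n‖ := by
  refine le_trans ?_ (re_le_norm _)
  rw [dirichletKernel, re_sum]
  have hterm : ∀ j ∈ range Q, (1 / 2 : ℝ) ≤ ((exp (2 * Real.pi * I / N) ^ j) ^ n).re := by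
    intro j hj
    have hangle : (exp (2 * Real.pi * I / N) ^ j) ^ n =
        exp ((2 * Real.pi * ((j * n : ℕ) / N : ℝ) : ℝ) * I) := by
      rw [← exp_nat_mul, ← exp_nat_mul]
      congr 1
      push_cast
      ring
    have hsixth : ((j * n : ℕ) : ℝ) / N ≤ 1 / 6 := by
      rw [div_le_div_iff₀ (by exact_mod_cast hN) (by norm_num)]
      have : j * n ≤ Q * n := Nat.mul_le_mul_right n (mem_range.1 hj).le
      exact_mod_cast (by lia : j * n * 6 ≤ 1 * N)
    rw [hangle, exp_ofReal_mul_I_re, ← Real.cos_pi_div_three]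
    refine Real.cos_le_cos_of_nonneg_of_le_pi (by positivity) ?_ ?_
    · linarith [Real.pi_pos]
    · nlinarith [Real.pi_pos]
  calc (Q : ℝ) / 2 = ∑ j ∈ range Q, (1 / 2 : ℝ) := by simp [div_eq_mul_inv]
    _ ≤ _ := sum_le_sum hterm

/-- Weighting by the squared Dirichlet kernel costs only a constant on `[0, X)` by positivity,
whereas over a full period it sees nothing but the mean. -/
theorem sum_range_le_expect_of_periodic {ι : Type*} (I : Finset ι) (G : ι → ℕ → ℝ) (m : ι → ℕ)
    {Q X : ℕ} (hQ : 0 < Q) (hper : ∀ i ∈ I, Function.Periodic (G i) (m i))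
    (hm : ∀ i ∈ I, m i ∣ Q ∧ m i ≤ X) (hG : ∀ n, 0 ≤ ∑ i ∈ I, G i n) :
    ∑ n ∈ range X, ∑ i ∈ I, G i n ≤ 24 * X * 𝔼 n ∈ range Q, ∑ i ∈ I, G i n := by
  rcases X.eq_zero_or_pos with rfl | hX
  · simp
  set F : ℕ → ℝ := fun n => ∑ i ∈ I, G i n
  set N := 6 * X * Q with hN
  have hNpos : 0 < N := by positivity
  have hFper : Function.Periodic F Q := fun n =>
    sum_congr rfl fun i hi => periodic_of_dvd (hper i hi) (hm i hi).1 n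
  have hweighted : ∑ n ∈ range N, F n * ‖dirichletKernel N Q n‖ ^ 2 = Q * ∑ n ∈ range N, F n := by
    simp only [F, sum_mul]
    rw [sum_comm, sum_comm (s := range N), mul_sum]
    refine sum_congr rfl fun i hi => sum_mul_norm_dirichletKernel_sq (hper i hi) hNpos
      ((hm i hi).1.mul_left _) ?_
    calc Q * m i ≤ Q * X := Nat.mul_le_mul_left Q (hm i hi).2
      _ ≤ N := by rw [hN]; nlinarith
  have hlower : ∀ n ∈ range X, ((Q : ℝ) / 2) ^ 2 ≤ ‖dirichletKernel N Q n‖ ^ 2 := by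
    intro n hn
    have hle : 6 * (Q * n) ≤ N := by
      rw [hN, mul_assoc, mul_comm X Q]
      exact Nat.mul_le_mul_left _ (Nat.mul_le_mul_left _ (mem_range.1 hn).le)
    exact pow_le_pow_left₀ (by positivity) (half_le_norm_dirichletKernel hNpos hle) 2
  have hcompare : ((Q : ℝ) / 2) ^ 2 * ∑ n ∈ range X, F n ≤ Q * ∑ n ∈ range N, F n := by
    calc ((Q : ℝ) / 2) ^ 2 * ∑ n ∈ range X, F n
        = ∑ n ∈ range X, F n * ((Q : ℝ) / 2) ^ 2 := by rw [mul_comm, sum_mul]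
      _ ≤ ∑ n ∈ range X, F n * ‖dirichletKernel N Q n‖ ^ 2 :=
          sum_le_sum fun n hn => mul_le_mul_of_nonneg_left (hlower n hn) (hG n)
      _ ≤ ∑ n ∈ range N, F n * ‖dirichletKernel N Q n‖ ^ 2 :=
          sum_le_sum_of_subset_of_nonneg (range_subset_range.2 (by rw [hN]; nlinarith))
            fun n _ _ => mul_nonneg (hG n) (by positivity)
      _ = Q * ∑ n ∈ range N, F n := hweighted
  rw [hN, sum_range_mul_of_periodic hFper] at hcompare
  push_cast at hcompare
  rw [expect_eq_sum_div_card, card_range]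
  calc ∑ n ∈ range X, F n ≤ Q * (6 * X * ∑ n ∈ range Q, F n) / ((Q : ℝ) / 2) ^ 2 := by
        rw [le_div_iff₀ (by positivity)]; linarith
    _ = 24 * X * ((∑ n ∈ range Q, F n) / Q) := by field_simp; ring

end LargeSieve

/-! ### Sieving by a finite set of primes -/

/-- The normalized fluctuation `(1_{p ∤ n} - (1 - 1/p)) / (1 - 1/p)` of the condition `p ∤ n`. -/
noncomputable def fluct (p n : ℕ) : ℝ := if p ∣ n then -1 else 1 / ((p : ℝ) - 1)

/-- The density of the integers that are free of prime factors in `s`. -/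
noncomputable def density (s : Finset ℕ) : ℝ := ∏ p ∈ s, (1 - 1 / (p : ℝ))

/-- The indicator of the integers that are free of prime factors in `s`. -/
noncomputable def rough (s : Finset ℕ) (n : ℕ) : ℝ := ∏ p ∈ s, if p ∣ n then 0 else 1

/-- The number of integers in `(n, n + H]` that are free of prime factors in `s`. -/
noncomputable def roughSum (s : Finset ℕ) (H n : ℕ) : ℝ := ∑ h ∈ Icc 1 H, rough s (n + h)

/-- The contribution of a set `t` of primes to the expansion of `roughSum` into fluctuations. -/
noncomputable def fluctSum (H : ℕ) (t : Finset ℕ) (n : ℕ) : ℝ :=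
  ∑ h ∈ Icc 1 H, ∏ p ∈ t, fluct p (n + h)

/-- The part of the expansion of `roughSum s` that comes from the sets of primes in the family `D`;
for `D = s.powerset` it is all of `roughSum s`. -/
noncomputable def truncatedSum (s : Finset ℕ) (D : Finset (Finset ℕ)) (H n : ℕ) : ℝ :=
  density s * ∑ t ∈ D, fluctSum H t n

/-- The variance of `roughSum s H` over a full period. -/
noncomputable def periodVariance (s : Finset ℕ) (H : ℕ) : ℝ :=
  𝔼 n ∈ range (∏ p ∈ s, p), (roughSum s H n - H * density s) ^ 2

theorem prod_primes_pos {s : Finset ℕ} (hs : ∀ p ∈ s, p.Prime) : 0 < ∏ p ∈ s, p :=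
  prod_pos fun p hp => (hs p hp).pos

theorem periodic_ite_dvd {A : Type*} (p : ℕ) (a b : A) :
    Function.Periodic (fun n => if p ∣ n then a else b) p := fun n => by
  simp only [Nat.dvd_add_self_right]

theorem expect_range_ite_dvd {p : ℕ} (hp : 0 < p) (a b : ℝ) :
    𝔼 n ∈ range p, (if p ∣ n then a else b) = b + (a - b) / p := by
  have hsplit : ∀ n ∈ range p, (if p ∣ n then a else b) = b + if n = 0 then a - b else 0 := by
    intro n hn
    simp only [Nat.dvd_iff_mod_eq_zero, Nat.mod_eq_of_lt (mem_range.1 hn)]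
    split_ifs <;> ring
  rw [expect_eq_sum_div_card, sum_congr rfl hsplit, sum_add_distrib, sum_ite_eq' (range p) 0,
    if_pos (mem_range.2 hp), sum_const, nsmul_eq_mul, card_range]
  field_simp

theorem fluct_periodic (p : ℕ) : Function.Periodic (fluct p) p := periodic_ite_dvd p _ _

theorem expect_fluct_add {p : ℕ} (hp : 1 < p) (h : ℕ) : 𝔼 n ∈ range p, fluct p (n + h) = 0 := by
  have hp1 : (p : ℝ) - 1 ≠ 0 := sub_ne_zero.2 (by exact_mod_cast hp.ne')
  have hp0 : (p : ℝ) ≠ 0 := by exact_mod_cast (zero_lt_one.trans hp).ne'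
  rw [expect_range_add_of_periodic (fluct_periodic p)]
  simp only [fluct, expect_range_ite_dvd (zero_lt_one.trans hp)]
  field_simp
  ring

theorem one_sub_inv_mul_one_add_fluct {p : ℕ} (hp : 1 < p) (n : ℕ) :
    (1 - 1 / (p : ℝ)) * (1 + fluct p n) = if p ∣ n then 0 else 1 := by
  have hp1 : (p : ℝ) - 1 ≠ 0 := sub_ne_zero.2 (by exact_mod_cast hp.ne')
  have hp0 : (p : ℝ) ≠ 0 := by exact_mod_cast (zero_lt_one.trans hp).ne'
  unfold fluct
  split_ifs
  · simp
  · field_simp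
    ring

theorem rough_eq_density_mul_sum_fluct {s : Finset ℕ} (hs : ∀ p ∈ s, 1 < p) (n : ℕ) :
    rough s n = density s * ∑ t ∈ s.powerset, ∏ p ∈ t, fluct p n := by
  rw [← prod_one_add, density, rough, ← prod_mul_distrib]
  exact prod_congr rfl fun p hp => (one_sub_inv_mul_one_add_fluct (hs p hp) n).symm

theorem roughSum_eq_truncatedSum {s : Finset ℕ} (hs : ∀ p ∈ s, 1 < p) (H n : ℕ) :
    roughSum s H n = truncatedSum s s.powerset H n := by
  simp only [roughSum, truncatedSum, fluctSum, rough_eq_density_mul_sum_fluct hs, ← mul_sum]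
  rw [sum_comm]

theorem truncatedSum_sub_eq {D : Finset (Finset ℕ)} (hD : ∅ ∈ D) (s : Finset ℕ) (H n : ℕ) :
    truncatedSum s D H n - H * density s = density s * ∑ t ∈ D.erase ∅, fluctSum H t n := by
  have hempty : fluctSum H ∅ n = H := by simp [fluctSum]
  rw [truncatedSum, ← add_sum_erase _ _ hD, hempty]
  ring

theorem fluctSum_periodic (H : ℕ) (t : Finset ℕ) :
    Function.Periodic (fluctSum H t) (∏ p ∈ t, p) := fun n =>
  sum_congr rfl fun h _ => by
    rw [add_right_comm]
    exact periodic_prod_prod (fun p _ => fluct_periodic p) _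

/-! ### Orthogonality of the fluctuations -/

theorem expect_prod_fluct_mul_prod_fluct {s t t' : Finset ℕ} (hs : ∀ p ∈ s, p.Prime)
    (ht : t ⊆ s) (ht' : t' ⊆ s) (hne : t ≠ t') (h h' : ℕ) :
    𝔼 n ∈ range (∏ p ∈ s, p), (∏ p ∈ t, fluct p (n + h)) * ∏ p ∈ t', fluct p (n + h') = 0 := by
  set f : ℕ → ℕ → ℝ := fun p n =>
    (if p ∈ t then fluct p (n + h) else 1) * (if p ∈ t' then fluct p (n + h') else 1) with hf
  have hfprod (n : ℕ) :
      (∏ p ∈ t, fluct p (n + h)) * ∏ p ∈ t', fluct p (n + h') = ∏ p ∈ s, f p n := by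
    rw [hf, prod_mul_distrib, prod_ite_mem, prod_ite_mem, inter_eq_right.2 ht, inter_eq_right.2 ht']
  have hfper : ∀ p ∈ s, Function.Periodic (f p) p := fun p _ n => by
    simp only [hf, add_right_comm n p, fluct_periodic p _]
  simp only [hfprod]
  rw [expect_prod_eq_prod_expect (pairwise_coprime_of_prime hs) hfper]
  obtain ⟨p, hp⟩ : ∃ p, ¬ (p ∈ t ↔ p ∈ t') := not_forall.1 (mt Finset.ext hne)
  by_cases hpt : p ∈ t
  · have hpt' : p ∉ t' := fun h => hp ⟨fun _ => h, fun _ => hpt⟩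
    refine prod_eq_zero (ht hpt) ?_
    simpa only [hf, if_pos hpt, if_neg hpt', mul_one] using
      expect_fluct_add (hs p (ht hpt)).one_lt h
  · have hpt' : p ∈ t' := by tauto
    refine prod_eq_zero (ht' hpt') ?_
    simpa only [hf, if_neg hpt, if_pos hpt', one_mul] using
      expect_fluct_add (hs p (ht' hpt')).one_lt h'

theorem expect_fluctSum_mul_fluctSum {s t t' : Finset ℕ} (hs : ∀ p ∈ s, p.Prime)
    (ht : t ⊆ s) (ht' : t' ⊆ s) (hne : t ≠ t') (H : ℕ) :
    𝔼 n ∈ range (∏ p ∈ s, p), fluctSum H t n * fluctSum H t' n = 0 := by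
  simp only [fluctSum, sum_mul_sum, expect_sum_comm]
  exact sum_eq_zero fun h _ => sum_eq_zero fun h' _ =>
    expect_prod_fluct_mul_prod_fluct hs ht ht' hne h h'

theorem expect_sq_sum_fluctSum {s : Finset ℕ} (hs : ∀ p ∈ s, p.Prime) (H : ℕ)
    {D : Finset (Finset ℕ)} (hD : D ⊆ s.powerset) :
    𝔼 n ∈ range (∏ p ∈ s, p), (∑ t ∈ D, fluctSum H t n) ^ 2 =
      ∑ t ∈ D, 𝔼 n ∈ range (∏ p ∈ s, p), fluctSum H t n ^ 2 := by
  simp only [sq, sum_mul_sum, expect_sum_comm]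
  exact sum_congr rfl fun t ht => sum_eq_single_of_mem t ht fun t' ht' hne =>
    expect_fluctSum_mul_fluctSum hs (mem_powerset.1 (hD ht)) (mem_powerset.1 (hD ht')) hne.symm H

/-- By orthogonality, discarding sets of primes from the expansion can only lower the variance. -/
theorem expect_sq_truncatedSum_sub_le {s : Finset ℕ} (hs : ∀ p ∈ s, p.Prime)
    {D : Finset (Finset ℕ)} (hD : D ⊆ s.powerset) (hempty : ∅ ∈ D) (H : ℕ) :
    𝔼 n ∈ range (∏ p ∈ s, p), (truncatedSum s D H n - H * density s) ^ 2 ≤ periodVariance s H := by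
  simp only [periodVariance, roughSum_eq_truncatedSum fun p hp => (hs p hp).one_lt,
    truncatedSum_sub_eq hempty, truncatedSum_sub_eq (empty_mem_powerset s), mul_pow, ← mul_expect]
  rw [expect_sq_sum_fluctSum hs H ((erase_subset _ _).trans hD),
    expect_sq_sum_fluctSum hs H (erase_subset _ _)]
  refine mul_le_mul_of_nonneg_left ?_ (sq_nonneg _)
  exact sum_le_sum_of_subset_of_nonneg (erase_subset_erase _ hD)
    fun t _ _ => expect_nonneg fun n _ => sq_nonneg _

theorem sum_range_sq_truncatedSum_sub_le {s : Finset ℕ} (hs : ∀ p ∈ s, p.Prime)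
    {D : Finset (Finset ℕ)} (hD : D ⊆ s.powerset) (hempty : ∅ ∈ D) (H : ℕ) {X : ℕ}
    (hDX : ∀ t ∈ D, ∀ t' ∈ D, (∏ p ∈ t, p) * ∏ p ∈ t', p ≤ X) :
    ∑ n ∈ range X, (truncatedSum s D H n - H * density s) ^ 2 ≤ 24 * X * periodVariance s H := by
  set E := D.erase ∅
  have hE {t : Finset ℕ} (ht : t ∈ E) : t ∈ D ∧ t ⊆ s :=
    have htD := mem_of_mem_erase ht
    ⟨htD, mem_powerset.1 (hD htD)⟩
  have hpos {t : Finset ℕ} (ht : t ∈ E) : 0 < ∏ p ∈ t, p :=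
    prod_primes_pos fun p hp => hs p ((hE ht).2 hp)
  have hsq (n : ℕ) : (truncatedSum s D H n - H * density s) ^ 2 =
      ∑ x ∈ E ×ˢ E, density s ^ 2 * (fluctSum H x.1 n * fluctSum H x.2 n) := by
    rw [truncatedSum_sub_eq hempty, mul_pow, ← mul_sum, sum_product, sq (∑ t ∈ E, _), sum_mul_sum]
  have hlarge := sum_range_le_expect_of_periodic (E ×ˢ E)
    (fun x n => density s ^ 2 * (fluctSum H x.1 n * fluctSum H x.2 n))
    (fun x => Nat.lcm (∏ p ∈ x.1, p) (∏ p ∈ x.2, p)) (X := X) (prod_primes_pos hs) ?_ ?_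
    fun n => by rw [← hsq]; positivity
  · simp only [← hsq] at hlarge
    exact hlarge.trans (mul_le_mul_of_nonneg_left
      (expect_sq_truncatedSum_sub_le hs hD hempty H) (by positivity))
  · rintro ⟨t, t'⟩ _ n
    simp only [periodic_of_dvd (fluctSum_periodic H t) (Nat.dvd_lcm_left _ _) n,
      periodic_of_dvd (fluctSum_periodic H t') (Nat.dvd_lcm_right _ _) n]
  · rintro ⟨t, t'⟩ hx
    rw [mem_product] at hx
    refine ⟨Nat.lcm_dvd (prod_dvd_prod_of_subset _ _ _ (hE hx.1).2)
      (prod_dvd_prod_of_subset _ _ _ (hE hx.2).2), ?_⟩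
    calc Nat.lcm (∏ p ∈ t, p) (∏ p ∈ t', p) ≤ (∏ p ∈ t, p) * ∏ p ∈ t', p :=
          Nat.le_of_dvd (Nat.mul_pos (hpos hx.1) (hpos hx.2)) (Nat.lcm_dvd_mul _ _)
      _ ≤ X := hDX _ (hE hx.1).1 _ (hE hx.2).1

/-! ### The variance over a full period -/

/-- The primes up to `y`. -/
def primesUpTo (y : ℕ) : Finset ℕ := (Icc 1 y).filter Nat.Prime

/-- The odd primes up to `y`, which index the product in `M`. -/
def oddPrimesUpTo (y : ℕ) : Finset ℕ := (Icc 3 y).filter Nat.Prime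

/-- The summand `{x} (1 - {x})` of `M`. -/
noncomputable def fractBump (x : ℝ) : ℝ := Int.fract x * (1 - Int.fract x)

theorem mem_primesUpTo {y p : ℕ} : p ∈ primesUpTo y ↔ p.Prime ∧ p ≤ y := by
  simp only [primesUpTo, mem_filter, mem_Icc]
  exact ⟨fun h => ⟨h.2, h.1.2⟩, fun h => ⟨⟨h.1.one_lt.le, h.2⟩, h.1⟩⟩

theorem prime_of_mem_primesUpTo {y : ℕ} : ∀ p ∈ primesUpTo y, p.Prime :=
  fun _ hp => (mem_primesUpTo.1 hp).1

theorem density_primesUpTo (y : ℕ) : density (primesUpTo y) = P y := rfl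

theorem mem_oddPrimesUpTo {y p : ℕ} : p ∈ oddPrimesUpTo y ↔ p.Prime ∧ 2 < p ∧ p ≤ y := by
  simp only [oddPrimesUpTo, mem_filter, mem_Icc]
  exact ⟨fun h => ⟨h.2, by omega, h.1.2⟩, fun h => ⟨⟨by omega, h.2.2⟩, h.1⟩⟩

theorem prime_of_mem_oddPrimesUpTo {y : ℕ} : ∀ p ∈ oddPrimesUpTo y, p.Prime :=
  fun _ hp => (mem_oddPrimesUpTo.1 hp).1

theorem two_lt_of_mem_oddPrimesUpTo {y p : ℕ} (hp : p ∈ oddPrimesUpTo y) : (2 : ℝ) < p := by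
  exact_mod_cast (mem_oddPrimesUpTo.1 hp).2.1

theorem two_notMem_oddPrimesUpTo (y : ℕ) : 2 ∉ oddPrimesUpTo y :=
  fun h => lt_irrefl 2 (mem_oddPrimesUpTo.1 h).2.1

theorem primesUpTo_eq_insert {y : ℕ} (hy : 2 ≤ y) :
    primesUpTo y = insert 2 (oddPrimesUpTo y) := by
  ext p
  simp only [mem_insert, mem_primesUpTo, mem_oddPrimesUpTo]
  constructor
  · rintro ⟨hp, hpy⟩
    exact hp.two_le.eq_or_lt'.imp_right fun h2p => ⟨hp, h2p, hpy⟩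
  · rintro (rfl | ⟨hp, -, hpy⟩)
    · exact ⟨Nat.prime_two, hy⟩
    · exact ⟨hp, hpy⟩

theorem P_eq_half_density_oddPrimesUpTo {y : ℕ} (hy : 2 ≤ y) :
    P y = 1 / 2 * density (oddPrimesUpTo y) := by
  rw [← density_primesUpTo, density, primesUpTo_eq_insert hy,
    prod_insert (two_notMem_oddPrimesUpTo y), density]
  norm_num

theorem fractBump_nonneg (x : ℝ) : 0 ≤ fractBump x :=
  mul_nonneg (Int.fract_nonneg _) (by linarith [Int.fract_lt_one x])

theorem prod_injOn_primes {s : Finset ℕ} (hs : ∀ p ∈ s, p.Prime) :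
    Set.InjOn (fun t : Finset ℕ => ∏ p ∈ t, p) (s.powerset : Set (Finset ℕ)) := by
  intro t ht t' ht' heq
  have heq' := congrArg Nat.primeFactors heq
  simp only at heq'
  rwa [Nat.primeFactors_prod fun p hp => hs p (mem_powerset.1 ht hp),
    Nat.primeFactors_prod fun p hp => hs p (mem_powerset.1 ht' hp)] at heq'

theorem squarefree_prod_primes {t : Finset ℕ} (ht : ∀ p ∈ t, p.Prime) :
    Squarefree (∏ p ∈ t, p) :=
  squarefree_prod_of_pairwise_isCoprime
    (fun _ hp _ hq hne => Nat.coprime_iff_isRelPrime.1 (pairwise_coprime_of_prime ht hp hq hne))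
    fun p hp => (ht p hp).squarefree

theorem g_prod_primes {y : ℕ} {t : Finset ℕ} (ht : t ⊆ oddPrimesUpTo y) :
    g y (∏ p ∈ t, p) = ∏ p ∈ t, (p : ℝ) / ((p : ℝ) - 2) := by
  have hp : ∀ p ∈ t, p.Prime := fun p hp => prime_of_mem_oddPrimesUpTo p (ht hp)
  rw [g, if_pos (squarefree_prod_primes hp), Nat.primeFactors_prod hp]
  exact prod_congr rfl fun p hp => if_pos (mem_oddPrimesUpTo.1 (ht hp)).2

theorem mem_image_prod_of_g_ne_zero {y n : ℕ} (hn : g y n ≠ 0) :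
    n ∈ (oddPrimesUpTo y).powerset.image fun t => ∏ p ∈ t, p := by
  have hsq : Squarefree n := by
    by_contra hsq
    exact hn (if_neg hsq)
  rw [g, if_pos hsq, prod_ne_zero_iff] at hn
  refine mem_image.2 ⟨n.primeFactors, mem_powerset.2 fun p hp => ?_,
    Nat.prod_primeFactors_of_squarefree hsq⟩
  exact mem_oddPrimesUpTo.2 ⟨Nat.prime_of_mem_primeFactors hp,
    by_contra fun hcon => hn p hp (if_neg hcon)⟩

theorem M_eq_sum (H y : ℕ) : M H y = (∏ p ∈ oddPrimesUpTo y, (1 - 2 / (p : ℝ))) *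
    ∑ t ∈ (oddPrimesUpTo y).powerset, (∏ p ∈ t, (p : ℝ) / ((p : ℝ) - 2)) *
      fractBump (H / (2 * ∏ p ∈ t, p : ℕ)) := by
  unfold M
  congr 1
  rw [tsum_eq_sum (s := (oddPrimesUpTo y).powerset.image fun t => ∏ p ∈ t, p),
    sum_image (prod_injOn_primes prime_of_mem_oddPrimesUpTo)]
  · refine sum_congr rfl fun t ht => ?_
    rw [g_prod_primes (mem_powerset.1 ht), Nat.cast_mul, Nat.cast_two]
    rfl
  · intro n hn
    rw [not_not.1 (mt mem_image_prod_of_g_ne_zero hn), zero_mul]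

theorem count_modEq_range (H v : ℕ) {m : ℕ} (hm : 0 < m) :
    (∑ h ∈ range H, if h ≡ v [MOD m] then 1 else 0) =
      H / m + if v % m < H % m then 1 else 0 := by
  rw [← card_filter, ← Nat.count_eq_card_filter_range, Nat.count_modEq_card H hm]

theorem card_range_filter_mod_lt (H : ℕ) {m : ℕ} (hm : 0 < m) :
    (∑ h ∈ range H, if h % m < H % m then (1 : ℝ) else 0) =
      (H / m : ℕ) * (H % m : ℕ) + (H % m : ℕ) := by
  have hper : Function.Periodic (fun h => if h % m < H % m then (1 : ℝ) else 0) m := fun h => by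
    simp only [Nat.add_mod_right]
  have hinit {n : ℕ} (hn : n ≤ m) (hHn : H % m ≤ n) :
      (∑ h ∈ range n, if h % m < H % m then (1 : ℝ) else 0) = (H % m : ℕ) := by
    have hmod : ∀ h ∈ range n, (if h % m < H % m then (1 : ℝ) else 0) =
        if h ∈ range (H % m) then 1 else 0 := fun h hh => by
      rw [Nat.mod_eq_of_lt ((mem_range.1 hh).trans_le hn)]
      simp only [mem_range]
    rw [sum_congr rfl hmod, sum_ite_mem, inter_eq_right.2 (range_mono hHn)]
    simp
  have hlt := Nat.mod_lt H hm
  conv_lhs => rw [← Nat.div_add_mod' H m]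
  rw [sum_range_add, Nat.div_add_mod' H m, sum_range_mul_of_periodic hper, hinit le_rfl hlt.le]
  simp only [add_comm (H / m * m), Nat.add_mul_mod_self_right]
  rw [hinit hlt.le le_rfl]

theorem sum_modEq (H : ℕ) {m : ℕ} (hm : 0 < m) :
    ∑ h ∈ Icc 1 H, ∑ h' ∈ Icc 1 H, (if h ≡ h' [MOD m] then (1 : ℝ) else 0) =
      (H : ℝ) ^ 2 / m + m * fractBump (H / m) := by
  have hshift (f : ℕ → ℝ) : ∑ h ∈ Icc 1 H, f h = ∑ h ∈ range H, f (h + 1) := by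
    rw [range_eq_Ico, sum_Ico_add' f 0 H 1, zero_add, Ico_add_one_right_eq_Icc]
  have hcount (h' : ℕ) : (∑ h ∈ range H, if h ≡ h' [MOD m] then (1 : ℝ) else 0) =
      (H / m : ℕ) + if h' % m < H % m then 1 else 0 := by
    exact_mod_cast congrArg (Nat.cast : ℕ → ℝ) (count_modEq_range H h' hm)
  have hmod : (H : ℝ) = m * (H / m : ℕ) + (H % m : ℕ) := by
    exact_mod_cast (Nat.div_add_mod H m).symm
  have hm' : (m : ℝ) ≠ 0 := by positivity
  rw [sum_comm]
  simp only [hshift, Nat.ModEq.add_iff_right (Nat.ModEq.refl 1), hcount]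
  rw [sum_add_distrib, card_range_filter_mod_lt H hm, sum_const, card_range, nsmul_eq_mul,
    fractBump, Int.fract_div_natCast_eq_div_natCast_mod]
  generalize ((H / m : ℕ) : ℝ) = q at *
  generalize ((H % m : ℕ) : ℝ) = r at *
  rw [hmod]
  field_simp
  ring

theorem expect_range_notDvd_mul_notDvd {p : ℕ} (hp : 0 < p) (h h' : ℕ) :
    𝔼 a ∈ range p, ((if p ∣ a + h then (0 : ℝ) else 1) * (if p ∣ a + h' then 0 else 1)) =
      1 - 2 / p + if h ≡ h' [MOD p] then 1 / (p : ℝ) else 0 := by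
  have hdvd (k : ℕ) : 𝔼 a ∈ range p, (if p ∣ a + k then (1 : ℝ) else 0) = 1 / p := by
    rw [expect_range_add_of_periodic (periodic_ite_dvd p (1 : ℝ) 0), expect_range_ite_dvd hp]
    ring
  have hincl (a : ℕ) : ((if p ∣ a + h then (0 : ℝ) else 1) * (if p ∣ a + h' then 0 else 1)) =
      1 - (if p ∣ a + h then (1 : ℝ) else 0) - (if p ∣ a + h' then (1 : ℝ) else 0) +
        (if h ≡ h' [MOD p] then 1 else 0) * (if p ∣ a + h then (1 : ℝ) else 0) := by
    have hiff : h ≡ h' [MOD p] → (p ∣ a + h ↔ p ∣ a + h') := fun hm =>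
      (Nat.ModEq.add_left a hm).dvd_iff dvd_rfl
    have hmod : p ∣ a + h → p ∣ a + h' → h ≡ h' [MOD p] := fun hd hd' =>
      Nat.ModEq.add_left_cancel' a
        ((Nat.modEq_zero_iff_dvd.2 hd).trans (Nat.modEq_zero_iff_dvd.2 hd').symm)
    split_ifs <;> first | tauto | norm_num
  simp only [hincl, expect_add_distrib, expect_sub_distrib, ← mul_expect, hdvd,
    expect_const (nonempty_range_iff.2 hp.ne')]
  split_ifs <;> ring

theorem modEq_prod_iff {t : Finset ℕ} (ht : (t : Set ℕ).Pairwise Nat.Coprime) (h h' : ℕ) :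
    h ≡ h' [MOD ∏ p ∈ t, p] ↔ ∀ p ∈ t, h ≡ h' [MOD p] := by
  induction t using Finset.induction_on with
  | empty => simp [Nat.modEq_one]
  | insert q t hq ih =>
    rw [coe_insert, Set.pairwise_insert_of_symm] at ht
    rw [prod_insert hq, ← Nat.modEq_and_modEq_iff_modEq_mul
      (Nat.Coprime.prod_right fun p hp => ht.2 p hp (ne_of_mem_of_not_mem hp hq).symm),
      ih ht.1, forall_mem_insert]

theorem expect_rough_mul_rough {s : Finset ℕ} (hs : ∀ p ∈ s, p.Prime) (h h' : ℕ) :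
    𝔼 n ∈ range (∏ p ∈ s, p), rough s (n + h) * rough s (n + h') =
      ∏ p ∈ s, (1 - 2 / (p : ℝ) + if h ≡ h' [MOD p] then 1 / (p : ℝ) else 0) := by
  have hper : ∀ p ∈ s, Function.Periodic (fun n =>
      (if p ∣ n + h then (0 : ℝ) else 1) * if p ∣ n + h' then 0 else 1) p := fun p _ n => by
    simp only [add_right_comm n p, Nat.dvd_add_self_right]
  simp only [rough, ← prod_mul_distrib]
  rw [expect_prod_eq_prod_expect (pairwise_coprime_of_prime hs) hper]
  exact prod_congr rfl fun p hp => expect_range_notDvd_mul_notDvd (hs p hp).pos h h'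

theorem expect_rough_primesUpTo_mul_rough {y : ℕ} (hy : 2 ≤ y) (h h' : ℕ) :
    𝔼 n ∈ range (∏ p ∈ primesUpTo y, p),
        rough (primesUpTo y) (n + h) * rough (primesUpTo y) (n + h') =
      (∏ p ∈ oddPrimesUpTo y, (1 - 2 / (p : ℝ))) / 2 * ∑ t ∈ (oddPrimesUpTo y).powerset,
        (∏ p ∈ t, 1 / ((p : ℝ) - 2)) * if h ≡ h' [MOD 2 * ∏ p ∈ t, p] then 1 else 0 := by
  have hfactor : ∀ p ∈ oddPrimesUpTo y,
      1 - 2 / (p : ℝ) + (if h ≡ h' [MOD p] then 1 / (p : ℝ) else 0) =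
        (1 - 2 / (p : ℝ)) * (1 + 1 / ((p : ℝ) - 2) * if h ≡ h' [MOD p] then 1 else 0) := by
    intro p hp
    have h2p := two_lt_of_mem_oddPrimesUpTo hp
    have hp2 : (p : ℝ) - 2 ≠ 0 := by linarith
    split_ifs
    · field_simp
    · ring
  have hmod : ∀ t ∈ (oddPrimesUpTo y).powerset,
      (if h ≡ h' [MOD 2] then (1 : ℝ) else 0) *
          ∏ p ∈ t, (1 / ((p : ℝ) - 2) * if h ≡ h' [MOD p] then 1 else 0) =
        (∏ p ∈ t, 1 / ((p : ℝ) - 2)) * if h ≡ h' [MOD 2 * ∏ p ∈ t, p] then 1 else 0 := by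
    intro t ht
    have h2t : 2 ∉ t := fun h => two_notMem_oddPrimesUpTo y (mem_powerset.1 ht h)
    have hprime : ∀ p ∈ insert 2 t, p.Prime := (forall_mem_insert _ _ _).2
      ⟨Nat.prime_two, fun p hp => prime_of_mem_oddPrimesUpTo p (mem_powerset.1 ht hp)⟩
    have hcrt := modEq_prod_iff (pairwise_coprime_of_prime hprime) h h'
    rw [prod_insert h2t, forall_mem_insert] at hcrt
    rw [prod_mul_distrib, mul_left_comm, prod_ite_zero]
    simp only [prod_const_one, hcrt, ite_and, ite_mul, one_mul, zero_mul]
  rw [expect_rough_mul_rough prime_of_mem_primesUpTo, primesUpTo_eq_insert hy,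
    prod_insert (two_notMem_oddPrimesUpTo y), prod_congr rfl hfactor, prod_mul_distrib,
    prod_one_add, ← sum_congr rfl hmod, ← mul_sum]
  split_ifs <;> push_cast <;> ring

theorem expect_rough_add {s : Finset ℕ} (hs : ∀ p ∈ s, p.Prime) (h : ℕ) :
    𝔼 n ∈ range (∏ p ∈ s, p), rough s (n + h) = density s := by
  rw [expect_range_add_of_periodic (f := rough s)
    (periodic_prod_prod fun p _ => periodic_ite_dvd p _ _)]
  unfold rough density
  rw [expect_prod_eq_prod_expect (pairwise_coprime_of_prime hs) fun p _ => periodic_ite_dvd p _ _]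
  refine prod_congr rfl fun p hp => ?_
  rw [expect_range_ite_dvd (hs p hp).pos]
  ring

theorem expect_roughSum {s : Finset ℕ} (hs : ∀ p ∈ s, p.Prime) (H : ℕ) :
    𝔼 n ∈ range (∏ p ∈ s, p), roughSum s H n = H * density s := by
  simp only [roughSum]
  rw [expect_sum_comm, sum_congr rfl fun h _ => expect_rough_add hs h, sum_const, Nat.card_Icc,
    Nat.add_sub_cancel, nsmul_eq_mul]

theorem expect_roughSum_sq (s : Finset ℕ) (H : ℕ) :
    𝔼 n ∈ range (∏ p ∈ s, p), roughSum s H n ^ 2 = ∑ h ∈ Icc 1 H, ∑ h' ∈ Icc 1 H,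
      𝔼 n ∈ range (∏ p ∈ s, p), rough s (n + h) * rough s (n + h') := by
  simp only [roughSum, sq, sum_mul_sum, expect_sum_comm]

theorem sum_modEq_two_mul_prod (H : ℕ) {t : Finset ℕ} (ht : ∀ p ∈ t, 0 < p) :
    ∑ h ∈ Icc 1 H, ∑ h' ∈ Icc 1 H,
        ((∏ p ∈ t, 1 / ((p : ℝ) - 2)) * if h ≡ h' [MOD 2 * ∏ p ∈ t, p] then 1 else 0) =
      (∏ p ∈ t, 1 / ((p : ℝ) * ((p : ℝ) - 2))) * ((H : ℝ) ^ 2 / 2) +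
        2 * ((∏ p ∈ t, (p : ℝ) / ((p : ℝ) - 2)) * fractBump (H / (2 * ∏ p ∈ t, p : ℕ))) := by
  have hpos : 0 < ∏ p ∈ t, p := prod_pos ht
  have hpos' : 0 < ((∏ p ∈ t, p : ℕ) : ℝ) := by exact_mod_cast hpos
  have hdiv : ∏ p ∈ t, 1 / ((p : ℝ) * ((p : ℝ) - 2)) =
      (∏ p ∈ t, 1 / ((p : ℝ) - 2)) / (∏ p ∈ t, p : ℕ) := by
    push_cast
    rw [← prod_div_distrib]
    exact prod_congr rfl fun p _ => by rw [div_div, mul_comm]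
  have hmul : ∏ p ∈ t, (p : ℝ) / ((p : ℝ) - 2) =
      (∏ p ∈ t, 1 / ((p : ℝ) - 2)) * (∏ p ∈ t, p : ℕ) := by
    push_cast
    rw [← prod_mul_distrib]
    exact prod_congr rfl fun p _ => by ring
  simp only [← mul_sum]
  rw [sum_modEq H (mul_pos two_pos hpos), hdiv, hmul]
  push_cast at hpos' ⊢
  field_simp

theorem prod_one_sub_two_div_mul_prod (y : ℕ) :
    (∏ p ∈ oddPrimesUpTo y, (1 - 2 / (p : ℝ))) *
        ∏ p ∈ oddPrimesUpTo y, (1 + 1 / ((p : ℝ) * ((p : ℝ) - 2))) =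
      density (oddPrimesUpTo y) ^ 2 := by
  rw [density, ← prod_mul_distrib, ← prod_pow]
  refine prod_congr rfl fun p hp => ?_
  have h2p := two_lt_of_mem_oddPrimesUpTo hp
  have hp2 : (p : ℝ) - 2 ≠ 0 := by linarith
  field_simp
  ring

theorem expect_roughSum_primesUpTo_sq {y : ℕ} (hy : 2 ≤ y) (H : ℕ) :
    𝔼 n ∈ range (∏ p ∈ primesUpTo y, p), roughSum (primesUpTo y) H n ^ 2 =
      M H y + (H * P y) ^ 2 := by
  rw [expect_roughSum_sq]
  simp only [expect_rough_primesUpTo_mul_rough hy, ← mul_sum]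
  rw [sum_congr rfl fun h _ => sum_comm, sum_comm]
  rw [sum_congr rfl fun t ht => sum_modEq_two_mul_prod H fun p hp =>
    (prime_of_mem_oddPrimesUpTo p (mem_powerset.1 ht hp)).pos]
  rw [sum_add_distrib, ← sum_mul, ← mul_sum, ← prod_one_add, M_eq_sum,
    P_eq_half_density_oddPrimesUpTo hy]
  linear_combination ((H : ℝ) ^ 2 / 4) * prod_one_sub_two_div_mul_prod y

theorem periodVariance_primesUpTo {y : ℕ} (hy : 2 ≤ y) (H : ℕ) :
    periodVariance (primesUpTo y) H = M H y := by
  have hmean := expect_roughSum (prime_of_mem_primesUpTo (y := y)) H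
  have hsq := expect_roughSum_primesUpTo_sq hy H
  rw [density_primesUpTo] at hmean
  have hne := nonempty_range_iff.2 (prod_primes_pos (prime_of_mem_primesUpTo (y := y))).ne'
  simp only [periodVariance, density_primesUpTo, sub_sq, expect_add_distrib, expect_sub_distrib,
    ← expect_mul, ← mul_expect, hmean, hsq, expect_const hne]
  ring

/-! ### Truncation of the sieve by Rankin's trick -/

/-- The sum of `d ^ σ` over the divisors `d ≤ B` of `n` that are products of distinct primes
in `s`. -/
noncomputable def divisorPowerSum (s : Finset ℕ) (B σ : ℝ) (n : ℕ) : ℝ :=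
  ∑ d ∈ {p ∈ s | p ∣ n}.powerset with ((∏ p ∈ d, p : ℕ) : ℝ) ≤ B, ((∏ p ∈ d, p : ℕ) : ℝ) ^ σ

/-- The truncation at level `D` of the expansion of `rough s` into fluctuations. -/
noncomputable def truncatedRough (s : Finset ℕ) (D : ℝ) (n : ℕ) : ℝ :=
  density s * ∑ t ∈ s.powerset with ((∏ p ∈ t, p : ℕ) : ℝ) ≤ D, ∏ p ∈ t, fluct p n

/-- Rankin's upper bound, with exponent `σ`, for the total weight that the expansion of `rough s`
into fluctuations gives to the sets of primes with product `> D`. -/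
noncomputable def rankinWeight (s : Finset ℕ) (D σ : ℝ) : ℝ :=
  D ^ (-σ) * ∏ p ∈ s, (1 + (p : ℝ) ^ σ / ((p : ℝ) - 1))

/-- Rankin's upper bound, with exponent `σ`, for the mean of `|rough s - truncatedRough s D|`. -/
noncomputable def rankinError (s : Finset ℕ) (D σ : ℝ) : ℝ :=
  rankinWeight s D σ * ∏ p ∈ s, (1 + (p : ℝ) ^ (σ - 1))

theorem one_sub_one_div_natCast_nonneg (p : ℕ) : (0 : ℝ) ≤ 1 - 1 / (p : ℝ) := by
  rw [one_div]
  exact sub_nonneg.2 (Nat.cast_inv_le_one p)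

theorem density_nonneg (s : Finset ℕ) : 0 ≤ density s :=
  prod_nonneg fun p _ => one_sub_one_div_natCast_nonneg p

theorem density_le_one (s : Finset ℕ) : density s ≤ 1 :=
  prod_le_one (fun p _ => one_sub_one_div_natCast_nonneg p) fun _ _ =>
    sub_le_self _ (by positivity)

theorem density_pos {s : Finset ℕ} (hs : ∀ p ∈ s, 1 < p) : 0 < density s := by
  refine prod_pos fun p hp => sub_pos.2 ?_
  have hp1 : (1 : ℝ) < p := by exact_mod_cast hs p hp
  exact (div_lt_one (by linarith)).2 hp1

theorem rough_nonneg (s : Finset ℕ) (n : ℕ) : 0 ≤ rough s n :=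
  prod_nonneg fun p _ => by split_ifs <;> norm_num

theorem rough_le_one (s : Finset ℕ) (n : ℕ) : rough s n ≤ 1 :=
  prod_le_one (fun p _ => by split_ifs <;> norm_num) fun p _ => by split_ifs <;> norm_num

theorem divisorPowerSum_nonneg (s : Finset ℕ) (B σ : ℝ) (n : ℕ) : 0 ≤ divisorPowerSum s B σ n :=
  sum_nonneg fun d _ => by positivity

theorem one_le_prod_one_add_rpow_div {s : Finset ℕ} (hs : ∀ p ∈ s, 1 < p) (σ : ℝ) :
    1 ≤ ∏ p ∈ s, (1 + (p : ℝ) ^ σ / ((p : ℝ) - 1)) := by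
  refine one_le_prod fun p hp => ?_
  have hp1 : (0 : ℝ) < (p : ℝ) - 1 := sub_pos.2 (by exact_mod_cast hs p hp)
  exact le_add_of_nonneg_right (by positivity)

theorem rankinWeight_nonneg {s : Finset ℕ} (hs : ∀ p ∈ s, 1 < p) {D : ℝ} (hD : 0 ≤ D) (σ : ℝ) :
    0 ≤ rankinWeight s D σ :=
  mul_nonneg (by positivity) (zero_le_one.trans (one_le_prod_one_add_rpow_div hs σ))

theorem rankinError_nonneg {s : Finset ℕ} (hs : ∀ p ∈ s, 1 < p) {D : ℝ} (hD : 0 ≤ D) (σ : ℝ) :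
    0 ≤ rankinError s D σ :=
  mul_nonneg (rankinWeight_nonneg hs hD σ) (by positivity)

theorem one_le_rpow_neg_mul_rpow {T x σ : ℝ} (hT : 0 < T) (hTx : T ≤ x) (hσ : 0 ≤ σ) :
    1 ≤ T ^ (-σ) * x ^ σ := by
  rw [Real.rpow_neg hT.le, inv_mul_eq_div, one_le_div (Real.rpow_pos_of_pos hT σ)]
  exact Real.rpow_le_rpow hT.le hTx hσ

/-- The sets `a` and `insert q a` have opposite signs, so only those `a` count for which `T`
separates the products over `a` and over `insert q a`; the latter is then at most `q * T`. -/
theorem abs_sum_neg_one_pow_card_le {s : Finset ℕ} {T B σ : ℝ} (hs : ∀ p ∈ s, 0 < p) (hT : 0 < T)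
    (hB : 1 ≤ B) (hsB : ∀ p ∈ s, p * T ≤ B) (hσ : 0 ≤ σ) :
    |∑ a ∈ s.powerset with T < (∏ p ∈ a, p : ℕ), (-1 : ℝ) ^ a.card| ≤
      T ^ (-σ) * ∑ d ∈ s.powerset with ((∏ p ∈ d, p : ℕ) : ℝ) ≤ B,
        ((∏ p ∈ d, p : ℕ) : ℝ) ^ σ := by
  set w : Finset ℕ → ℝ := fun d =>
    if ((∏ p ∈ d, p : ℕ) : ℝ) ≤ B then T ^ (-σ) * ((∏ p ∈ d, p : ℕ) : ℝ) ^ σ else 0 with hw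
  have hw_nonneg (d : Finset ℕ) : 0 ≤ w d := by
    simp only [hw]
    split_ifs <;> positivity
  have hone_le {d : Finset ℕ} (hTd : T < (∏ p ∈ d, p : ℕ)) (hdB : ((∏ p ∈ d, p : ℕ) : ℝ) ≤ B) :
      1 ≤ w d := by
    simp only [hw, if_pos hdB]
    exact one_le_rpow_neg_mul_rpow hT hTd.le hσ
  rw [mul_sum, sum_filter, sum_filter]
  rcases s.eq_empty_or_nonempty with rfl | ⟨q, hqs⟩
  · rw [powerset_empty, sum_singleton, sum_singleton]
    split_ifs with hTd hdB hdB
    · simpa using one_le_rpow_neg_mul_rpow hT hTd.le hσ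
    · exact absurd (by simpa using hB) hdB
    · simp only [abs_zero]; positivity
    · simp
  · obtain ⟨s, hq, rfl⟩ : ∃ s', q ∉ s' ∧ insert q s' = s :=
      ⟨s.erase q, notMem_erase q s, insert_erase hqs⟩
    rw [sum_powerset_insert hq, sum_powerset_insert hq, ← sum_add_distrib]
    refine (abs_sum_le_sum_abs _ _).trans (le_add_of_nonneg_of_le
      (sum_nonneg fun d _ => hw_nonneg d) (sum_le_sum fun a ha => ?_))
    have hqa : q ∉ a := fun h => hq (mem_powerset.1 ha h)
    have hprod : ((∏ p ∈ insert q a, p : ℕ) : ℝ) = q * (∏ p ∈ a, p : ℕ) := by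
      rw [prod_insert hqa, Nat.cast_mul]
    have hq1 : (1 : ℝ) ≤ q := by exact_mod_cast hs q hqs
    rw [card_insert_of_notMem hqa, pow_succ]
    by_cases hTa : T < (∏ p ∈ a, p : ℕ)
    · have hTqa : T < (∏ p ∈ insert q a, p : ℕ) := by
        rw [hprod]
        exact hTa.trans_le (le_mul_of_one_le_left (Nat.cast_nonneg _) hq1)
      rw [if_pos hTa, if_pos hTqa, mul_neg_one, add_neg_cancel, abs_zero]
      exact hw_nonneg _
    · by_cases hTqa : T < (∏ p ∈ insert q a, p : ℕ)
      · rw [if_neg hTa, if_pos hTqa, zero_add, mul_neg_one, abs_neg, abs_pow, abs_neg, abs_one,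
          one_pow]
        refine hone_le hTqa (hprod.trans_le (le_trans ?_ (hsB q hqs)))
        exact mul_le_mul_of_nonneg_left (not_lt.1 hTa) (by positivity)
      · rw [if_neg hTa, if_neg hTqa, add_zero, abs_zero]
        exact hw_nonneg _

theorem cast_prod_rpow (t : Finset ℕ) (σ : ℝ) :
    ((∏ p ∈ t, p : ℕ) : ℝ) ^ σ = ∏ p ∈ t, (p : ℝ) ^ σ := by
  rw [Nat.cast_prod, Real.finsetProd_rpow _ _ fun p _ => by positivity]

theorem union_injOn_powerset_product {A : Type*} [DecidableEq A] {s₁ s₂ : Finset A}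
    (hdisj : Disjoint s₁ s₂) :
    Set.InjOn (fun x : Finset A × Finset A => x.1 ∪ x.2) (s₁.powerset ×ˢ s₂.powerset) := by
  rintro ⟨a, b⟩ hab ⟨a', b'⟩ hab' heq
  simp only [Set.mem_prod, mem_coe, mem_powerset] at hab hab' heq
  have hleft {a b : Finset A} (ha : a ⊆ s₁) (hb : b ⊆ s₂) : (a ∪ b) ∩ s₁ = a := by
    rw [union_inter_distrib_right, inter_eq_left.2 ha,
      disjoint_iff_inter_eq_empty.1 (disjoint_of_subset_left hb hdisj.symm), union_empty]
  have hright {a b : Finset A} (ha : a ⊆ s₁) (hb : b ⊆ s₂) : (a ∪ b) ∩ s₂ = b := by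
    rw [union_inter_distrib_right, inter_eq_left.2 hb,
      disjoint_iff_inter_eq_empty.1 (disjoint_of_subset_left ha hdisj), empty_union]
  exact Prod.ext (by rw [← hleft hab.1 hab.2, heq, hleft hab'.1 hab'.2])
    (by rw [← hright hab.1 hab.2, heq, hright hab'.1 hab'.2])

theorem sum_powerset_union {A : Type*} [DecidableEq A] {s₁ s₂ : Finset A} (hdisj : Disjoint s₁ s₂)
    (f : Finset A → ℝ) :
    ∑ t ∈ (s₁ ∪ s₂).powerset, f t = ∑ a ∈ s₁.powerset, ∑ b ∈ s₂.powerset, f (a ∪ b) := by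
  have himage : (s₁ ∪ s₂).powerset = (s₁.powerset ×ˢ s₂.powerset).image fun x => x.1 ∪ x.2 := by
    ext t
    simp only [mem_image, mem_product, mem_powerset, Prod.exists]
    refine ⟨fun ht => ⟨t ∩ s₁, t ∩ s₂, ⟨inter_subset_right, inter_subset_right⟩, ?_⟩, ?_⟩
    · rw [← inter_union_distrib_left, inter_eq_left.2 ht]
    · rintro ⟨a, b, ⟨ha, hb⟩, rfl⟩
      exact union_subset_union ha hb
  rw [himage, sum_image (by exact_mod_cast union_injOn_powerset_product hdisj), sum_product]

theorem prod_primes_dvd_iff {d : Finset ℕ} (hd : ∀ p ∈ d, p.Prime) (n : ℕ) :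
    ∏ p ∈ d, p ∣ n ↔ ∀ p ∈ d, p ∣ n :=
  ⟨fun h _ hp => (dvd_prod_of_mem _ hp).trans h,
    prod_primes_dvd n fun p hp => (hd p hp).prime⟩

theorem sum_powerset_filter_dvd {s : Finset ℕ} (hs : ∀ p ∈ s, p.Prime) (f : Finset ℕ → ℝ) (n : ℕ) :
    ∑ d ∈ {p ∈ s | p ∣ n}.powerset, f d =
      ∑ d ∈ s.powerset, if ∏ p ∈ d, p ∣ n then f d else 0 := by
  rw [← sum_filter]
  refine sum_congr (ext fun d => ?_) fun _ _ => rfl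
  rw [mem_filter, mem_powerset, mem_powerset]
  simp only [subset_iff, mem_filter, imp_and, forall_and]
  exact and_congr_right fun hd => (prod_primes_dvd_iff (fun p hp => hs p (hd p hp)) n).symm

theorem rough_sub_truncatedRough_eq {s : Finset ℕ} (hs : ∀ p ∈ s, 1 < p) (D : ℝ) (n : ℕ) :
    rough s n - truncatedRough s D n = density s *
      ∑ b ∈ {p ∈ s | ¬ p ∣ n}.powerset, (∏ p ∈ b, 1 / ((p : ℝ) - 1)) *
        ∑ a ∈ {p ∈ s | p ∣ n}.powerset with D / (∏ p ∈ b, p : ℕ) < (∏ p ∈ a, p : ℕ),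
          (-1 : ℝ) ^ a.card := by
  rw [rough_eq_density_mul_sum_fluct hs, truncatedRough, ← mul_sub,
    ← sum_filter_add_sum_filter_not s.powerset fun t => ((∏ p ∈ t, p : ℕ) : ℝ) ≤ D,
    add_sub_cancel_left, sum_filter, ← filter_union_filter_not_eq (· ∣ n) s,
    sum_powerset_union (disjoint_filter_filter_not s s (· ∣ n)), sum_comm,
    filter_union_filter_not_eq]
  refine congrArg _ (sum_congr rfl fun b hb => ?_)
  rw [sum_filter, mul_sum]
  refine sum_congr rfl fun a ha => ?_
  have hb := mem_powerset.1 hb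
  have ha := mem_powerset.1 ha
  have hdisj : Disjoint a b :=
    disjoint_of_subset_left ha (disjoint_of_subset_right hb (disjoint_filter_filter_not s s _))
  have hbpos : 0 < ((∏ p ∈ b, p : ℕ) : ℝ) := by
    exact_mod_cast prod_pos fun p hp => zero_lt_one.trans (hs p (mem_filter.1 (hb hp)).1)
  have hdvd : ∏ p ∈ a, fluct p n = (-1) ^ a.card := by
    rw [← prod_const]
    exact prod_congr rfl fun p hp => if_pos (mem_filter.1 (ha hp)).2
  have hnotDvd : ∏ p ∈ b, fluct p n = ∏ p ∈ b, 1 / ((p : ℝ) - 1) :=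
    prod_congr rfl fun p hp => if_neg (mem_filter.1 (hb hp)).2
  simp only [prod_union hdisj, hdvd, hnotDvd, Nat.cast_mul, div_lt_iff₀ hbpos, not_le]
  split_ifs <;> ring

theorem abs_rough_sub_truncatedRough_le {s : Finset ℕ} (hs : ∀ p ∈ s, 1 < p) {B D σ : ℝ}
    (hD : 0 < D) (hB : 1 ≤ B) (hsB : ∀ p ∈ s, p * D ≤ B) (hσ : 0 ≤ σ) (n : ℕ) :
    |rough s n - truncatedRough s D n| ≤
      density s * rankinWeight s D σ * divisorPowerSum s B σ n := by
  have hpos : ∀ p ∈ s, 0 < p := fun p hp => zero_lt_one.trans (hs p hp)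
  have hsub_pos : ∀ p ∈ s, (0 : ℝ) < (p : ℝ) - 1 := fun p hp =>
    sub_pos.2 (by exact_mod_cast hs p hp)
  have hinner : ∀ b ∈ {p ∈ s | ¬ p ∣ n}.powerset, |(∏ p ∈ b, 1 / ((p : ℝ) - 1)) *
        ∑ a ∈ {p ∈ s | p ∣ n}.powerset with D / (∏ p ∈ b, p : ℕ) < (∏ p ∈ a, p : ℕ),
          (-1 : ℝ) ^ a.card| ≤
      (∏ p ∈ b, (p : ℝ) ^ σ / ((p : ℝ) - 1)) * (D ^ (-σ) * divisorPowerSum s B σ n) := by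
    intro b hb
    have hbs : ∀ p ∈ b, p ∈ s := fun p hp => (mem_filter.1 (mem_powerset.1 hb hp)).1
    have hone : (1 : ℝ) ≤ (∏ p ∈ b, p : ℕ) := by
      exact_mod_cast Nat.succ_le_of_lt (prod_pos fun p hp => hpos p (hbs p hp))
    have hweight : 0 ≤ ∏ p ∈ b, 1 / ((p : ℝ) - 1) :=
      prod_nonneg fun p hp => (one_div_pos.2 (hsub_pos p (hbs p hp))).le
    have hcancel := abs_sum_neg_one_pow_card_le (s := {p ∈ s | p ∣ n})
      (fun p hp => hpos p (mem_filter.1 hp).1) (div_pos hD (zero_lt_one.trans_le hone)) hB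
      (fun p hp => (mul_le_mul_of_nonneg_left (div_le_self hD.le hone) (Nat.cast_nonneg p)).trans
        (hsB p (mem_filter.1 hp).1)) hσ
    have hrpow : (D / (∏ p ∈ b, p : ℕ)) ^ (-σ) = D ^ (-σ) * ∏ p ∈ b, (p : ℝ) ^ σ := by
      rw [Real.div_rpow hD.le (Nat.cast_nonneg _), Real.rpow_neg (Nat.cast_nonneg _),
        div_inv_eq_mul, cast_prod_rpow]
    rw [abs_mul, abs_of_nonneg hweight]
    refine (mul_le_mul_of_nonneg_left hcancel hweight).trans_eq ?_
    simp only [div_eq_mul_one_div (_ ^ σ), prod_mul_distrib, divisorPowerSum, hrpow]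
    ring
  have hprod : ∑ b ∈ {p ∈ s | ¬ p ∣ n}.powerset, ∏ p ∈ b, (p : ℝ) ^ σ / ((p : ℝ) - 1) ≤
      ∏ p ∈ s, (1 + (p : ℝ) ^ σ / ((p : ℝ) - 1)) := by
    rw [prod_one_add]
    refine sum_le_sum_of_subset_of_nonneg (powerset_mono.2 (filter_subset _ _)) fun b hb _ => ?_
    exact prod_nonneg fun p hp => div_nonneg (by positivity) (hsub_pos p (mem_powerset.1 hb hp)).le
  rw [rough_sub_truncatedRough_eq hs, abs_mul, abs_of_nonneg (density_nonneg s), mul_assoc]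
  refine mul_le_mul_of_nonneg_left ?_ (density_nonneg s)
  refine ((abs_sum_le_sum_abs _ _).trans (sum_le_sum hinner)).trans ?_
  rw [← sum_mul, rankinWeight]
  refine (mul_le_mul_of_nonneg_right hprod
    (mul_nonneg (by positivity) (divisorPowerSum_nonneg _ _ _ _))).trans_eq ?_
  ring

theorem sum_Icc_ite_dvd_le {c : ℝ} (hc : 0 ≤ c) (N m : ℕ) :
    ∑ n ∈ Icc 1 N, (if m ∣ n then c else 0) ≤ N * (c / m) := by
  have hcard : #{n ∈ Icc 1 N | m ∣ n} = N / m := Nat.Ioc_filter_dvd_card_eq_div N m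
  rw [← sum_filter, sum_const, hcard, nsmul_eq_mul]
  exact (mul_le_mul_of_nonneg_right Nat.cast_div_le hc).trans_eq (by ring)

theorem prod_one_add_ite_dvd {s : Finset ℕ} (hs : ∀ p ∈ s, p.Prime) (u : ℕ → ℝ) (n : ℕ) :
    ∏ p ∈ s, (1 + if p ∣ n then u p else 0) =
      ∑ d ∈ s.powerset, if ∏ p ∈ d, p ∣ n then ∏ p ∈ d, u p else 0 := by
  rw [prod_one_add]
  refine sum_congr rfl fun d hd => ?_
  rw [prod_ite_zero]
  exact if_congr (prod_primes_dvd_iff (fun p hp => hs p (mem_powerset.1 hd hp)) n).symm rfl rfl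

theorem sum_Icc_prod_one_add_ite_dvd_le {s : Finset ℕ} (hs : ∀ p ∈ s, p.Prime) {u : ℕ → ℝ}
    (hu : ∀ p ∈ s, 0 ≤ u p) (N : ℕ) :
    ∑ n ∈ Icc 1 N, ∏ p ∈ s, (1 + if p ∣ n then u p else 0) ≤ N * ∏ p ∈ s, (1 + u p / p) := by
  simp only [prod_one_add_ite_dvd hs]
  rw [sum_comm, prod_one_add, mul_sum]
  refine sum_le_sum fun d hd => ?_
  rw [prod_div_distrib, ← Nat.cast_prod]
  exact sum_Icc_ite_dvd_le (prod_nonneg fun p hp => hu p (mem_powerset.1 hd hp)) _ _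

theorem divisorPowerSum_le_prod (s : Finset ℕ) (B σ : ℝ) (n : ℕ) :
    divisorPowerSum s B σ n ≤ ∏ p ∈ s, (1 + if p ∣ n then (p : ℝ) ^ σ else 0) := by
  calc divisorPowerSum s B σ n
      ≤ ∑ d ∈ {p ∈ s | p ∣ n}.powerset, ((∏ p ∈ d, p : ℕ) : ℝ) ^ σ :=
        sum_le_sum_of_subset_of_nonneg (filter_subset _ _) fun d _ _ => by positivity
    _ = ∏ p ∈ s with p ∣ n, (1 + (p : ℝ) ^ σ) := by
        simp only [cast_prod_rpow, prod_one_add]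
    _ = _ := by
        rw [prod_filter]
        exact prod_congr rfl fun p _ => by split_ifs <;> ring

theorem natCast_rpow_sub_one_eq_div {p : ℕ} (hp : 0 < p) (σ : ℝ) :
    (p : ℝ) ^ (σ - 1) = (p : ℝ) ^ σ / p :=
  Real.rpow_sub_one (Nat.cast_ne_zero.2 hp.ne') σ

theorem prod_one_add_rpow_sub_one {s : Finset ℕ} (hs : ∀ p ∈ s, 0 < p) (σ : ℝ) :
    ∏ p ∈ s, (1 + (p : ℝ) ^ (σ - 1)) =
      ∑ d ∈ s.powerset, ((∏ p ∈ d, p : ℕ) : ℝ) ^ σ / (∏ p ∈ d, p : ℕ) := by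
  rw [prod_one_add]
  refine sum_congr rfl fun d hd => ?_
  rw [cast_prod_rpow, Nat.cast_prod, ← prod_div_distrib]
  exact prod_congr rfl fun p hp => natCast_rpow_sub_one_eq_div (hs p (mem_powerset.1 hd hp)) σ

theorem sum_divisorPowerSum_le {s : Finset ℕ} (hs : ∀ p ∈ s, p.Prime) (B σ : ℝ) (N : ℕ) :
    ∑ n ∈ Icc 1 N, divisorPowerSum s B σ n ≤ N * ∏ p ∈ s, (1 + (p : ℝ) ^ (σ - 1)) := by
  refine (sum_le_sum fun n _ => divisorPowerSum_le_prod s B σ n).trans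
    ((sum_Icc_prod_one_add_ite_dvd_le hs (fun p _ => by positivity) N).trans_eq ?_)
  exact congrArg _ (prod_congr rfl fun p hp => by
    rw [natCast_rpow_sub_one_eq_div (hs p hp).pos])

theorem sum_divisorPowerSum_mul_le {s₁ s₂ : Finset ℕ} (hs₁ : ∀ p ∈ s₁, p.Prime)
    (hs₂ : ∀ p ∈ s₂, p.Prime) (hdisj : Disjoint s₁ s₂) (B₁ B₂ σ₁ σ₂ : ℝ) (N : ℕ) :
    ∑ n ∈ Icc 1 N, divisorPowerSum s₁ B₁ σ₁ n * divisorPowerSum s₂ B₂ σ₂ n ≤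
      N * ((∏ p ∈ s₁, (1 + (p : ℝ) ^ (σ₁ - 1))) * ∏ p ∈ s₂, (1 + (p : ℝ) ^ (σ₂ - 1))) := by
  set σ : ℕ → ℝ := fun p => if p ∈ s₁ then σ₁ else σ₂
  have hσ₁ : ∀ p ∈ s₁, σ p = σ₁ := fun p hp => if_pos hp
  have hσ₂ : ∀ p ∈ s₂, σ p = σ₂ := fun p hp => if_neg (disjoint_right.1 hdisj hp)
  have hs : ∀ p ∈ s₁ ∪ s₂, p.Prime := fun p hp => (mem_union.1 hp).elim (hs₁ p) (hs₂ p)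
  have hpointwise (n : ℕ) : divisorPowerSum s₁ B₁ σ₁ n * divisorPowerSum s₂ B₂ σ₂ n ≤
      ∏ p ∈ s₁ ∪ s₂, (1 + if p ∣ n then (p : ℝ) ^ σ p else 0) := by
    rw [prod_union hdisj]
    refine mul_le_mul ((divisorPowerSum_le_prod s₁ B₁ σ₁ n).trans_eq ?_)
      ((divisorPowerSum_le_prod s₂ B₂ σ₂ n).trans_eq ?_) (divisorPowerSum_nonneg _ _ _ _)
      (prod_nonneg fun p _ => by positivity)
    · exact prod_congr rfl fun p hp => by rw [hσ₁ p hp]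
    · exact prod_congr rfl fun p hp => by rw [hσ₂ p hp]
  refine (sum_le_sum fun n _ => hpointwise n).trans
    ((sum_Icc_prod_one_add_ite_dvd_le hs (fun p _ => by positivity) N).trans_eq ?_)
  rw [prod_union hdisj]
  refine congrArg _ (congrArg₂ _ (prod_congr rfl fun p hp => ?_) (prod_congr rfl fun p hp => ?_))
  · rw [hσ₁ p hp, natCast_rpow_sub_one_eq_div (hs₁ p hp).pos]
  · rw [hσ₂ p hp, natCast_rpow_sub_one_eq_div (hs₂ p hp).pos]

/-! ### An upper bound sieve -/

theorem rough_eq_sum_neg_one_pow {s : Finset ℕ} (hs : ∀ p ∈ s, p.Prime) (n : ℕ) :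
    rough s n = ∑ d ∈ s.powerset, if ∏ p ∈ d, p ∣ n then (-1 : ℝ) ^ d.card else 0 := by
  have hprod : rough s n = ∏ p ∈ s, (1 + if p ∣ n then (-1 : ℝ) else 0) :=
    prod_congr rfl fun p _ => by split_ifs <;> norm_num
  simp only [hprod, prod_one_add_ite_dvd hs, prod_const]

theorem rough_le_truncated_sum_add {s : Finset ℕ} (hs : ∀ p ∈ s, p.Prime) {D σ : ℝ} (hD : 0 < D)
    (hσ : 0 ≤ σ) (n : ℕ) :
    rough s n ≤ (∑ d ∈ s.powerset with ((∏ p ∈ d, p : ℕ) : ℝ) ≤ D,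
        if ∏ p ∈ d, p ∣ n then (-1 : ℝ) ^ d.card else 0) +
      D ^ (-σ) * ∏ p ∈ s, (1 + if p ∣ n then (p : ℝ) ^ σ else 0) := by
  set B : ℝ := 1 + ∑ p ∈ s, p * D
  have hsum_nonneg : 0 ≤ ∑ p ∈ s, p * D := sum_nonneg fun p _ => by positivity
  have hsB : ∀ p ∈ s, p * D ≤ B := fun p hp =>
    (single_le_sum (f := fun p : ℕ => p * D) (fun q _ => by positivity) hp).trans
      (le_add_of_nonneg_left zero_le_one)
  rw [rough_eq_sum_neg_one_pow hs,
    ← sum_filter_add_sum_filter_not s.powerset fun d => ((∏ p ∈ d, p : ℕ) : ℝ) ≤ D]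
  gcongr
  calc ∑ d ∈ s.powerset with ¬ ((∏ p ∈ d, p : ℕ) : ℝ) ≤ D,
        (if ∏ p ∈ d, p ∣ n then (-1 : ℝ) ^ d.card else 0)
      = ∑ d ∈ {p ∈ s | p ∣ n}.powerset with D < (∏ p ∈ d, p : ℕ), (-1 : ℝ) ^ d.card := by
        rw [sum_filter, sum_filter, sum_powerset_filter_dvd hs]
        refine sum_congr rfl fun d _ => ?_
        simp only [not_le]
        split_ifs <;> rfl
    _ ≤ D ^ (-σ) * divisorPowerSum s B σ n :=
        (le_abs_self _).trans (abs_sum_neg_one_pow_card_le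
          (fun p hp => (hs p (mem_filter.1 hp).1).pos) hD (le_add_of_nonneg_right hsum_nonneg)
          (fun p hp => hsB p (mem_filter.1 hp).1) hσ)
    _ ≤ _ := mul_le_mul_of_nonneg_left (divisorPowerSum_le_prod s B σ n) (by positivity)

theorem card_filter_prod_le {s : Finset ℕ} (hs : ∀ p ∈ s, p.Prime) {D : ℝ} (hD : 0 ≤ D) :
    (#{d ∈ s.powerset | ((∏ p ∈ d, p : ℕ) : ℝ) ≤ D} : ℝ) ≤ D := by
  have hcard : #{d ∈ s.powerset | ((∏ p ∈ d, p : ℕ) : ℝ) ≤ D} ≤ #(Icc 1 ⌊D⌋₊) := by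
    refine card_le_card_of_injOn (fun d => ∏ p ∈ d, p) (fun d hd => ?_)
      ((prod_injOn_primes hs).mono (coe_subset.2 (filter_subset _ _)))
    obtain ⟨hds, hdD⟩ := mem_filter.1 (mem_coe.1 hd)
    exact mem_coe.2 (mem_Icc.2
      ⟨prod_pos fun p hp => (hs p (mem_powerset.1 hds hp)).pos, Nat.le_floor hdD⟩)
  rw [Nat.card_Icc, Nat.add_sub_cancel] at hcard
  exact (Nat.cast_le.2 hcard).trans (Nat.floor_le hD)

theorem sum_neg_one_pow_div_le {s : Finset ℕ} (hs : ∀ p ∈ s, 0 < p) {D σ : ℝ} (hD : 0 < D)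
    (hσ : 0 ≤ σ) :
    ∑ d ∈ s.powerset with ((∏ p ∈ d, p : ℕ) : ℝ) ≤ D, (-1 : ℝ) ^ d.card / (∏ p ∈ d, p : ℕ) ≤
      density s + D ^ (-σ) * ∏ p ∈ s, (1 + (p : ℝ) ^ (σ - 1)) := by
  have hdensity : density s = ∑ d ∈ s.powerset, (-1 : ℝ) ^ d.card / (∏ p ∈ d, p : ℕ) := by
    simp only [Nat.cast_prod, ← prod_const, ← prod_div_distrib, ← prod_one_add]
    exact prod_congr rfl fun p _ => by ring
  have htail : |∑ d ∈ s.powerset with ¬ ((∏ p ∈ d, p : ℕ) : ℝ) ≤ D,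
      (-1 : ℝ) ^ d.card / (∏ p ∈ d, p : ℕ)| ≤
        D ^ (-σ) * ∏ p ∈ s, (1 + (p : ℝ) ^ (σ - 1)) := by
    rw [prod_one_add_rpow_sub_one hs, mul_sum]
    refine (abs_sum_le_sum_abs _ _).trans ((sum_le_sum fun d hd => ?_).trans
      (sum_le_sum_of_subset_of_nonneg (filter_subset _ _) fun d _ _ => by positivity))
    rw [abs_div, abs_neg_one_pow, Nat.abs_cast, ← mul_div_assoc]
    exact div_le_div_of_nonneg_right
      (one_le_rpow_neg_mul_rpow hD (not_le.1 (mem_filter.1 hd).2).le hσ) (Nat.cast_nonneg _)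
  rw [hdensity, ← sum_filter_add_sum_filter_not s.powerset
    (fun d => ((∏ p ∈ d, p : ℕ) : ℝ) ≤ D) fun d => (-1 : ℝ) ^ d.card / (∏ p ∈ d, p : ℕ)]
  linarith [(abs_le.1 htail).1]

theorem sum_Icc_ite_dvd_neg_one_pow_le {m : ℕ} (hm : 0 < m) (N k : ℕ) :
    ∑ n ∈ Icc 1 N, (if m ∣ n then (-1 : ℝ) ^ k else 0) ≤ N * ((-1 : ℝ) ^ k / m) + 1 := by
  have hcard : #{n ∈ Icc 1 N | m ∣ n} = N / m := Nat.Ioc_filter_dvd_card_eq_div N m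
  have hle : ((N / m : ℕ) : ℝ) ≤ N / m := Nat.cast_div_le
  have hlt : (N : ℝ) / m < (N / m : ℕ) + 1 := by
    rw [div_lt_iff₀ (by exact_mod_cast hm)]
    exact_mod_cast Nat.lt_mul_of_div_lt (Nat.lt_succ_self (N / m)) hm
  rw [← sum_filter, sum_const, nsmul_eq_mul, hcard, mul_div_left_comm, mul_comm ((-1 : ℝ) ^ k)]
  rcases neg_one_pow_eq_or ℝ k with hsign | hsign <;> rw [hsign] <;> linarith

theorem sum_rough_le {s : Finset ℕ} (hs : ∀ p ∈ s, p.Prime) {D σ : ℝ} (hD : 0 < D) (hσ : 0 ≤ σ)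
    (N : ℕ) :
    ∑ n ∈ Icc 1 N, rough s n ≤
      N * density s + D + 2 * N * (D ^ (-σ) * ∏ p ∈ s, (1 + (p : ℝ) ^ (σ - 1))) := by
  have hmain : ∑ n ∈ Icc 1 N, ∑ d ∈ s.powerset with ((∏ p ∈ d, p : ℕ) : ℝ) ≤ D,
      (if ∏ p ∈ d, p ∣ n then (-1 : ℝ) ^ d.card else 0) ≤
        N * (density s + D ^ (-σ) * ∏ p ∈ s, (1 + (p : ℝ) ^ (σ - 1))) + D := by
    rw [sum_comm]
    refine (sum_le_sum fun d hd => sum_Icc_ite_dvd_neg_one_pow_le (prod_pos fun p hp =>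
      (hs p (mem_powerset.1 (mem_filter.1 hd).1 hp)).pos) N d.card).trans ?_
    rw [sum_add_distrib, ← mul_sum, sum_const, nsmul_eq_mul, mul_one]
    exact add_le_add (mul_le_mul_of_nonneg_left
      (sum_neg_one_pow_div_le (fun p hp => (hs p hp).pos) hD hσ) (Nat.cast_nonneg N))
      (card_filter_prod_le hs hD.le)
  have htail : ∑ n ∈ Icc 1 N, ∏ p ∈ s, (1 + if p ∣ n then (p : ℝ) ^ σ else 0) ≤
      N * ∏ p ∈ s, (1 + (p : ℝ) ^ (σ - 1)) := by
    refine (sum_Icc_prod_one_add_ite_dvd_le hs (fun p _ => by positivity) N).trans_eq ?_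
    exact congrArg _ (prod_congr rfl fun p hp => by
      rw [natCast_rpow_sub_one_eq_div (hs p hp).pos])
  refine (sum_le_sum fun n _ => rough_le_truncated_sum_add hs hD hσ n).trans ?_
  rw [sum_add_distrib, ← mul_sum]
  refine (add_le_add hmain (mul_le_mul_of_nonneg_left htail (by positivity))).trans_eq ?_
  ring

/-! ### The first absolute moment -/

theorem sum_Icc_filter_dvd {a : ℕ} (ha : 0 < a) (f : ℕ → ℝ) (N : ℕ) :
    ∑ n ∈ Icc 1 N with a ∣ n, f n = ∑ k ∈ Icc 1 (N / a), f (a * k) := by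
  symm
  refine sum_bij' (fun k _ => a * k) (fun n _ => n / a) (fun k hk => ?_) (fun n hn => ?_)
    (fun k _ => Nat.mul_div_cancel_left k ha) (fun n hn => Nat.mul_div_cancel' (mem_filter.1 hn).2)
    fun _ _ => rfl
  · rw [mem_Icc] at hk
    rw [mem_filter, mem_Icc]
    exact ⟨⟨Nat.mul_pos ha hk.1, (Nat.mul_le_mul_left a hk.2).trans (Nat.mul_div_le N a)⟩,
      dvd_mul_right _ _⟩
  · rw [mem_filter, mem_Icc] at hn
    exact mem_Icc.2 ⟨Nat.div_pos (Nat.le_of_dvd hn.1.1 hn.2) ha, Nat.div_le_div_right hn.1.2⟩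

theorem rough_mul_of_coprime {s : Finset ℕ} {a : ℕ} (ha : ∀ q ∈ s, q.Coprime a) (n : ℕ) :
    rough s (a * n) = rough s n :=
  prod_congr rfl fun q hq => by simp only [(ha q hq).dvd_mul_left]

theorem coprime_prod_of_disjoint {s₁ s₂ d : Finset ℕ} (hs₁ : ∀ p ∈ s₁, p.Prime)
    (hs₂ : ∀ p ∈ s₂, p.Prime) (hdisj : Disjoint s₁ s₂) (hd : d ⊆ s₂) :
    ∀ q ∈ s₁, q.Coprime (∏ p ∈ d, p) := fun q hq =>
  Nat.Coprime.prod_right fun _p hp =>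
    (Nat.coprime_primes (hs₁ q hq) (hs₂ _ (hd hp))).2 (disjoint_left.1 hdisj hq <| · ▸ hd hp)

theorem sum_rough_mul_divisorPowerSum_le {s₁ s₂ : Finset ℕ} (hs₁ : ∀ p ∈ s₁, p.Prime)
    (hs₂ : ∀ p ∈ s₂, p.Prime) (hdisj : Disjoint s₁ s₂) {B σ : ℝ} {N : ℕ}
    (hsieve : ∀ Y : ℕ, (N : ℝ) ≤ (Y + 1) * B → ∑ n ∈ Icc 1 Y, rough s₁ n ≤ 2 * density s₁ * Y) :
    ∑ n ∈ Icc 1 N, rough s₁ n * divisorPowerSum s₂ B σ n ≤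
      2 * density s₁ * (N * ∏ p ∈ s₂, (1 + (p : ℝ) ^ (σ - 1))) := by
  simp only [divisorPowerSum, sum_filter, sum_powerset_filter_dvd hs₂, mul_sum]
  rw [sum_comm, prod_one_add_rpow_sub_one fun p hp => (hs₂ p hp).pos, mul_sum, mul_sum]
  refine sum_le_sum fun d hd => ?_
  have hds := mem_powerset.1 hd
  have hpos : 0 < ∏ p ∈ d, p := prod_pos fun p hp => (hs₂ p (hds hp)).pos
  have hcoprime := coprime_prod_of_disjoint hs₁ hs₂ hdisj hds
  set a := ∏ p ∈ d, p
  have hdensity := density_nonneg s₁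
  by_cases haB : (a : ℝ) ≤ B
  · have hquotient : (N : ℝ) ≤ ((N / a : ℕ) + 1) * B := by
      have hlt : N ≤ (N / a + 1) * a := (Nat.lt_mul_of_div_lt (Nat.lt_succ_self (N / a)) hpos).le
      exact (by exact_mod_cast hlt : (N : ℝ) ≤ ((N / a : ℕ) + 1) * a).trans
        (mul_le_mul_of_nonneg_left haB (by positivity))
    simp only [if_pos haB, mul_ite, mul_zero]
    rw [← sum_filter, sum_Icc_filter_dvd hpos]
    simp only [rough_mul_of_coprime hcoprime]
    rw [← sum_mul]
    calc (∑ k ∈ Icc 1 (N / a), rough s₁ k) * (a : ℝ) ^ σ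
        ≤ (2 * density s₁ * (N / a : ℕ)) * (a : ℝ) ^ σ :=
          mul_le_mul_of_nonneg_right (hsieve _ hquotient) (by positivity)
      _ ≤ (2 * density s₁ * (N / a)) * (a : ℝ) ^ σ := by gcongr; exact Nat.cast_div_le
      _ = _ := by ring
  · simp only [if_neg haB, ite_self, mul_zero, sum_const_zero]
    positivity

theorem abs_rough_mul_rough_sub_le {s₁ s₂ : Finset ℕ} {B₁ B₂ D₁ D₂ σ₁ σ₂ : ℝ}
    (hs₁ : ∀ p ∈ s₁, 1 < p) (hs₂ : ∀ p ∈ s₂, 1 < p) (hD₁ : 0 < D₁) (hD₂ : 0 < D₂) (hB₁ : 1 ≤ B₁)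
    (hB₂ : 1 ≤ B₂) (hsB₁ : ∀ p ∈ s₁, p * D₁ ≤ B₁) (hsB₂ : ∀ p ∈ s₂, p * D₂ ≤ B₂) (hσ₁ : 0 ≤ σ₁)
    (hσ₂ : 0 ≤ σ₂) (n : ℕ) :
    |rough s₁ n * rough s₂ n - truncatedRough s₁ D₁ n * truncatedRough s₂ D₂ n| ≤
      density s₂ * rankinWeight s₂ D₂ σ₂ * (rough s₁ n * divisorPowerSum s₂ B₂ σ₂ n) +
      rankinWeight s₁ D₁ σ₁ * divisorPowerSum s₁ B₁ σ₁ n +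
      rankinWeight s₁ D₁ σ₁ * rankinWeight s₂ D₂ σ₂ *
        (divisorPowerSum s₁ B₁ σ₁ n * divisorPowerSum s₂ B₂ σ₂ n) := by
  have hdiff₁ := abs_rough_sub_truncatedRough_le hs₁ hD₁ hB₁ hsB₁ hσ₁ n
  have hdiff₂ := abs_rough_sub_truncatedRough_le hs₂ hD₂ hB₂ hsB₂ hσ₂ n
  have hA₁ := rankinWeight_nonneg hs₁ hD₁.le σ₁
  have hA₂ := rankinWeight_nonneg hs₂ hD₂.le σ₂
  set A₁ := rankinWeight s₁ D₁ σ₁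
  set A₂ := rankinWeight s₂ D₂ σ₂
  have hS₁ := divisorPowerSum_nonneg s₁ B₁ σ₁ n
  have hS₂ := divisorPowerSum_nonneg s₂ B₂ σ₂ n
  set S₁ := divisorPowerSum s₁ B₁ σ₁ n
  set S₂ := divisorPowerSum s₂ B₂ σ₂ n
  have hrough₁ := rough_nonneg s₁ n
  have hdiff₁' : |rough s₁ n - truncatedRough s₁ D₁ n| ≤ A₁ * S₁ :=
    hdiff₁.trans (mul_le_mul_of_nonneg_right (mul_le_of_le_one_left hA₁ (density_le_one s₁)) hS₁)
  have htruncated₂ : |truncatedRough s₂ D₂ n| ≤ 1 + A₂ * S₂ := by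
    rw [← sub_sub_cancel (rough s₂ n) (truncatedRough s₂ D₂ n)]
    refine (abs_sub _ _).trans (add_le_add ?_ (hdiff₂.trans
      (mul_le_mul_of_nonneg_right (mul_le_of_le_one_left hA₂ (density_le_one s₂)) hS₂)))
    exact (abs_of_nonneg (rough_nonneg s₂ n)).trans_le (rough_le_one s₂ n)
  calc |rough s₁ n * rough s₂ n - truncatedRough s₁ D₁ n * truncatedRough s₂ D₂ n|
      = |rough s₁ n * (rough s₂ n - truncatedRough s₂ D₂ n) +
          (rough s₁ n - truncatedRough s₁ D₁ n) * truncatedRough s₂ D₂ n| := by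
        congr 1
        ring
    _ ≤ rough s₁ n * |rough s₂ n - truncatedRough s₂ D₂ n| +
          |rough s₁ n - truncatedRough s₁ D₁ n| * |truncatedRough s₂ D₂ n| := by
        refine (abs_add_le _ _).trans_eq ?_
        rw [abs_mul, abs_mul, abs_of_nonneg hrough₁]
    _ ≤ rough s₁ n * (density s₂ * A₂ * S₂) + A₁ * S₁ * (1 + A₂ * S₂) := by gcongr
    _ = _ := by ring

theorem sum_abs_rough_mul_rough_sub_le {s₁ s₂ : Finset ℕ} (hs₁ : ∀ p ∈ s₁, p.Prime)
    (hs₂ : ∀ p ∈ s₂, p.Prime) (hdisj : Disjoint s₁ s₂) {y D₁ D₂ σ₁ σ₂ : ℝ} (hy : 1 ≤ y)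
    (hD₁ : 1 ≤ D₁) (hD₂ : 1 ≤ D₂) (hσ₁ : 0 ≤ σ₁) (hσ₂ : 0 ≤ σ₂)
    (hsy₁ : ∀ p ∈ s₁, (p : ℝ) ≤ y) (hsy₂ : ∀ p ∈ s₂, (p : ℝ) ≤ y) {N : ℕ}
    (hsieve : ∀ Y : ℕ, (N : ℝ) ≤ (Y + 1) * (y * D₂) →
      ∑ n ∈ Icc 1 Y, rough s₁ n ≤ 2 * density s₁ * Y) :
    ∑ n ∈ Icc 1 N, |rough s₁ n * rough s₂ n - truncatedRough s₁ D₁ n * truncatedRough s₂ D₂ n| ≤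
      N * (2 * (density s₁ * density s₂) * rankinError s₂ D₂ σ₂ +
        rankinError s₁ D₁ σ₁ * (1 + rankinError s₂ D₂ σ₂)) := by
  have hlt₁ : ∀ p ∈ s₁, 1 < p := fun p hp => (hs₁ p hp).one_lt
  have hlt₂ : ∀ p ∈ s₂, 1 < p := fun p hp => (hs₂ p hp).one_lt
  have hA₁ := rankinWeight_nonneg hlt₁ (zero_le_one.trans hD₁) σ₁
  have hA₂ := rankinWeight_nonneg hlt₂ (zero_le_one.trans hD₂) σ₂
  have hdensity₂ := density_nonneg s₂
  refine (sum_le_sum fun n _ => abs_rough_mul_rough_sub_le hlt₁ hlt₂ (zero_lt_one.trans_le hD₁)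
    (zero_lt_one.trans_le hD₂) (one_le_mul_of_one_le_of_one_le hy hD₁)
    (one_le_mul_of_one_le_of_one_le hy hD₂)
    (fun p hp => mul_le_mul_of_nonneg_right (hsy₁ p hp) (zero_le_one.trans hD₁))
    (fun p hp => mul_le_mul_of_nonneg_right (hsy₂ p hp) (zero_le_one.trans hD₂)) hσ₁ hσ₂ n).trans ?_
  simp only [sum_add_distrib, ← mul_sum]
  have hboth := sum_rough_mul_divisorPowerSum_le hs₁ hs₂ hdisj (σ := σ₂) hsieve
  have hfirst := sum_divisorPowerSum_le hs₁ (y * D₁) σ₁ N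
  have hproduct := sum_divisorPowerSum_mul_le hs₁ hs₂ hdisj (y * D₁) (y * D₂) σ₁ σ₂ N
  refine (add_le_add (add_le_add (mul_le_mul_of_nonneg_left hboth (by positivity))
    (mul_le_mul_of_nonneg_left hfirst hA₁))
    (mul_le_mul_of_nonneg_left hproduct (by positivity))).trans_eq ?_
  simp only [rankinError]
  ring

/-- The sets of primes kept when `rough s₁` is truncated at level `D₁` and `rough s₂` at level
`D₂`. -/
noncomputable def levelFamily (s₁ s₂ : Finset ℕ) (D₁ D₂ : ℝ) : Finset (Finset ℕ) :=
  ({t ∈ s₁.powerset | ((∏ p ∈ t, p : ℕ) : ℝ) ≤ D₁} ×ˢ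
    {t ∈ s₂.powerset | ((∏ p ∈ t, p : ℕ) : ℝ) ≤ D₂}).image fun x => x.1 ∪ x.2

theorem levelFamily_subset_powerset (s₁ s₂ : Finset ℕ) (D₁ D₂ : ℝ) :
    levelFamily s₁ s₂ D₁ D₂ ⊆ (s₁ ∪ s₂).powerset := by
  refine image_subset_iff.2 fun x hx => mem_powerset.2 ?_
  simp only [mem_product, mem_filter, mem_powerset] at hx
  exact union_subset_union hx.1.1 hx.2.1

theorem empty_mem_levelFamily (s₁ s₂ : Finset ℕ) {D₁ D₂ : ℝ} (hD₁ : 1 ≤ D₁) (hD₂ : 1 ≤ D₂) :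
    ∅ ∈ levelFamily s₁ s₂ D₁ D₂ :=
  mem_image.2 ⟨(∅, ∅), by simp [hD₁, hD₂], by simp⟩

theorem prod_le_of_mem_levelFamily {s₁ s₂ : Finset ℕ} (hdisj : Disjoint s₁ s₂) {D₁ D₂ : ℝ}
    {t : Finset ℕ} (ht : t ∈ levelFamily s₁ s₂ D₁ D₂) : ((∏ p ∈ t, p : ℕ) : ℝ) ≤ D₁ * D₂ := by
  obtain ⟨⟨a, b⟩, hab, rfl⟩ := mem_image.1 ht
  simp only [mem_product, mem_filter, mem_powerset] at hab
  rw [prod_union (disjoint_of_subset_left hab.1.1 (disjoint_of_subset_right hab.2.1 hdisj)),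
    Nat.cast_mul]
  exact mul_le_mul hab.1.2 hab.2.2 (Nat.cast_nonneg _) ((Nat.cast_nonneg _).trans hab.1.2)

theorem density_union {s₁ s₂ : Finset ℕ} (hdisj : Disjoint s₁ s₂) :
    density (s₁ ∪ s₂) = density s₁ * density s₂ :=
  prod_union hdisj

theorem rough_union {s₁ s₂ : Finset ℕ} (hdisj : Disjoint s₁ s₂) (n : ℕ) :
    rough (s₁ ∪ s₂) n = rough s₁ n * rough s₂ n :=
  prod_union hdisj

theorem density_mul_sum_levelFamily {s₁ s₂ : Finset ℕ} (hdisj : Disjoint s₁ s₂) (D₁ D₂ : ℝ)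
    (n : ℕ) :
    density (s₁ ∪ s₂) * ∑ t ∈ levelFamily s₁ s₂ D₁ D₂, ∏ p ∈ t, fluct p n =
      truncatedRough s₁ D₁ n * truncatedRough s₂ D₂ n := by
  rw [levelFamily, sum_image, sum_product, density_union hdisj, truncatedRough, truncatedRough,
    mul_mul_mul_comm, sum_mul_sum]
  · refine congrArg₂ _ rfl (sum_congr rfl fun a ha => sum_congr rfl fun b hb => ?_)
    simp only [mem_filter, mem_powerset] at ha hb
    exact prod_union (disjoint_of_subset_left ha.1 (disjoint_of_subset_right hb.1 hdisj))
  · refine (union_injOn_powerset_product hdisj).mono ?_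
    rw [coe_product]
    exact Set.prod_mono (filter_subset _ _) (filter_subset _ _)

theorem truncatedSum_levelFamily {s₁ s₂ : Finset ℕ} (hdisj : Disjoint s₁ s₂) (D₁ D₂ : ℝ)
    (H n : ℕ) :
    truncatedSum (s₁ ∪ s₂) (levelFamily s₁ s₂ D₁ D₂) H n =
      ∑ h ∈ Icc 1 H, truncatedRough s₁ D₁ (n + h) * truncatedRough s₂ D₂ (n + h) := by
  simp only [← density_mul_sum_levelFamily hdisj, truncatedSum, fluctSum, ← mul_sum]
  rw [sum_comm]

theorem sum_range_sum_shift_le {f : ℕ → ℝ} (hf : ∀ n, 0 ≤ f n) (X H : ℕ) :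
    ∑ n ∈ range (X + 1), ∑ h ∈ Icc 1 H, f (n + h) ≤ H * ∑ n ∈ Icc 1 (X + H), f n := by
  have hshift : ∀ h ∈ Icc 1 H, ∑ n ∈ range (X + 1), f (n + h) ≤ ∑ n ∈ Icc 1 (X + H), f n := by
    intro h hh
    rw [mem_Icc] at hh
    rw [← sum_image (g := (· + h)) (f := f) (add_left_injective h).injOn]
    refine sum_le_sum_of_subset_of_nonneg (image_subset_iff.2 fun n hn => ?_) fun n _ _ => hf n
    rw [mem_range] at hn
    rw [mem_Icc]
    omega
  rw [sum_comm]
  exact (sum_le_card_nsmul _ _ _ hshift).trans_eq (by simp)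

theorem sum_abs_roughSum_sub_truncatedSum_le {s₁ s₂ : Finset ℕ} (hs₁ : ∀ p ∈ s₁, p.Prime)
    (hs₂ : ∀ p ∈ s₂, p.Prime) (hdisj : Disjoint s₁ s₂) {y D₁ D₂ σ₁ σ₂ : ℝ} (hy : 1 ≤ y)
    (hD₁ : 1 ≤ D₁) (hD₂ : 1 ≤ D₂) (hσ₁ : 0 ≤ σ₁) (hσ₂ : 0 ≤ σ₂)
    (hsy₁ : ∀ p ∈ s₁, (p : ℝ) ≤ y) (hsy₂ : ∀ p ∈ s₂, (p : ℝ) ≤ y) {X H : ℕ}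
    (hsieve : ∀ Y : ℕ, ((X + H : ℕ) : ℝ) ≤ (Y + 1) * (y * D₂) →
      ∑ n ∈ Icc 1 Y, rough s₁ n ≤ 2 * density s₁ * Y) :
    ∑ n ∈ range (X + 1), |roughSum (s₁ ∪ s₂) H n -
        truncatedSum (s₁ ∪ s₂) (levelFamily s₁ s₂ D₁ D₂) H n| ≤
      H * ((X + H : ℕ) * (2 * density (s₁ ∪ s₂) * rankinError s₂ D₂ σ₂ +
        rankinError s₁ D₁ σ₁ * (1 + rankinError s₂ D₂ σ₂))) := by
  have hmean := sum_abs_rough_mul_rough_sub_le hs₁ hs₂ hdisj hy hD₁ hD₂ hσ₁ hσ₂ hsy₁ hsy₂ hsieve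
  rw [← density_union hdisj] at hmean
  refine le_trans (sum_le_sum fun n _ => ?_) ((sum_range_sum_shift_le
    (fun _ => abs_nonneg _) X H).trans (mul_le_mul_of_nonneg_left hmean (Nat.cast_nonneg H)))
  rw [truncatedSum_levelFamily hdisj, roughSum, ← sum_sub_distrib]
  simp only [rough_union hdisj]
  exact abs_sum_le_sum_abs _ _

theorem sum_abs_truncatedSum_sub_le {s : Finset ℕ} (hs : ∀ p ∈ s, p.Prime)
    {D : Finset (Finset ℕ)} (hD : D ⊆ s.powerset) (hempty : ∅ ∈ D) (H : ℕ) {X : ℕ}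
    (hDX : ∀ t ∈ D, ∀ t' ∈ D, (∏ p ∈ t, p) * ∏ p ∈ t', p ≤ X) :
    ∑ n ∈ range X, |truncatedSum s D H n - H * density s| ≤ 5 * X * √(periodVariance s H) := by
  have hvariance : 0 ≤ periodVariance s H := expect_nonneg fun _ _ => sq_nonneg _
  refine (le_abs_self _).trans (abs_le_of_sq_le_sq ?_ (by positivity))
  calc (∑ n ∈ range X, |truncatedSum s D H n - H * density s|) ^ 2
      ≤ X * ∑ n ∈ range X, (truncatedSum s D H n - H * density s) ^ 2 := by
        simpa only [card_range, sq_abs] using sq_sum_le_card_mul_sum_sq (s := range X)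
          (f := fun n => |truncatedSum s D H n - H * density s|)
    _ ≤ X * (24 * X * periodVariance s H) := by
        gcongr
        exact sum_range_sq_truncatedSum_sub_le hs hD hempty H hDX
    _ = 24 * (X ^ 2 * periodVariance s H) := by ring
    _ ≤ 25 * (X ^ 2 * periodVariance s H) := by gcongr; norm_num
    _ = (5 * X * √(periodVariance s H)) ^ 2 := by
      rw [mul_pow, mul_pow, Real.sq_sqrt hvariance]
      ring

theorem sum_abs_roughSum_sub_le {s₁ s₂ : Finset ℕ} (hs₁ : ∀ p ∈ s₁, p.Prime)
    (hs₂ : ∀ p ∈ s₂, p.Prime) (hdisj : Disjoint s₁ s₂) {y D₁ D₂ σ₁ σ₂ : ℝ} (hy : 1 ≤ y)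
    (hD₁ : 1 ≤ D₁) (hD₂ : 1 ≤ D₂) (hσ₁ : 0 ≤ σ₁) (hσ₂ : 0 ≤ σ₂)
    (hsy₁ : ∀ p ∈ s₁, (p : ℝ) ≤ y) (hsy₂ : ∀ p ∈ s₂, (p : ℝ) ≤ y) {X H : ℕ}
    (hlevel : (D₁ * D₂) ^ 2 ≤ X)
    (hsieve : ∀ Y : ℕ, ((X + H : ℕ) : ℝ) ≤ (Y + 1) * (y * D₂) →
      ∑ n ∈ Icc 1 Y, rough s₁ n ≤ 2 * density s₁ * Y) :
    ∑ n ∈ range (X + 1), |roughSum (s₁ ∪ s₂) H n - H * density (s₁ ∪ s₂)| ≤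
      H * ((X + H : ℕ) * (2 * density (s₁ ∪ s₂) * rankinError s₂ D₂ σ₂ +
        rankinError s₁ D₁ σ₁ * (1 + rankinError s₂ D₂ σ₂))) +
      5 * (X + 1 : ℕ) * √(periodVariance (s₁ ∪ s₂) H) := by
  have hs : ∀ p ∈ s₁ ∪ s₂, p.Prime := fun p hp => (mem_union.1 hp).elim (hs₁ p) (hs₂ p)
  have hproducts : ∀ t ∈ levelFamily s₁ s₂ D₁ D₂, ∀ t' ∈ levelFamily s₁ s₂ D₁ D₂,
      (∏ p ∈ t, p) * ∏ p ∈ t', p ≤ X + 1 := by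
    intro t ht t' ht'
    have hle : (((∏ p ∈ t, p) * ∏ p ∈ t', p : ℕ) : ℝ) ≤ X := by
      rw [Nat.cast_mul]
      refine (mul_le_mul (prod_le_of_mem_levelFamily hdisj ht)
        (prod_le_of_mem_levelFamily hdisj ht') (Nat.cast_nonneg _) (by positivity)).trans ?_
      rwa [← sq]
    exact (Nat.cast_le.1 hle).trans (Nat.le_succ X)
  refine (sum_le_sum fun n _ => abs_sub_le _
    (truncatedSum (s₁ ∪ s₂) (levelFamily s₁ s₂ D₁ D₂) H n) _).trans ?_
  rw [sum_add_distrib]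
  exact add_le_add (sum_abs_roughSum_sub_truncatedSum_le hs₁ hs₂ hdisj hy hD₁ hD₂ hσ₁ hσ₂ hsy₁
    hsy₂ hsieve) (sum_abs_truncatedSum_sub_le hs (levelFamily_subset_powerset s₁ s₂ D₁ D₂)
      (empty_mem_levelFamily s₁ s₂ hD₁ hD₂) H hproducts)

/-! ### Estimates of Mertens type -/

theorem sum_log_primes_dvd_le {n : ℕ} (hn : 0 < n) (y : ℕ) :
    ∑ p ∈ primesUpTo y with p ∣ n, Real.log p ≤ Real.log n := by
  have hprime : ∀ p ∈ {p ∈ primesUpTo y | p ∣ n}, p.Prime := fun p hp =>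
    prime_of_mem_primesUpTo p (mem_filter.1 hp).1
  have hdvd : ∏ p ∈ primesUpTo y with p ∣ n, p ∣ n :=
    prod_primes_dvd n (fun p hp => (hprime p hp).prime) fun p hp => (mem_filter.1 hp).2
  rw [← Real.log_prod fun p hp => by exact_mod_cast (hprime p hp).ne_zero, ← Nat.cast_prod]
  exact Real.log_le_log (by exact_mod_cast prod_primes_pos hprime)
    (by exact_mod_cast Nat.le_of_dvd hn hdvd)

theorem half_mul_log_div_le_sum_filter_dvd {p y : ℕ} (hp : 0 < p) (hpy : p ≤ y) :
    y / 2 * (Real.log p / p) ≤ ∑ n ∈ Icc 1 y with p ∣ n, Real.log p := by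
  have hcard : #{n ∈ Icc 1 y | p ∣ n} = y / p := Nat.Ioc_filter_dvd_card_eq_div y p
  have hfloor : (y : ℝ) / (2 * p) ≤ (y / p : ℕ) := by
    rw [div_le_iff₀ (by positivity)]
    have hlt := Nat.lt_mul_div_succ y hp
    have hone := Nat.div_pos hpy hp
    exact_mod_cast (by nlinarith : y ≤ y / p * (2 * p))
  calc y / 2 * (Real.log p / p) = y / (2 * p) * Real.log p := by ring
    _ ≤ (y / p : ℕ) * Real.log p := mul_le_mul_of_nonneg_right hfloor (Real.log_natCast_nonneg p)
    _ = _ := by rw [sum_const, hcard, nsmul_eq_mul]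

theorem sum_log_div_le {y : ℕ} (hy : 1 ≤ y) :
    ∑ p ∈ primesUpTo y, Real.log p / p ≤ 2 * Real.log y := by
  have hy0 : (0 : ℝ) < y := by exact_mod_cast hy
  have hdouble : y / 2 * ∑ p ∈ primesUpTo y, Real.log p / p ≤ y * Real.log y := by
    calc y / 2 * ∑ p ∈ primesUpTo y, Real.log p / p
        ≤ ∑ p ∈ primesUpTo y, ∑ n ∈ Icc 1 y with p ∣ n, Real.log p := by
          rw [mul_sum]
          refine sum_le_sum fun p hp => ?_
          obtain ⟨hprime, hpy⟩ := mem_primesUpTo.1 hp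
          exact half_mul_log_div_le_sum_filter_dvd hprime.pos hpy
      _ = ∑ n ∈ Icc 1 y, ∑ p ∈ primesUpTo y with p ∣ n, Real.log p := by
          simp only [sum_filter]
          exact sum_comm
      _ ≤ ∑ _n ∈ Icc 1 y, Real.log y := by
          refine sum_le_sum fun n hn => ?_
          obtain ⟨hn1, hny⟩ := mem_Icc.1 hn
          exact (sum_log_primes_dvd_le hn1 y).trans
            (Real.log_le_log (by exact_mod_cast hn1) (by exact_mod_cast hny))
      _ = y * Real.log y := by simp
  refine le_of_mul_le_mul_left ?_ hy0
  linarith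

/-- The completely multiplicative function `n ↦ n ^ (-s)`, as the Euler product API expects it. -/
noncomputable def powHom (s : ℝ) : ℕ →* ℝ where
  toFun n := (n : ℝ) ^ (-s)
  map_one' := by simp
  map_mul' m n := by
    rw [Nat.cast_mul, Real.mul_rpow m.cast_nonneg n.cast_nonneg]

theorem powHom_apply (s : ℝ) (n : ℕ) : powHom s n = (n : ℝ) ^ (-s) := rfl

theorem powHom_nonneg (s : ℝ) (n : ℕ) : 0 ≤ powHom s n := Real.rpow_nonneg n.cast_nonneg _

theorem powHom_one (n : ℕ) : powHom 1 n = 1 / n := by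
  rw [powHom_apply, Real.rpow_neg_one, one_div]

theorem powHom_lt_one {s : ℝ} (hs : 0 < s) {n : ℕ} (hn : 1 < n) : powHom s n < 1 :=
  Real.rpow_lt_one_of_one_lt_of_neg (by exact_mod_cast hn) (neg_lt_zero.2 hs)

theorem P_pos (y : ℕ) : 0 < P y := density_pos fun p hp => (prime_of_mem_primesUpTo p hp).one_lt

theorem sum_Icc_one_div_le_inv_P (y : ℕ) : ∑ n ∈ Icc 1 y, 1 / (n : ℝ) ≤ (P y)⁻¹ := by
  obtain ⟨-, hhas⟩ := EulerProduct.summable_and_hasSum_smoothNumbers_prod_primesBelow_geometric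
    (f := powHom 1) (fun {p} hp => by
      rw [Real.norm_of_nonneg (powHom_nonneg 1 p)]
      exact powHom_lt_one one_pos hp.one_lt) (y + 1)
  have hprod : ∏ p ∈ (y + 1).primesBelow, (1 - powHom 1 p)⁻¹ = (P y)⁻¹ := by
    rw [← Nat.primesLE, Nat.primesLE_eq_filter_Icc_one, prod_inv_distrib]
    simp only [powHom_one]
    rfl
  have hmem : ∀ n ∈ Icc 1 y, n ∈ (y + 1).smoothNumbers := fun n hn =>
    Nat.mem_smoothNumbers_of_lt (mem_Icc.1 hn).1 (Nat.lt_succ_of_le (mem_Icc.1 hn).2)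
  calc ∑ n ∈ Icc 1 y, 1 / (n : ℝ)
      = ∑ n ∈ (Icc 1 y).subtype (· ∈ (y + 1).smoothNumbers), powHom 1 n := by
        rw [sum_subtype_of_mem (f := fun n => powHom 1 n) hmem]
        simp only [powHom_one]
    _ ≤ _ := hhas.summable.sum_le_tsum _ fun n _ => powHom_nonneg 1 n
    _ = (P y)⁻¹ := by rw [hhas.tsum_eq, hprod]

theorem P_le_one_div_log {y : ℕ} (hy : 2 ≤ y) : P y ≤ 1 / Real.log y := by
  have hlog : 0 < Real.log y := Real.log_pos (by exact_mod_cast hy)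
  rw [one_div]
  refine le_inv_of_le_inv₀ hlog ?_
  calc Real.log y ≤ Real.log (y + 1 : ℕ) :=
        Real.log_le_log (by positivity) (by exact_mod_cast y.le_succ)
    _ ≤ harmonic y := log_add_one_le_harmonic y
    _ = ∑ n ∈ Icc 1 y, 1 / (n : ℝ) := by
        rw [harmonic_eq_sum_Icc]
        push_cast
        simp only [one_div]
    _ ≤ (P y)⁻¹ := sum_Icc_one_div_le_inv_P y

theorem summable_powHom {s : ℝ} (hs : 1 < s) : Summable (powHom s) :=
  Real.summable_nat_rpow.2 (neg_lt_neg hs)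

theorem tsum_powHom_le {s : ℝ} (hs : 1 < s) : ∑' n, powHom s n ≤ 1 + 1 / (s - 1) := by
  have hshift : ∑' n, powHom s n = ∑' n : ℕ, 1 / (n + 1 : ℝ) ^ s := by
    rw [(summable_powHom hs).tsum_eq_zero_add, powHom_apply, Nat.cast_zero,
      Real.zero_rpow (by linarith), zero_add]
    refine tsum_congr fun n => ?_
    rw [powHom_apply, Real.rpow_neg (Nat.cast_nonneg _), one_div, Nat.cast_succ]
  have hterm : 0 ≤ s * ZetaAsymptotics.termTSum s :=
    mul_nonneg (by linarith) (tsum_nonneg fun n => ZetaAsymptotics.term_nonneg _ _)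
  rw [hshift]
  linarith [ZetaAsymptotics.zeta_limit_aux1 hs]

theorem prod_primesUpTo_one_sub_powHom_inv_le {s : ℝ} (hs : 1 < s) (y : ℕ) :
    (∏ p ∈ primesUpTo y, (1 - powHom s p))⁻¹ ≤ 1 + 1 / (s - 1) := by
  rw [← prod_inv_distrib, primesUpTo, ← Nat.primesLE_eq_filter_Icc_one, Nat.primesLE,
    EulerProduct.prod_primesBelow_geometric_eq_tsum_smoothNumbers (summable_powHom hs)]
  exact (Summable.tsum_subtype_le _ _ (powHom_nonneg s) (summable_powHom hs)).trans
    (tsum_powHom_le hs)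

theorem one_sub_powHom_one_add_le (e : ℝ) {p : ℕ} (he : 0 ≤ e) (hp : 2 ≤ p) :
    1 - powHom (1 + e) p ≤ (1 - 1 / (p : ℝ)) * Real.exp (2 * e * (Real.log p / p)) := by
  have hp2 : (2 : ℝ) ≤ p := by exact_mod_cast hp
  have hp0 : (0 : ℝ) < p := by linarith
  have hpow : powHom (1 + e) p = 1 / p * Real.exp (-(e * Real.log p)) := by
    rw [powHom_apply, neg_add, Real.rpow_add hp0, Real.rpow_neg_one, Real.rpow_def_of_pos hp0,
      one_div]
    ring_nf
  have hinv : 1 / (p : ℝ) ≤ 1 / 2 := one_div_le_one_div_of_le two_pos hp2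
  have hlog : 0 ≤ e * Real.log p * (1 / p) * (1 - 2 * (1 / p)) :=
    mul_nonneg (mul_nonneg (mul_nonneg he (Real.log_natCast_nonneg p)) (by positivity))
      (by linarith)
  calc 1 - powHom (1 + e) p ≤ 1 - 1 / p * (-(e * Real.log p) + 1) := by
        rw [hpow]
        gcongr
        exact Real.add_one_le_exp _
    _ ≤ (1 - 1 / (p : ℝ)) * (2 * e * (Real.log p / p) + 1) := by
        rw [div_eq_mul_one_div (Real.log p)]
        linarith
    _ ≤ _ := mul_le_mul_of_nonneg_left (Real.add_one_le_exp _) (by linarith)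

/-- The Euler product of `∑ n ^ (-s)` is compared with `P y` at `s = 1 + 1 / log y`. -/
theorem exp_neg_four_div_le_P {y : ℕ} (hy : 2 ≤ y) :
    Real.exp (-4) / (1 + Real.log y) ≤ P y := by
  have hlog : 0 < Real.log y := Real.log_pos (by exact_mod_cast hy)
  have he : 0 < 1 / Real.log y := one_div_pos.2 hlog
  have hpos : ∀ p ∈ primesUpTo y, 0 < 1 - powHom (1 + 1 / Real.log y) p := fun p hp =>
    sub_pos.2 (powHom_lt_one (by linarith) (prime_of_mem_primesUpTo p hp).one_lt)
  have hupper : ∏ p ∈ primesUpTo y, (1 - powHom (1 + 1 / Real.log y) p) ≤ P y * Real.exp 4 := by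
    calc ∏ p ∈ primesUpTo y, (1 - powHom (1 + 1 / Real.log y) p)
        ≤ ∏ p ∈ primesUpTo y,
            ((1 - 1 / (p : ℝ)) * Real.exp (2 * (1 / Real.log y) * (Real.log p / p))) :=
          prod_le_prod (fun p hp => (hpos p hp).le) fun p hp =>
            one_sub_powHom_one_add_le _ he.le (prime_of_mem_primesUpTo p hp).two_le
      _ = P y * Real.exp (2 * (1 / Real.log y) * ∑ p ∈ primesUpTo y, Real.log p / p) := by
          rw [prod_mul_distrib, ← Real.exp_sum, ← mul_sum]
          rfl
      _ ≤ P y * Real.exp (2 * (1 / Real.log y) * (2 * Real.log y)) := by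
          gcongr
          · exact (P_pos y).le
          · exact sum_log_div_le (by omega)
      _ = P y * Real.exp 4 := by
          congr 2
          field_simp
          norm_num
  have hlower : 1 / (1 + Real.log y) ≤ ∏ p ∈ primesUpTo y, (1 - powHom (1 + 1 / Real.log y) p) := by
    rw [one_div]
    refine inv_le_of_inv_le₀ (prod_pos hpos) ?_
    simpa using prod_primesUpTo_one_sub_powHom_inv_le (by linarith : 1 < 1 + 1 / Real.log y) y
  rw [Real.exp_neg, div_eq_mul_one_div, inv_mul_le_iff₀ (Real.exp_pos 4), mul_comm _ (P y)]
  exact hlower.trans hupper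

theorem sum_one_div_primesUpTo_le {y : ℕ} (hy : 2 ≤ y) :
    ∑ p ∈ primesUpTo y, 1 / (p : ℝ) ≤ 4 + Real.log (1 + Real.log y) := by
  have hlog : 0 < Real.log y := Real.log_pos (by exact_mod_cast hy)
  have hle : P y ≤ Real.exp (-∑ p ∈ primesUpTo y, 1 / (p : ℝ)) := by
    rw [← sum_neg_distrib, Real.exp_sum, ← density_primesUpTo]
    exact prod_le_prod (fun p _ => one_sub_one_div_natCast_nonneg p) fun p _ =>
      Real.one_sub_le_exp_neg _
  have hexp := Real.log_le_log (by positivity) ((exp_neg_four_div_le_P hy).trans hle)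
  rw [Real.log_exp, Real.log_div (Real.exp_pos _).ne' (by linarith), Real.log_exp] at hexp
  linarith

/-! ### The Rankin error over small and large primes -/

theorem rankinError_le_exp {s : Finset ℕ} (hs : ∀ p ∈ s, 1 < p) {D : ℝ} (hD : 0 ≤ D) (σ : ℝ) :
    rankinError s D σ ≤ D ^ (-σ) * Real.exp (3 * ∑ p ∈ s, (p : ℝ) ^ (σ - 1)) := by
  have hdiv : ∀ p ∈ s, (p : ℝ) ^ σ / ((p : ℝ) - 1) ≤ 2 * (p : ℝ) ^ (σ - 1) := fun p hp => by
    have hp2 : (2 : ℝ) ≤ p := by exact_mod_cast hs p hp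
    have hpow : 0 ≤ (p : ℝ) ^ σ := by positivity
    rw [Real.rpow_sub_one (by linarith), ← mul_div_assoc,
      div_le_div_iff₀ (by linarith) (by linarith)]
    nlinarith
  have hweight : ∏ p ∈ s, (1 + (p : ℝ) ^ σ / ((p : ℝ) - 1)) ≤
      Real.exp (∑ p ∈ s, 2 * (p : ℝ) ^ (σ - 1)) := by
    rw [Real.exp_sum]
    refine prod_le_prod (fun p hp => ?_) fun p hp => ?_
    · have hp1 : (1 : ℝ) ≤ p := by exact_mod_cast (hs p hp).le
      have := sub_nonneg.2 hp1
      positivity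
    · linarith [hdiv p hp, Real.add_one_le_exp (2 * (p : ℝ) ^ (σ - 1))]
  have hmean : ∏ p ∈ s, (1 + (p : ℝ) ^ (σ - 1)) ≤ Real.exp (∑ p ∈ s, (p : ℝ) ^ (σ - 1)) := by
    rw [Real.exp_sum]
    refine prod_le_prod (fun p _ => by positivity) fun p _ => ?_
    linarith [Real.add_one_le_exp ((p : ℝ) ^ (σ - 1))]
  calc rankinError s D σ
      ≤ D ^ (-σ) * Real.exp (∑ p ∈ s, 2 * (p : ℝ) ^ (σ - 1)) *
          Real.exp (∑ p ∈ s, (p : ℝ) ^ (σ - 1)) := by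
        unfold rankinError rankinWeight
        gcongr
    _ = D ^ (-σ) * Real.exp (3 * ∑ p ∈ s, (p : ℝ) ^ (σ - 1)) := by
        rw [mul_assoc, ← Real.exp_add, ← mul_sum]
        ring_nf

/-- The primes up to `y` that are at most `z`, with a real threshold `z`. -/
noncomputable def smallPrimes (y : ℕ) (z : ℝ) : Finset ℕ := {p ∈ primesUpTo y | (p : ℝ) ≤ z}

/-- The primes up to `y` that exceed `z`, with a real threshold `z`. -/
noncomputable def largePrimes (y : ℕ) (z : ℝ) : Finset ℕ := {p ∈ primesUpTo y | ¬(p : ℝ) ≤ z}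

theorem smallPrimes_subset (y : ℕ) (z : ℝ) : smallPrimes y z ⊆ primesUpTo y := filter_subset _ _

theorem largePrimes_subset (y : ℕ) (z : ℝ) : largePrimes y z ⊆ primesUpTo y := filter_subset _ _

theorem prime_of_mem_smallPrimes {y : ℕ} {z : ℝ} : ∀ p ∈ smallPrimes y z, p.Prime :=
  fun p hp => prime_of_mem_primesUpTo p (smallPrimes_subset y z hp)

theorem prime_of_mem_largePrimes {y : ℕ} {z : ℝ} : ∀ p ∈ largePrimes y z, p.Prime :=
  fun p hp => prime_of_mem_primesUpTo p (largePrimes_subset y z hp)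

theorem smallPrimes_union_largePrimes (y : ℕ) (z : ℝ) :
    smallPrimes y z ∪ largePrimes y z = primesUpTo y :=
  filter_union_filter_not_eq _ _

theorem disjoint_smallPrimes_largePrimes (y : ℕ) (z : ℝ) :
    Disjoint (smallPrimes y z) (largePrimes y z) :=
  disjoint_filter_filter_not _ _ _

theorem natCast_le_of_mem_primesUpTo {y p : ℕ} (hp : p ∈ primesUpTo y) : (p : ℝ) ≤ y := by
  exact_mod_cast (mem_primesUpTo.1 hp).2

theorem log_natCast_div_nonneg (p : ℕ) : 0 ≤ Real.log p / p :=
  div_nonneg (Real.log_natCast_nonneg p) p.cast_nonneg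

theorem sum_largePrimes_rpow_sub_one_le {y : ℕ} {z σ : ℝ} (hy : 1 ≤ y) (hz : 1 < z) (hσ : 0 ≤ σ) :
    ∑ p ∈ largePrimes y z, (p : ℝ) ^ (σ - 1) ≤ (y : ℝ) ^ σ * (2 * Real.log y / Real.log z) := by
  have hlogz : 0 < Real.log z := Real.log_pos hz
  have hterm : ∀ p ∈ largePrimes y z,
      (p : ℝ) ^ (σ - 1) ≤ (y : ℝ) ^ σ / Real.log z * (Real.log p / p) := fun p hp => by
    have hp0 : (0 : ℝ) < p := by exact_mod_cast (prime_of_mem_largePrimes p hp).pos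
    have hzp : z < p := not_le.1 (mem_filter.1 hp).2
    have hpy := natCast_le_of_mem_primesUpTo (largePrimes_subset y z hp)
    calc (p : ℝ) ^ (σ - 1) ≤ (y : ℝ) ^ σ / p := by
          rw [Real.rpow_sub_one hp0.ne']
          gcongr
      _ ≤ (y : ℝ) ^ σ / p * (Real.log p / Real.log z) :=
          le_mul_of_one_le_right (by positivity)
            ((one_le_div hlogz).2 (Real.log_le_log (by linarith) hzp.le))
      _ = _ := by ring
  calc ∑ p ∈ largePrimes y z, (p : ℝ) ^ (σ - 1)
      ≤ (y : ℝ) ^ σ / Real.log z * ∑ p ∈ largePrimes y z, Real.log p / p := by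
        rw [mul_sum]
        exact sum_le_sum hterm
    _ ≤ (y : ℝ) ^ σ / Real.log z * (2 * Real.log y) := by
        gcongr
        exact (sum_le_sum_of_subset_of_nonneg (largePrimes_subset y z) fun p _ _ =>
          log_natCast_div_nonneg p).trans (sum_log_div_le hy)
    _ = _ := by ring

theorem rpow_le_one_add_mul_log_mul_rpow {x : ℝ} (hx : 0 < x) (σ : ℝ) :
    x ^ σ ≤ 1 + σ * Real.log x * x ^ σ := by
  have hpow : 0 < x ^ σ := Real.rpow_pos_of_pos hx σ
  have hlog := mul_le_mul_of_nonneg_right (Real.one_sub_inv_le_log_of_pos hpow) hpow.le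
  rw [Real.log_rpow hx, sub_mul, inv_mul_cancel₀ hpow.ne'] at hlog
  linarith

theorem sum_smallPrimes_log_div_le (y : ℕ) {z : ℝ} (hz : 1 ≤ z) :
    ∑ p ∈ smallPrimes y z, Real.log p / p ≤ 2 * Real.log z := by
  have hfloor : 1 ≤ ⌊z⌋₊ := (Nat.one_le_floor_iff z).2 hz
  have hsub : smallPrimes y z ⊆ primesUpTo ⌊z⌋₊ := fun p hp =>
    mem_primesUpTo.2 ⟨prime_of_mem_smallPrimes p hp, Nat.le_floor (mem_filter.1 hp).2⟩
  calc ∑ p ∈ smallPrimes y z, Real.log p / p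
      ≤ ∑ p ∈ primesUpTo ⌊z⌋₊, Real.log p / p :=
        sum_le_sum_of_subset_of_nonneg hsub fun p _ _ => log_natCast_div_nonneg p
    _ ≤ 2 * Real.log ⌊z⌋₊ := sum_log_div_le hfloor
    _ ≤ 2 * Real.log z := by
        gcongr
        exact Nat.floor_le (by linarith)

theorem sum_smallPrimes_rpow_sub_one_le {y : ℕ} {z σ : ℝ} (hy : 2 ≤ y) (hz : 1 ≤ z)
    (hσ : 0 ≤ σ) :
    ∑ p ∈ smallPrimes y z, (p : ℝ) ^ (σ - 1) ≤
      4 + Real.log (1 + Real.log y) + σ * z ^ σ * (2 * Real.log z) := by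
  have hterm : ∀ p ∈ smallPrimes y z,
      (p : ℝ) ^ (σ - 1) ≤ 1 / p + σ * z ^ σ * (Real.log p / p) := fun p hp => by
    have hp0 : (0 : ℝ) < p := by exact_mod_cast (prime_of_mem_smallPrimes p hp).pos
    have hpz : (p : ℝ) ≤ z := (mem_filter.1 hp).2
    have := Real.log_natCast_nonneg p
    calc (p : ℝ) ^ (σ - 1) = (p : ℝ) ^ σ / p := Real.rpow_sub_one hp0.ne' σ
      _ ≤ (1 + σ * Real.log p * (p : ℝ) ^ σ) / p := by
          gcongr
          exact rpow_le_one_add_mul_log_mul_rpow hp0 σ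
      _ ≤ (1 + σ * Real.log p * z ^ σ) / p := by gcongr
      _ = _ := by ring
  calc ∑ p ∈ smallPrimes y z, (p : ℝ) ^ (σ - 1)
      ≤ ∑ p ∈ smallPrimes y z, 1 / (p : ℝ) +
          σ * z ^ σ * ∑ p ∈ smallPrimes y z, Real.log p / p := by
        rw [mul_sum, ← sum_add_distrib]
        exact sum_le_sum hterm
    _ ≤ _ := by
        gcongr
        · exact (sum_le_sum_of_subset_of_nonneg (smallPrimes_subset y z) fun p _ _ => by
            positivity).trans (sum_one_div_primesUpTo_le hy)
        · exact sum_smallPrimes_log_div_le y hz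

/-! ### Lower bounds for the main term -/

/-- The normalizing factor `∏ (1 + 1 / (p - 2))⁻¹` of the weights `∏ p ∈ t, 1 / (p - 2)` with
`t ⊆ s`. -/
noncomputable def oddFactor (s : Finset ℕ) : ℝ := ∏ p ∈ s, (((p : ℝ) - 2) / ((p : ℝ) - 1))

/-- The probability that `H ≤ ∏ p ∈ t, p` for the random set `t` of odd primes up to `y` that
contains each `p` independently with probability `1 / (p - 1)`. -/
noncomputable def productTailProb (y H : ℕ) : ℝ :=
  oddFactor (oddPrimesUpTo y) *
    ∑ t ∈ (oddPrimesUpTo y).powerset with H ≤ ∏ p ∈ t, p, ∏ p ∈ t, 1 / ((p : ℝ) - 2)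

section OddFactor

variable {s : Finset ℕ}

theorem oddFactor_nonneg (hs : ∀ p ∈ s, 2 ≤ p) : 0 ≤ oddFactor s := prod_nonneg fun p hp => by
  have hp2 : (2 : ℝ) ≤ p := by exact_mod_cast hs p hp
  exact div_nonneg (by linarith) (by linarith)

theorem oddFactor_mul_prod_one_add (hs : ∀ p ∈ s, 2 < p) :
    oddFactor s * ∏ p ∈ s, (1 + 1 / ((p : ℝ) - 2)) = 1 := by
  rw [oddFactor, ← prod_mul_distrib]
  refine prod_eq_one fun p hp => ?_
  have hp2 : (2 : ℝ) < p := by exact_mod_cast hs p hp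
  have hsub1 : (p : ℝ) - 1 ≠ 0 := by linarith
  have hsub2 : (p : ℝ) - 2 ≠ 0 := by linarith
  field_simp
  ring

theorem prod_one_sub_two_div_eq (hs : ∀ p ∈ s, 1 < p) :
    ∏ p ∈ s, (1 - 2 / (p : ℝ)) = oddFactor s * density s := by
  rw [oddFactor, density, ← prod_mul_distrib]
  refine prod_congr rfl fun p hp => ?_
  have hp1 : (1 : ℝ) < p := by exact_mod_cast hs p hp
  have hsub1 : (p : ℝ) - 1 ≠ 0 := by linarith
  field_simp

theorem oddFactor_le_density (hs : ∀ p ∈ s, 2 ≤ p) : oddFactor s ≤ density s := by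
  refine prod_le_prod (fun p hp => ?_) fun p hp => ?_
  all_goals have hp2 : (2 : ℝ) ≤ p := by exact_mod_cast hs p hp
  · exact div_nonneg (by linarith) (by linarith)
  · rw [one_sub_div (by linarith), div_le_div_iff₀ (by linarith) (by linarith)]
    nlinarith

theorem density_sq_le_oddFactor (hs : ∀ p ∈ s, 2 < p) : density s ^ 2 ≤ oddFactor s := by
  rw [density, ← prod_pow]
  refine prod_le_prod (fun p _ => by positivity) fun p hp => ?_
  have hp3 : (3 : ℝ) ≤ p := by exact_mod_cast hs p hp
  rw [one_sub_div (by linarith), div_pow, div_le_div_iff₀ (by positivity) (by linarith)]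
  nlinarith [mul_nonneg (by linarith : (0 : ℝ) ≤ p - 3) (by linarith : (0 : ℝ) ≤ p)]

theorem prod_one_div_sub_two_nonneg (hs : ∀ p ∈ s, 2 ≤ p) : 0 ≤ ∏ p ∈ s, 1 / ((p : ℝ) - 2) :=
  prod_nonneg fun p hp => one_div_nonneg.2 (sub_nonneg.2 (by exact_mod_cast hs p hp))

end OddFactor

theorem two_lt_of_mem_subset_oddPrimesUpTo {y : ℕ} {t : Finset ℕ} (ht : t ⊆ oddPrimesUpTo y) :
    ∀ p ∈ t, 2 < p := fun _ hp => (mem_oddPrimesUpTo.1 (ht hp)).2.1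

theorem two_le_of_mem_subset_oddPrimesUpTo {y : ℕ} {t : Finset ℕ} (ht : t ⊆ oddPrimesUpTo y) :
    ∀ p ∈ t, 2 ≤ p := fun p hp => (two_lt_of_mem_subset_oddPrimesUpTo ht p hp).le

theorem div_le_fractBump {x : ℝ} (hx0 : 0 ≤ x) (hx : x ≤ 1 / 2) : x / 2 ≤ fractBump x := by
  rw [fractBump, Int.fract_eq_self.2 ⟨hx0, by linarith⟩, div_eq_mul_one_div]
  exact mul_le_mul_of_nonneg_left (by linarith) hx0

theorem mul_prod_one_div_le {H : ℕ} {t : Finset ℕ} (ht : ∀ p ∈ t, 2 ≤ p) (hH : H ≤ ∏ p ∈ t, p) :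
    H / 4 * ∏ p ∈ t, 1 / ((p : ℝ) - 2) ≤
      (∏ p ∈ t, (p : ℝ) / ((p : ℝ) - 2)) * fractBump (H / (2 * ∏ p ∈ t, p : ℕ)) := by
  have hpos : (0 : ℝ) < (∏ p ∈ t, p : ℕ) := by
    exact_mod_cast prod_pos fun p hp => two_pos.trans_le (ht p hp)
  have hle : (H : ℝ) ≤ (∏ p ∈ t, p : ℕ) := by exact_mod_cast hH
  have hsplit : ∏ p ∈ t, (p : ℝ) / ((p : ℝ) - 2) =
      (∏ p ∈ t, 1 / ((p : ℝ) - 2)) * (∏ p ∈ t, p : ℕ) := by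
    rw [Nat.cast_prod, ← prod_mul_distrib]
    exact prod_congr rfl fun p _ => by ring
  have hbump : H / (2 * (∏ p ∈ t, p : ℕ) : ℝ) / 2 ≤ fractBump (H / (2 * ∏ p ∈ t, p : ℕ)) := by
    rw [Nat.cast_mul, Nat.cast_two]
    refine div_le_fractBump (by positivity) ?_
    rw [div_le_div_iff₀ (by positivity) two_pos]
    linarith
  calc H / 4 * ∏ p ∈ t, 1 / ((p : ℝ) - 2)
      = (∏ p ∈ t, (p : ℝ) / ((p : ℝ) - 2)) * (H / (2 * (∏ p ∈ t, p : ℕ) : ℝ) / 2) := by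
        rw [hsplit]
        field_simp
        norm_num
    _ ≤ _ := by
        refine mul_le_mul_of_nonneg_left hbump ?_
        rw [hsplit]
        exact mul_nonneg (prod_one_div_sub_two_nonneg ht) hpos.le

/-- The products that are at least `H` give `fractBump (H / (2 * n))` at half of its maximal
slope. -/
theorem mul_productTailProb_le_M {y : ℕ} (hy : 2 ≤ y) (H : ℕ) :
    H * P y / 2 * productTailProb y H ≤ M H y := by
  have hodd := two_le_of_mem_subset_oddPrimesUpTo (subset_refl (oddPrimesUpTo y))
  have hnonneg : ∀ t ∈ (oddPrimesUpTo y).powerset,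
      0 ≤ (∏ p ∈ t, (p : ℝ) / ((p : ℝ) - 2)) * fractBump (H / (2 * ∏ p ∈ t, p : ℕ)) :=
    fun t ht => mul_nonneg (prod_nonneg fun p hp => by
      have hp2 := two_lt_of_mem_oddPrimesUpTo (mem_powerset.1 ht hp)
      exact div_nonneg (by linarith) (by linarith)) (fractBump_nonneg _)
  have hsum : H / 4 * ∑ t ∈ (oddPrimesUpTo y).powerset with H ≤ ∏ p ∈ t, p,
      ∏ p ∈ t, 1 / ((p : ℝ) - 2) ≤ ∑ t ∈ (oddPrimesUpTo y).powerset,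
        (∏ p ∈ t, (p : ℝ) / ((p : ℝ) - 2)) * fractBump (H / (2 * ∏ p ∈ t, p : ℕ)) := by
    rw [mul_sum]
    refine (sum_le_sum fun t ht => ?_).trans
      (sum_le_sum_of_subset_of_nonneg (filter_subset _ _) fun t ht _ => hnonneg t ht)
    obtain ⟨ht, hH⟩ := mem_filter.1 ht
    exact mul_prod_one_div_le (two_le_of_mem_subset_oddPrimesUpTo (mem_powerset.1 ht)) hH
  have hfactor : ∏ p ∈ oddPrimesUpTo y, (1 - 2 / (p : ℝ)) =
      oddFactor (oddPrimesUpTo y) * (2 * P y) := by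
    rw [prod_one_sub_two_div_eq fun p hp => hodd p hp, P_eq_half_density_oddPrimesUpTo hy]
    ring
  rw [M_eq_sum, hfactor]
  refine le_trans (le_of_eq ?_) (mul_le_mul_of_nonneg_left hsum
    (mul_nonneg (oddFactor_nonneg hodd) (by linarith [P_pos y])))
  rw [productTailProb]
  ring

theorem oddPrimesUpTo_mono {y₁ y₂ : ℕ} (h : y₁ ≤ y₂) : oddPrimesUpTo y₁ ⊆ oddPrimesUpTo y₂ :=
  filter_subset_filter _ (Icc_subset_Icc_right h)

theorem oddFactor_mul_prod_one_add_le {y H : ℕ} (hH : 2 ≤ H) (hHy : H ≤ y) :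
    oddFactor (oddPrimesUpTo y) * ∏ p ∈ oddPrimesUpTo H, (1 + 1 / ((p : ℝ) - 2)) ≤ P y / P H := by
  have hsub := oddPrimesUpTo_mono hHy
  have hdens : 0 < density (oddPrimesUpTo H) := density_pos fun p hp =>
    (prime_of_mem_oddPrimesUpTo p hp).one_lt
  have hdiff : density (oddPrimesUpTo y \ oddPrimesUpTo H) * density (oddPrimesUpTo H) =
      density (oddPrimesUpTo y) := prod_sdiff hsub
  calc oddFactor (oddPrimesUpTo y) * ∏ p ∈ oddPrimesUpTo H, (1 + 1 / ((p : ℝ) - 2))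
      = oddFactor (oddPrimesUpTo y \ oddPrimesUpTo H) := by
        rw [oddFactor, ← prod_sdiff hsub, ← oddFactor, ← oddFactor, mul_assoc,
          oddFactor_mul_prod_one_add (two_lt_of_mem_subset_oddPrimesUpTo (subset_refl _)), mul_one]
    _ ≤ density (oddPrimesUpTo y \ oddPrimesUpTo H) :=
        oddFactor_le_density (two_le_of_mem_subset_oddPrimesUpTo sdiff_subset)
    _ = P y / P H := by
        rw [P_eq_half_density_oddPrimesUpTo (hH.trans hHy), P_eq_half_density_oddPrimesUpTo hH,
          mul_div_mul_left _ _ (by norm_num), ← hdiff, mul_div_cancel_right₀ _ hdens.ne']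

theorem one_sub_productTailProb_le {y H : ℕ} (hH : 2 ≤ H) (hHy : H ≤ y) :
    1 - productTailProb y H ≤ P y / P H := by
  have hmem {t : Finset ℕ} (ht : t ∈ {t ∈ (oddPrimesUpTo y).powerset | ¬H ≤ ∏ p ∈ t, p}) :
      t ∈ (oddPrimesUpTo H).powerset := by
    obtain ⟨ht, hlt⟩ := mem_filter.1 ht
    refine mem_powerset.2 fun p hp => ?_
    have hodd := mem_oddPrimesUpTo.1 (mem_powerset.1 ht hp)
    have hle : p ≤ ∏ p ∈ t, p := Nat.le_of_dvd (prod_primes_pos fun q hq =>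
      prime_of_mem_oddPrimesUpTo q (mem_powerset.1 ht hq)) (dvd_prod_of_mem _ hp)
    exact mem_oddPrimesUpTo.2 ⟨hodd.1, hodd.2.1, hle.trans (not_le.1 hlt).le⟩
  have hcompl : ∑ t ∈ (oddPrimesUpTo y).powerset with ¬H ≤ ∏ p ∈ t, p,
      ∏ p ∈ t, 1 / ((p : ℝ) - 2) ≤ ∏ p ∈ oddPrimesUpTo H, (1 + 1 / ((p : ℝ) - 2)) := by
    rw [prod_one_add]
    exact sum_le_sum_of_subset_of_nonneg (fun t ht => hmem ht) fun t ht _ =>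
      prod_one_div_sub_two_nonneg (two_le_of_mem_subset_oddPrimesUpTo (mem_powerset.1 ht))
  have htotal := oddFactor_mul_prod_one_add
    (two_lt_of_mem_subset_oddPrimesUpTo (subset_refl (oddPrimesUpTo y)))
  rw [prod_one_add, ← sum_filter_add_sum_filter_not _ fun t => H ≤ ∏ p ∈ t, p, mul_add,
    ← productTailProb] at htotal
  have hle := mul_le_mul_of_nonneg_left hcompl
    (oddFactor_nonneg (two_le_of_mem_subset_oddPrimesUpTo (subset_refl (oddPrimesUpTo y))))
  linarith [oddFactor_mul_prod_one_add_le hH hHy]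

theorem P_div_P_le_half {y H : ℕ} (hy : 2 ≤ y) (hH : 2 ≤ H)
    (hlog : 2 * Real.exp 4 * (1 + Real.log H) ≤ Real.log y) : P y / P H ≤ 1 / 2 := by
  have hlogH : 0 < Real.log H := Real.log_pos (by exact_mod_cast hH)
  rw [div_le_iff₀ (P_pos H)]
  calc P y ≤ 1 / Real.log y := P_le_one_div_log hy
    _ ≤ 1 / (2 * Real.exp 4 * (1 + Real.log H)) :=
        one_div_le_one_div_of_le (by positivity) hlog
    _ = 1 / 2 * (Real.exp (-4) / (1 + Real.log H)) := by
        rw [Real.exp_neg]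
        field_simp
    _ ≤ 1 / 2 * P H := by
        gcongr
        exact exp_neg_four_div_le_P hH

theorem mul_P_div_four_le_M {y H : ℕ} (hH : 2 ≤ H) (hHy : H ≤ y)
    (hlog : 2 * Real.exp 4 * (1 + Real.log H) ≤ Real.log y) : H * P y / 4 ≤ M H y := by
  have hy : 2 ≤ y := hH.trans hHy
  have hprob : 1 / 2 ≤ productTailProb y H := by
    linarith [one_sub_productTailProb_le hH hHy, P_div_P_le_half hy hH hlog]
  have hPy := P_pos y
  calc H * P y / 4 = H * P y / 2 * (1 / 2) := by ring
    _ ≤ H * P y / 2 * productTailProb y H := by gcongr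
    _ ≤ M H y := mul_productTailProb_le_M hy H

theorem div_pow_le_choose {n r : ℕ} (hrn : 2 * r ≤ n) : ((n : ℝ) / (2 * r)) ^ r ≤ n.choose r := by
  have hhalf : (n : ℝ) / 2 ≤ (n + 1 - r : ℕ) := by
    rw [div_le_iff₀ two_pos]
    exact_mod_cast (by omega : n ≤ (n + 1 - r) * 2)
  have hfact : ((r.factorial : ℕ) : ℝ) ≤ (r : ℝ) ^ r := by exact_mod_cast Nat.factorial_le_pow r
  calc ((n : ℝ) / (2 * r)) ^ r = ((n : ℝ) / 2) ^ r / (r : ℝ) ^ r := by rw [← div_div, div_pow]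
    _ ≤ ((n + 1 - r : ℕ) : ℝ) ^ r / (r.factorial : ℕ) := by gcongr
    _ ≤ n.choose r := Nat.pow_le_choose r n

theorem div_pow_le_sum_prod_one_div {y H r : ℕ} {T : Finset ℕ} (hT : T ⊆ oddPrimesUpTo y) {B : ℝ}
    (hB : 0 ≤ B) (hTB : ∀ p ∈ T, B ≤ p) (hHB : (H : ℝ) ≤ B ^ r) (hcard : 2 * r ≤ #T) :
    ((#T : ℝ) / (2 * r * y)) ^ r ≤ ∑ t ∈ (oddPrimesUpTo y).powerset with H ≤ ∏ p ∈ t, p,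
      ∏ p ∈ t, 1 / ((p : ℝ) - 2) := by
  have hsub : T.powersetCard r ⊆ {t ∈ (oddPrimesUpTo y).powerset | H ≤ ∏ p ∈ t, p} := by
    intro t ht
    obtain ⟨htT, rfl⟩ := mem_powersetCard.1 ht
    refine mem_filter.2 ⟨mem_powerset.2 (htT.trans hT), ?_⟩
    have hprod : (H : ℝ) ≤ ∏ p ∈ t, (p : ℝ) :=
      hHB.trans (prod_const B ▸ prod_le_prod (fun _ _ => hB) fun p hp => hTB p (htT hp))
    rw [← Nat.cast_prod] at hprod
    exact_mod_cast hprod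
  have hterm : ∀ t ∈ T.powersetCard r, (1 / (y : ℝ)) ^ r ≤ ∏ p ∈ t, 1 / ((p : ℝ) - 2) := by
    intro t ht
    obtain ⟨htT, rfl⟩ := mem_powersetCard.1 ht
    rw [← prod_const]
    refine prod_le_prod (fun _ _ => by positivity) fun p hp => ?_
    have hp2 := two_lt_of_mem_oddPrimesUpTo (hT (htT hp))
    have hpy : (p : ℝ) ≤ y := by exact_mod_cast (mem_oddPrimesUpTo.1 (hT (htT hp))).2.2
    exact one_div_le_one_div_of_le (by linarith) (by linarith)
  calc ((#T : ℝ) / (2 * r * y)) ^ r = ((#T : ℝ) / (2 * r)) ^ r * (1 / (y : ℝ)) ^ r := by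
        rw [← mul_pow, ← div_div, div_eq_mul_one_div _ (y : ℝ)]
    _ ≤ (#T).choose r * (1 / (y : ℝ)) ^ r := by
        gcongr
        exact div_pow_le_choose hcard
    _ = ∑ t ∈ T.powersetCard r, (1 / (y : ℝ)) ^ r := by
        rw [sum_const, card_powersetCard, nsmul_eq_mul]
    _ ≤ ∑ t ∈ T.powersetCard r, ∏ p ∈ t, 1 / ((p : ℝ) - 2) := sum_le_sum hterm
    _ ≤ _ := sum_le_sum_of_subset_of_nonneg hsub fun t ht _ => prod_one_div_sub_two_nonneg
        (two_le_of_mem_subset_oddPrimesUpTo (mem_powerset.1 (mem_filter.1 ht).1))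

theorem P_sq_le_oddFactor {y : ℕ} (hy : 2 ≤ y) : P y ^ 2 ≤ oddFactor (oddPrimesUpTo y) := by
  refine le_trans ?_ (density_sq_le_oddFactor
    (two_lt_of_mem_subset_oddPrimesUpTo (subset_refl (oddPrimesUpTo y))))
  rw [P_eq_half_density_oddPrimesUpTo hy]
  linarith [sq_nonneg (density (oddPrimesUpTo y))]

theorem mul_card_div_pow_le_M {y H r : ℕ} (hy : 2 ≤ y) {T : Finset ℕ} (hT : T ⊆ oddPrimesUpTo y)
    {B : ℝ} (hB : 0 ≤ B) (hTB : ∀ p ∈ T, B ≤ p) (hHB : (H : ℝ) ≤ B ^ r) (hcard : 2 * r ≤ #T) :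
    H * P y / 2 * (P y ^ 2 * ((#T : ℝ) / (2 * r * y)) ^ r) ≤ M H y := by
  have hPy := P_pos y
  refine le_trans ?_ (mul_productTailProb_le_M hy H)
  unfold productTailProb
  gcongr
  · exact oddFactor_nonneg (two_le_of_mem_subset_oddPrimesUpTo (subset_refl _))
  · exact P_sq_le_oddFactor hy
  · exact div_pow_le_sum_prod_one_div hT hB hTB hHB hcard

/-! ### The first moment in the long range -/

theorem rankinError_largePrimes_le {y : ℕ} {X a c K u : ℝ} (hy : 2 ≤ y) (hK : 0 < K)
    (hc : 0 ≤ c) (hu : 1 ≤ u) (hX0 : 0 < X) (hX : Real.log X = u * Real.log y) :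
    rankinError (largePrimes y (Real.exp (Real.log y / K))) (X ^ a) (c * Real.log u / Real.log y) ≤
      Real.exp (-(a * c * (u * Real.log u)) + 6 * K * u ^ c) := by
  have hlogy : 0 < Real.log y := Real.log_pos (by exact_mod_cast hy)
  have hy0 : (0 : ℝ) < y := by positivity
  have hlogu : 0 ≤ Real.log u := Real.log_nonneg hu
  set σ := c * Real.log u / Real.log y with hσ
  have hσ0 : 0 ≤ σ := by positivity
  have hsum := sum_largePrimes_rpow_sub_one_le (y := y) (by omega)
    (Real.one_lt_exp_iff.2 (by positivity : 0 < Real.log y / K)) hσ0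
  have hyσ : (y : ℝ) ^ σ = u ^ c := by
    rw [Real.rpow_def_of_pos hy0, Real.rpow_def_of_pos (by linarith), hσ]
    congr 1; field_simp
  have hquot : 2 * Real.log y / (Real.log y / K) = 2 * K := by field_simp
  rw [hyσ, Real.log_exp, hquot] at hsum
  have hXσ : (X ^ a) ^ (-σ) = Real.exp (-(a * c * (u * Real.log u))) := by
    rw [← Real.rpow_mul hX0.le, Real.rpow_def_of_pos hX0, hX, hσ]
    congr 1; field_simp
  refine (rankinError_le_exp (fun p hp => (prime_of_mem_largePrimes p hp).one_lt)
    (by positivity) σ).trans ?_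
  rw [hXσ, Real.exp_add]
  exact mul_le_mul_of_nonneg_left (Real.exp_le_exp.2 (by linarith)) (Real.exp_pos _).le

theorem rankinError_smallPrimes_le {y : ℕ} {X a K u : ℝ} (hy : 2 ≤ y) (hK : 0 < K)
    (hu : 1 ≤ u) (hX0 : 0 < X) (hX : Real.log X = u * Real.log y) :
    rankinError (smallPrimes y (Real.exp (Real.log y / K))) (X ^ a)
        (K * Real.log u / (2 * Real.log y)) ≤
      Real.exp (-(a * K / 2 * (u * Real.log u)) + (12 + 3 * Real.log (1 + Real.log y) +
        3 * Real.log u * Real.exp (Real.log u / 2))) := by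
  have hlogy : 0 < Real.log y := Real.log_pos (by exact_mod_cast hy)
  have hlogu : 0 ≤ Real.log u := Real.log_nonneg hu
  set σ := K * Real.log u / (2 * Real.log y) with hσ
  have hσ0 : 0 ≤ σ := by positivity
  have hsum := sum_smallPrimes_rpow_sub_one_le hy
    (Real.one_le_exp (by positivity : 0 ≤ Real.log y / K)) hσ0
  have hzσ : Real.exp (Real.log y / K) ^ σ = Real.exp (Real.log u / 2) := by
    rw [← Real.exp_mul, hσ]
    congr 1; field_simp
  have hprod : σ * Real.exp (Real.log u / 2) * (2 * (Real.log y / K)) =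
      Real.log u * Real.exp (Real.log u / 2) := by rw [hσ]; field_simp
  rw [hzσ, Real.log_exp, hprod] at hsum
  have hXσ : (X ^ a) ^ (-σ) = Real.exp (-(a * K / 2 * (u * Real.log u))) := by
    rw [← Real.rpow_mul hX0.le, Real.rpow_def_of_pos hX0, hX, hσ]
    congr 1; field_simp
  refine (rankinError_le_exp (fun p hp => (prime_of_mem_smallPrimes p hp).one_lt)
    (by positivity) σ).trans ?_
  rw [hXσ, Real.exp_add]
  exact mul_le_mul_of_nonneg_left (Real.exp_le_exp.2 (by linarith)) (Real.exp_pos _).le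

theorem density_anti : Antitone density := fun s t h => by
  rw [density, ← prod_sdiff h]
  exact mul_le_of_le_one_left (density_nonneg s) (density_le_one _)

theorem sum_rough_le_rankinError {s : Finset ℕ} (hs : ∀ p ∈ s, p.Prime) {D σ : ℝ}
    (hD : 0 < D) (hσ : 0 ≤ σ) (N : ℕ) :
    ∑ n ∈ Icc 1 N, rough s n ≤ N * density s + D + 2 * N * rankinError s D σ := by
  refine (sum_rough_le hs hD hσ N).trans ?_
  rw [rankinError, rankinWeight]
  gcongr
  exact le_mul_of_one_le_right (by positivity)
    (one_le_prod_one_add_rpow_div (fun p hp => (hs p hp).one_lt) σ)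

theorem sum_rough_le_two_mul {s : Finset ℕ} (hs : ∀ p ∈ s, p.Prime) {D σ : ℝ} (hD : 0 < D)
    (hσ : 0 ≤ σ) (hR : 4 * rankinError s D σ ≤ density s) {N : ℕ}
    (hDN : 2 * D ≤ density s * N) :
    ∑ n ∈ Icc 1 N, rough s n ≤ 2 * density s * N := by
  have hsieve := sum_rough_le_rankinError hs hD hσ N
  have := mul_le_mul_of_nonneg_right hR N.cast_nonneg
  linarith

theorem mul_rpow_half_sub_le {X y u η : ℝ} (hX0 : 0 < X) (hy : 1 ≤ y)
    (hX : Real.log X = u * Real.log y) (hu : 1 ≤ 2 * η * u) :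
    y * X ^ (1 / 2 - 2 * η) ≤ X ^ (1 / 2 : ℝ) := by
  have := mul_le_mul_of_nonneg_right hu (Real.log_nonneg hy)
  rw [Real.rpow_def_of_pos hX0, Real.rpow_def_of_pos hX0, hX]
  nth_rewrite 1 [← Real.exp_log (by linarith : 0 < y)]
  rw [← Real.exp_add, Real.exp_le_exp]
  linarith

theorem le_rpow_one_div_four {X y u : ℝ} (hX0 : 0 < X) (hy : 1 ≤ y)
    (hX : Real.log X = u * Real.log y) (hu : 4 ≤ u) : y ≤ X ^ (1 / 4 : ℝ) := by
  have := mul_le_mul_of_nonneg_right hu (Real.log_nonneg hy)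
  rw [Real.rpow_def_of_pos hX0, hX, ← Real.log_le_iff_le_exp (by linarith)]
  linarith

theorem four_le_P_mul {y : ℕ} (hy : 2 ≤ y) {Z : ℝ}
    (hZ : 4 * Real.exp 4 * (1 + Real.log y) ≤ Z) : 4 ≤ P y * Z := by
  have hlogy : 0 < Real.log y := Real.log_pos (by exact_mod_cast hy)
  calc (4 : ℝ) = Real.exp (-4) / (1 + Real.log y) * (4 * Real.exp 4 * (1 + Real.log y)) := by
        rw [Real.exp_neg]; field_simp
    _ ≤ P y * Z := mul_le_mul (exp_neg_four_div_le_P hy) hZ (by positivity) (P_pos y).le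

theorem two_mul_rpow_le_mul {p X η Y : ℝ} (hp0 : 0 ≤ p) (hp1 : p ≤ 1) (hX : 1 ≤ X)
    (hη : η ≤ 1 / 4) (hpX : 4 ≤ p * X ^ (1 / 4 : ℝ)) (hXY : X ^ (1 / 2 : ℝ) ≤ Y + 1) :
    2 * X ^ η ≤ p * Y := by
  have hXη : X ^ η ≤ X ^ (1 / 4 : ℝ) := Real.rpow_le_rpow_of_exponent_le hX hη
  have hsq : X ^ (1 / 2 : ℝ) = X ^ (1 / 4 : ℝ) * X ^ (1 / 4 : ℝ) := by
    rw [← Real.rpow_add (by linarith)]; norm_num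
  set Z := X ^ (1 / 4 : ℝ)
  have hZ0 : 0 ≤ Z := by positivity
  have hZ4 : 4 ≤ Z := hpX.trans (mul_le_of_le_one_left hZ0 hp1)
  have hY : Z * Z / 2 ≤ Y := by nlinarith
  calc 2 * X ^ η ≤ 4 * Z / 2 := by linarith
    _ ≤ p * Z * Z / 2 := by gcongr
    _ = p * (Z * Z / 2) := by ring
    _ ≤ p * Y := by gcongr

theorem sum_rough_le_two_mul_of_level {y X H : ℕ} {η u σ : ℝ} {s : Finset ℕ}
    (hs : s ⊆ primesUpTo y) (hy : 2 ≤ y) (hX1 : 1 ≤ X) (hX : Real.log X = u * Real.log y)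
    (hη : η ≤ 1 / 4) (hu : 4 ≤ u) (hηu : 1 ≤ 2 * η * u) (hσ : 0 ≤ σ)
    (hy_large : 4 * Real.exp 4 * (1 + Real.log y) ≤ y)
    (hR : 4 * rankinError s ((X : ℝ) ^ η) σ ≤ P y) (Y : ℕ)
    (hY : ((X + H : ℕ) : ℝ) ≤ (Y + 1) * (y * (X : ℝ) ^ (1 / 2 - 2 * η))) :
    ∑ n ∈ Icc 1 Y, rough s n ≤ 2 * density s * Y := by
  have hX0 : (0 : ℝ) < X := by exact_mod_cast hX1
  have hy1 : (1 : ℝ) ≤ y := by exact_mod_cast (by omega : 1 ≤ y)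
  have hPs : P y ≤ density s := density_anti hs
  have hXY : (X : ℝ) ^ (1 / 2 : ℝ) ≤ Y + 1 := by
    have hsq : (X : ℝ) = (X : ℝ) ^ (1 / 2 : ℝ) * (X : ℝ) ^ (1 / 2 : ℝ) := by
      rw [← Real.rpow_add hX0]; norm_num
    refine le_of_mul_le_mul_right (a := (X : ℝ) ^ (1 / 2 : ℝ)) ?_ (by positivity)
    calc (X : ℝ) ^ (1 / 2 : ℝ) * (X : ℝ) ^ (1 / 2 : ℝ) ≤ (X + H : ℕ) := by
          rw [← hsq]; exact_mod_cast Nat.le_add_right X H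
      _ ≤ (Y + 1) * (y * (X : ℝ) ^ (1 / 2 - 2 * η)) := hY
      _ ≤ (Y + 1) * (X : ℝ) ^ (1 / 2 : ℝ) := by gcongr; exact mul_rpow_half_sub_le hX0 hy1 hX hηu
  have hPX : 4 ≤ P y * (X : ℝ) ^ (1 / 4 : ℝ) :=
    four_le_P_mul hy (hy_large.trans (le_rpow_one_div_four hX0 hy1 hX hu))
  refine sum_rough_le_two_mul (fun p hp => prime_of_mem_primesUpTo p (hs hp))
    (by positivity) hσ (hR.trans hPs) ?_
  calc 2 * (X : ℝ) ^ η ≤ P y * Y :=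
        two_mul_rpow_le_mul (P_pos y).le (density_le_one _) (by exact_mod_cast hX1) hη hPX hXY
    _ ≤ density s * Y := by gcongr

theorem mul_add_mul_le_of_rankinErrors_le {h p R₁ R₂ m X N : ℝ} (hh : 0 ≤ h) (hp : 0 ≤ p)
    (hR₁ : 0 ≤ R₁) (hR₂ : 0 ≤ R₂) (hR₂1 : R₂ ≤ 1) (hm : 0 ≤ m) (hhR₁ : h * R₁ ≤ m)
    (hhR₂ : h * p * R₂ ≤ m) (hX : 1 ≤ X) (hN : N ≤ 2 * X) :
    h * (N * (2 * p * R₂ + R₁ * (1 + R₂))) + 5 * (X + 1) * m ≤ 18 * X * m := by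
  have hbracket : h * (2 * p * R₂ + R₁ * (1 + R₂)) ≤ 4 * m := by
    have : h * R₁ * R₂ ≤ h * R₁ := mul_le_of_le_one_right (by positivity) hR₂1
    linarith
  calc h * (N * (2 * p * R₂ + R₁ * (1 + R₂))) + 5 * (X + 1) * m
      = N * (h * (2 * p * R₂ + R₁ * (1 + R₂))) + 5 * (X + 1) * m := by ring
    _ ≤ 2 * X * (4 * m) + 5 * (X + X) * m := by gcongr
    _ = 18 * X * m := by ring

theorem sum_abs_roughSum_sub_le_of_rankinErrors_le {y H X : ℕ} {η u σ₁ σ₂ z : ℝ} (hη : 0 ≤ η)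
    (hη' : η ≤ 1 / 4) (hy : 2 ≤ y) (hHX : H ≤ X) (hX1 : 1 ≤ X) (hX : Real.log X = u * Real.log y)
    (hu : 4 ≤ u) (hηu : 1 ≤ 2 * η * u) (hσ₁ : 0 ≤ σ₁) (hσ₂ : 0 ≤ σ₂)
    (hy_large : 4 * Real.exp 4 * (1 + Real.log y) ≤ y)
    (hR₁ : 4 * rankinError (smallPrimes y z) ((X : ℝ) ^ η) σ₁ ≤ P y)
    (hHR₁ : H * rankinError (smallPrimes y z) ((X : ℝ) ^ η) σ₁ ≤ √(M H y))
    (hR₂ : rankinError (largePrimes y z) ((X : ℝ) ^ (1 / 2 - 2 * η)) σ₂ ≤ 1)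
    (hHR₂ : H * P y * rankinError (largePrimes y z) ((X : ℝ) ^ (1 / 2 - 2 * η)) σ₂ ≤
      √(M H y)) :
    ∑ n ∈ range (X + 1), |roughSum (primesUpTo y) H n - H * P y| ≤ 18 * X * √(M H y) := by
  have hX0 : (0 : ℝ) < X := by exact_mod_cast hX1
  have hX1' : (1 : ℝ) ≤ X := by exact_mod_cast hX1
  have hlevel : ((X : ℝ) ^ η * (X : ℝ) ^ (1 / 2 - 2 * η)) ^ 2 ≤ X := by
    rw [← Real.rpow_add hX0, ← Real.rpow_natCast, ← Real.rpow_mul hX0.le]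
    calc (X : ℝ) ^ ((η + (1 / 2 - 2 * η)) * (2 : ℕ)) ≤ (X : ℝ) ^ (1 : ℝ) :=
          Real.rpow_le_rpow_of_exponent_le hX1' (by push_cast; linarith)
      _ = X := Real.rpow_one _
  have hmoment := sum_abs_roughSum_sub_le (X := X) (H := H) (y := y)
    prime_of_mem_smallPrimes prime_of_mem_largePrimes (disjoint_smallPrimes_largePrimes y z)
    (by exact_mod_cast (by omega : 1 ≤ y)) (Real.one_le_rpow hX1' hη)
    (Real.one_le_rpow hX1' (by linarith)) hσ₁ hσ₂
    (fun p hp => natCast_le_of_mem_primesUpTo (smallPrimes_subset y z hp))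
    (fun p hp => natCast_le_of_mem_primesUpTo (largePrimes_subset y z hp)) hlevel
    (sum_rough_le_two_mul_of_level (smallPrimes_subset y z) hy hX1 hX hη' hu hηu hσ₁ hy_large hR₁)
  rw [smallPrimes_union_largePrimes, periodVariance_primesUpTo hy, density_primesUpTo,
    Nat.cast_add_one] at hmoment
  refine hmoment.trans (mul_add_mul_le_of_rankinErrors_le H.cast_nonneg (P_pos y).le
    (rankinError_nonneg (fun p hp => (prime_of_mem_smallPrimes p hp).one_lt) (by positivity) _)
    (rankinError_nonneg (fun p hp => (prime_of_mem_largePrimes p hp).one_lt) (by positivity) _)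
    hR₂ (Real.sqrt_nonneg _) hHR₁ hHR₂ hX1' ?_)
  exact_mod_cast (by omega : X + H ≤ 2 * X)

/-- The quantity `(1 + log log H / log y) log H` of the main hypothesis. Up to lower order terms
`exp (logScale y H)` is `H ^ 2 * P y / M H y`, the factor by which the truncation errors have to
beat the trivial bound. -/
noncomputable def logScale (y H : ℕ) : ℝ :=
  Real.log H + Real.log H / Real.log y * Real.log (Real.log H)

theorem log_le_logScale {y H : ℕ} (hy : 1 ≤ y) (hH : 0 ≤ Real.log (Real.log H)) :
    Real.log H ≤ logScale y H := by
  have : 0 ≤ Real.log y := Real.log_nonneg (by exact_mod_cast hy)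
  have : 0 ≤ Real.log H := Real.log_natCast_nonneg H
  exact le_add_of_nonneg_right (by positivity)

theorem mul_logScale_le_mul_log {y H : ℕ} {η δ u : ℝ} (hη : η ≤ 1) (hδ0 : 0 ≤ δ) (hδ1 : δ ≤ 1)
    (hy : 2 ≤ y) (hH : 0 < Real.log H) (hH₂ : 0 < Real.log (Real.log H))
    (hH₃ : Real.log (Real.log (Real.log H)) ≤ η * Real.log (Real.log H)) (hu : 0 < u)
    (hcond : (1 + Real.log (Real.log H) / Real.log y) * (Real.log H / Real.log (Real.log H)) ≤
      (1 - δ) * u) :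
    (1 - η) * logScale y H ≤ (1 - δ) * (u * Real.log u) := by
  have hlogy : 0 < Real.log y := Real.log_pos (by exact_mod_cast hy)
  rw [logScale]
  set l := Real.log H
  set l₂ := Real.log l with hl₂
  have hscale : l + l / Real.log y * l₂ ≤ (1 - δ) * u * l₂ := by
    calc l + l / Real.log y * l₂ = (1 + l₂ / Real.log y) * (l / l₂) * l₂ := by field_simp
      _ ≤ (1 - δ) * u * l₂ := by gcongr
  have hlogu : (1 - η) * l₂ ≤ Real.log u := by
    have hle : l / l₂ ≤ u := by
      rw [div_le_iff₀ hH₂]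
      have : 0 ≤ δ * (u * l₂) := by positivity
      have : 0 ≤ l / Real.log y * l₂ := by positivity
      linarith
    have hlog := Real.log_le_log (by positivity) hle
    rw [Real.log_div hH.ne' hH₂.ne', ← hl₂] at hlog
    linarith
  have : 0 ≤ 1 - η := by linarith
  have : 0 ≤ 1 - δ := by linarith
  calc (1 - η) * (l + l / Real.log y * l₂) ≤ (1 - η) * ((1 - δ) * u * l₂) := by gcongr
    _ = (1 - δ) * (u * ((1 - η) * l₂)) := by ring
    _ ≤ (1 - δ) * (u * Real.log u) := by gcongr

theorem one_add_mul_le_of_one_sub_mul_le {η δ Λ U : ℝ} (hη : 0 ≤ η) (hηδ : 8 * η ≤ δ)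
    (hδ : δ ≤ 1 / 2) (hΛ : 0 ≤ Λ) (h : (1 - η) * Λ ≤ (1 - δ) * U) :
    (1 + η) * Λ ≤ (1 - 6 * η) * U := by
  have hcoeff : (1 + η) * (1 - δ) ≤ (1 - 6 * η) * (1 - η) := by nlinarith
  refine le_of_mul_le_mul_left ?_ (by linarith : 0 < 1 - δ)
  calc (1 - δ) * ((1 + η) * Λ) = (1 + η) * (1 - δ) * Λ := by ring
    _ ≤ (1 - 6 * η) * (1 - η) * Λ := by gcongr
    _ = (1 - 6 * η) * ((1 - η) * Λ) := by ring
    _ ≤ (1 - 6 * η) * ((1 - δ) * U) := mul_le_mul_of_nonneg_left h (by linarith)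
    _ = (1 - δ) * ((1 - 6 * η) * U) := by ring

theorem exp_neg_five_mul_le_P {y : ℕ} {l : ℝ} (hy : 2 ≤ y) (hl : 5 ≤ l)
    (h : Real.log (1 + Real.log y) ≤ 4 * l + 1) : Real.exp (-(5 * l)) ≤ P y := by
  have hlogy : 0 < 1 + Real.log y := by
    have := Real.log_natCast_nonneg y
    linarith
  refine le_trans ?_ (exp_neg_four_div_le_P hy)
  rw [le_div_iff₀ hlogy, ← Real.exp_log hlogy, ← Real.exp_add, Real.exp_le_exp]
  linarith

theorem log_one_add_le_log_add_one {x : ℝ} (hx : 1 ≤ x) :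
    Real.log (1 + x) ≤ Real.log x + 1 := by
  have hmul : Real.log (1 + x) ≤ Real.log (2 * x) := Real.log_le_log (by linarith) (by linarith)
  rw [Real.log_mul two_ne_zero (by linarith)] at hmul
  have := Real.log_two_lt_d9
  linarith

section RankinComparison

variable {h p R l Λ η m : ℝ}

theorem four_mul_le_of_le_exp_neg (hlow : Real.exp (-(5 * l)) ≤ p)
    (hR : R ≤ Real.exp (-(10 * Λ))) (hΛ : l ≤ Λ) (hl : 1 ≤ l) : 4 * R ≤ p := by
  have : 4 ≤ Real.exp (5 * l) := by
    have := Real.add_one_le_exp (5 * l)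
    linarith
  calc 4 * R ≤ 4 * Real.exp (-(10 * Λ)) := by gcongr
    _ ≤ Real.exp (5 * l) * Real.exp (-(10 * Λ)) := by gcongr
    _ ≤ Real.exp (-(5 * l)) := by rw [← Real.exp_add, Real.exp_le_exp]; linarith
    _ ≤ p := hlow

theorem mul_le_sqrt_of_le_exp_neg (hh : h = Real.exp l) (hlow : Real.exp (-(5 * l)) ≤ p)
    (hR0 : 0 ≤ R) (hR : R ≤ Real.exp (-(10 * Λ))) (hΛ : l ≤ Λ) (hl : 0 ≤ l) (hη : η ≤ 1)
    (hm : h * p * Real.exp (-(Λ - l) - η * Λ) ≤ m) : h * R ≤ √m := by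
  have hηΛ : η * Λ ≤ Λ := mul_le_of_le_one_left (by linarith) hη
  subst hh
  refine Real.le_sqrt_of_sq_le (le_trans ?_ hm)
  calc (Real.exp l * R) ^ 2 ≤ (Real.exp l * Real.exp (-(10 * Λ))) ^ 2 := by gcongr
    _ ≤ Real.exp l * Real.exp (-(5 * l)) * Real.exp (-(Λ - l) - η * Λ) := by
      rw [← Real.exp_add, ← Real.exp_nat_mul, ← Real.exp_add, ← Real.exp_add, Real.exp_le_exp]
      push_cast
      linarith
    _ ≤ Real.exp l * p * Real.exp (-(Λ - l) - η * Λ) := by gcongr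

theorem mul_mul_le_sqrt_of_le_exp_neg {V : ℝ} (hh : h = Real.exp l) (hp : 0 ≤ p) (hp1 : p ≤ 1)
    (hR0 : 0 ≤ R) (hR : R ≤ Real.exp (-(V / 2))) (hV : (1 + η) * Λ ≤ V)
    (hm : h * p * Real.exp (-(Λ - l) - η * Λ) ≤ m) : h * p * R ≤ √m := by
  subst hh
  refine Real.le_sqrt_of_sq_le (le_trans ?_ hm)
  calc (Real.exp l * p * R) ^ 2 = Real.exp l * p * (p * (Real.exp l * R ^ 2)) := by ring
    _ ≤ Real.exp l * p * (1 * (Real.exp l * Real.exp (-(V / 2)) ^ 2)) := by gcongr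
    _ ≤ Real.exp l * p * Real.exp (-(Λ - l) - η * Λ) := by
      rw [one_mul, ← Real.exp_nat_mul, ← Real.exp_add]
      gcongr
      push_cast
      linarith

end RankinComparison

-- The cut at `y ^ (η / 100)` makes the small primes so sparse that `X ^ η` is an ample level.
theorem rankinError_smallPrimes_le_exp_neg {y H X : ℕ} {η u : ℝ} (hη : 0 < η) (hy : 2 ≤ y)
    (hX1 : 1 ≤ X) (hX : Real.log X = u * Real.log y) (hu : 1 ≤ u)
    (hlog : Real.log (1 + Real.log y) ≤ 4 * Real.log H + 1) (hH : 5 ≤ Real.log H)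
    (hΛ : Real.log H ≤ logScale y H) (hΛu : logScale y H / 2 ≤ u * Real.log u)
    (hu_exp : 24 + 6 * Real.log u * Real.exp (Real.log u / 2) ≤ u * Real.log u) :
    rankinError (smallPrimes y (Real.exp (Real.log y / (100 / η)))) ((X : ℝ) ^ η)
        (100 / η * Real.log u / (2 * Real.log y)) ≤ Real.exp (-(10 * logScale y H)) := by
  refine (rankinError_smallPrimes_le hy (by positivity) hu (by exact_mod_cast hX1) hX).trans
    (Real.exp_le_exp.2 ?_)
  have : η * (100 / η) = 100 := by field_simp
  rw [this]
  linarith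

theorem rankinError_largePrimes_le_exp_neg {y X : ℕ} {η u : ℝ} (hη : 0 < η) (hη1 : η ≤ 1)
    (hy : 2 ≤ y) (hX1 : 1 ≤ X) (hX : Real.log X = u * Real.log y) (hu : 1 ≤ u)
    (hu_rpow : 12 * (100 / η) * u ^ (1 - η) ≤ η * (u * Real.log u)) :
    rankinError (largePrimes y (Real.exp (Real.log y / (100 / η)))) ((X : ℝ) ^ (1 / 2 - 2 * η))
        ((1 - η) * Real.log u / Real.log y) ≤
      Real.exp (-((1 - 6 * η) * (u * Real.log u) / 2)) := by
  have hlogu : 0 ≤ Real.log u := Real.log_nonneg hu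
  refine (rankinError_largePrimes_le hy (by positivity) (by linarith) hu (by exact_mod_cast hX1)
    hX).trans (Real.exp_le_exp.2 ?_)
  have : (1 / 2 - 5 / 2 * η) * (u * Real.log u) ≤
      (1 / 2 - 2 * η) * (1 - η) * (u * Real.log u) := by
    gcongr
    nlinarith only [sq_nonneg η]
  linarith

theorem sum_abs_roughSum_sub_le_of_long {y H X : ℕ} {δ η u : ℝ} (hη : 0 < η) (hηδ : 8 * η ≤ δ)
    (hδ : δ ≤ 1 / 2) (hHX : H ≤ X) (hX : Real.log X = u * Real.log y)
    (hcond : (1 + Real.log (Real.log H) / Real.log y) * (Real.log H / Real.log (Real.log H)) ≤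
      (1 - δ) * u)
    (hloglogy : Real.log (Real.log y) ≤ 4 * Real.log H) (hlogy : 1 ≤ Real.log y)
    (hH : 5 ≤ Real.log H) (hH₂ : 0 < Real.log (Real.log H))
    (hH₃ : Real.log (Real.log (Real.log H)) ≤ η * Real.log (Real.log H))
    (hu : 4 ≤ u) (hηu : 1 ≤ 2 * η * u)
    (hu_rpow : 12 * (100 / η) * u ^ (1 - η) ≤ η * (u * Real.log u))
    (hu_exp : 24 + 6 * Real.log u * Real.exp (Real.log u / 2) ≤ u * Real.log u)
    (hy_large : 4 * Real.exp 4 * (1 + Real.log y) ≤ y)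
    (hM : H * P y * Real.exp (-(logScale y H - Real.log H) - η * logScale y H) ≤ M H y) :
    ∑ n ∈ range (X + 1), |roughSum (primesUpTo y) H n - H * P y| ≤ 18 * X * √(M H y) := by
  have hy : 2 ≤ y := by
    by_contra! hy
    interval_cases y <;> norm_num at hlogy
  have hH1 : 1 ≤ H := Nat.one_le_iff_ne_zero.2 fun h => by norm_num [h] at hH
  have hHexp : (H : ℝ) = Real.exp (Real.log H) := (Real.exp_log (by positivity)).symm
  have hlogu : 0 < Real.log u := Real.log_pos (by linarith)
  have hΛ : Real.log H ≤ logScale y H := log_le_logScale (by omega) hH₂.le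
  have hΛu : (1 - η) * logScale y H ≤ (1 - δ) * (u * Real.log u) :=
    mul_logScale_le_mul_log (by linarith) (by linarith) (by linarith) hy (by linarith) hH₂ hH₃
      (by linarith) hcond
  have hΛu_half : logScale y H / 2 ≤ u * Real.log u := by
    have : 0 ≤ δ * (u * Real.log u) := mul_nonneg (by linarith) (by positivity)
    have : η * logScale y H ≤ 1 / 2 * logScale y H := by gcongr <;> linarith
    linarith
  have hlog : Real.log (1 + Real.log y) ≤ 4 * Real.log H + 1 := by
    linarith [log_one_add_le_log_add_one hlogy]
  have hP_low : Real.exp (-(5 * Real.log H)) ≤ P y := exp_neg_five_mul_le_P hy hH hlog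
  have hR₁ := rankinError_smallPrimes_le_exp_neg hη hy (hH1.trans hHX) hX (by linarith) hlog hH hΛ
    hΛu_half hu_exp
  have hR₂ := rankinError_largePrimes_le_exp_neg hη (by linarith) hy (hH1.trans hHX) hX
    (by linarith) hu_rpow
  have hη6 : 0 ≤ (1 - 6 * η) * (u * Real.log u) := mul_nonneg (by linarith) (by positivity)
  refine sum_abs_roughSum_sub_le_of_rankinErrors_le hη.le (by linarith) hy hHX (hH1.trans hHX) hX
    hu hηu (by positivity) (div_nonneg (mul_nonneg (by linarith) hlogu.le) (by linarith)) hy_large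
    (four_mul_le_of_le_exp_neg hP_low hR₁ hΛ (by linarith))
    (mul_le_sqrt_of_le_exp_neg hHexp hP_low ?_ hR₁ hΛ (by linarith) (by linarith) hM)
    (hR₂.trans (Real.exp_le_one_iff.2 (by linarith)))
    (mul_mul_le_sqrt_of_le_exp_neg hHexp (P_pos y).le (density_le_one _) ?_ hR₂
      (one_add_mul_le_of_one_sub_mul_le hη.le hηδ hδ (by linarith) hΛu) hM)
  · exact rankinError_nonneg (fun p hp => (prime_of_mem_smallPrimes p hp).one_lt) (by positivity) _
  · exact rankinError_nonneg (fun p hp => (prime_of_mem_largePrimes p hp).one_lt) (by positivity) _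

/-! ### A lower bound for `M` -/

theorem two_mul_le_card_filter_oddPrimesUpTo {y : ℕ} {B : ℝ} (hB : 2 ≤ B)
    (hpi : 3 * B ≤ (y * Real.log 2 - Real.log (y + 1)) / Real.log y) :
    2 * B ≤ #({p ∈ oddPrimesUpTo y | B ≤ (p : ℝ)} : Finset ℕ) := by
  have hsub : primesUpTo y ⊆ {p ∈ oddPrimesUpTo y | B ≤ (p : ℝ)} ∪ Icc 1 ⌊B⌋₊ := by
    intro p hp
    obtain ⟨hprime, hpy⟩ := mem_primesUpTo.1 hp
    rcases le_or_gt (p : ℝ) B with hpB | hBp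
    · exact mem_union_right _ (mem_Icc.2 ⟨hprime.pos, Nat.le_floor hpB⟩)
    · have h2p : (2 : ℝ) < p := hB.trans_lt hBp
      exact mem_union_left _
        (mem_filter.2 ⟨mem_oddPrimesUpTo.2 ⟨hprime, by exact_mod_cast h2p, hpy⟩, hBp.le⟩)
  have hcard : (Nat.primeCounting y : ℝ) ≤
      #({p ∈ oddPrimesUpTo y | B ≤ (p : ℝ)} : Finset ℕ) + ⌊B⌋₊ := by
    have := (card_le_card hsub).trans (card_union_le _ _)
    rw [Nat.card_Icc, Nat.add_sub_cancel, primesUpTo, ← Nat.primesLE_eq_filter_Icc_one,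
      Nat.primesLE_card_eq_primeCounting] at this
    exact_mod_cast this
  linarith [hpi.trans (Chebyshev.pi_ge y), Nat.floor_le (by linarith : 0 ≤ B)]

theorem mul_add_log_le {η m l r c : ℝ} (hη : 0 ≤ η) (hη' : η ≤ 1 / 2) (hm : 0 < m)
    (hr1 : 1 ≤ r) (hr : r ≤ (1 + 2 * η) * (l / m) + 1) (hrl : r ≤ l) (hc : m ≤ c * l)
    (hsmall : Real.log l ≤ η * l) :
    r * (η * m + Real.log r) ≤
      l / m * Real.log l + (3 + c) * η * (l + l / m * Real.log l) := by
  have hl0 : 0 < l := by linarith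
  have hlogl : 0 ≤ Real.log l := Real.log_nonneg (by linarith)
  have hc0 : 0 ≤ c := le_of_mul_le_mul_right (by linarith) hl0
  have hrm : r * m ≤ (2 + c) * l := by
    calc r * m ≤ ((1 + 2 * η) * (l / m) + 1) * m := by gcongr
      _ = (1 + 2 * η) * l + m := by field_simp
      _ ≤ (1 + 2 * (1 / 2)) * l + c * l := by gcongr
      _ = (2 + c) * l := by ring
  have hrlog : r * Real.log r ≤ (1 + 2 * η) * (l / m * Real.log l) + Real.log l := by
    have : 0 ≤ Real.log r := Real.log_nonneg hr1
    calc r * Real.log r ≤ ((1 + 2 * η) * (l / m) + 1) * Real.log l := by gcongr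
      _ = (1 + 2 * η) * (l / m * Real.log l) + Real.log l := by ring
  have : 0 ≤ (1 + c) * η * (l / m * Real.log l) := by positivity
  linarith [mul_le_mul_of_nonneg_left hrm hη]

theorem div_one_sub_mul_le {η a b : ℝ} (hη : 0 ≤ η) (hη' : η ≤ 1 / 2) (hab : 0 ≤ a / b) :
    a / ((1 - η) * b) ≤ (1 + 2 * η) * (a / b) := by
  have hinv : 1 / (1 - η) ≤ 1 + 2 * η := by
    rw [div_le_iff₀ (by linarith)]
    nlinarith
  calc a / ((1 - η) * b) = 1 / (1 - η) * (a / b) := by rw [div_mul_div_comm, one_mul]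
    _ ≤ (1 + 2 * η) * (a / b) := by gcongr

theorem exp_neg_mul_le_div_pow {y r : ℕ} {η k : ℝ} (hy : 0 < y) (hr : 0 < r)
    (hk : 2 * (y : ℝ) ^ (1 - η) ≤ k) :
    Real.exp (-(r * (η * Real.log y + Real.log r))) ≤ (k / (2 * r * y)) ^ r := by
  have hbase : Real.exp (-(η * Real.log y + Real.log r)) =
      2 * (y : ℝ) ^ (1 - η) / (2 * r * y) := by
    rw [neg_add, Real.exp_add, Real.exp_neg (Real.log r), Real.exp_log (by positivity),
      Real.rpow_sub (by positivity), Real.rpow_one, Real.rpow_def_of_pos (by positivity),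
      mul_comm (Real.log y), Real.exp_neg]
    field_simp
  calc Real.exp (-(r * (η * Real.log y + Real.log r)))
      = Real.exp (-(η * Real.log y + Real.log r)) ^ r := by
        rw [← Real.exp_nat_mul]; congr 1; ring
    _ ≤ (k / (2 * r * y)) ^ r := by rw [hbase]; gcongr

theorem exp_neg_le_P_sq_div_two {y : ℕ} {b c : ℝ} (hy : 2 ≤ y) (hyc : Real.log y ≤ c)
    (hb : Real.log 2 + 8 + 2 * Real.log (1 + c) ≤ b) : Real.exp (-b) ≤ P y ^ 2 / 2 := by
  have hlogy : 0 < Real.log y := Real.log_pos (by exact_mod_cast hy)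
  have hP : Real.exp (-4) / (1 + c) ≤ P y :=
    (by gcongr : _ ≤ Real.exp (-4) / (1 + Real.log y)).trans (exp_neg_four_div_le_P hy)
  have hexp : Real.exp (-(Real.log 2 + 8 + 2 * Real.log (1 + c))) =
      (Real.exp (-4) / (1 + c)) ^ 2 / 2 := by
    have hsum : Real.log 2 + 8 + 2 * Real.log (1 + c) =
        (4 + Real.log (1 + c)) + (4 + Real.log (1 + c)) + Real.log 2 := by ring
    rw [hsum, Real.exp_neg, Real.exp_add, Real.exp_add, Real.exp_add,
      Real.exp_log (by linarith), Real.exp_log two_pos, Real.exp_neg]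
    field_simp
  calc Real.exp (-b) ≤ Real.exp (-(Real.log 2 + 8 + 2 * Real.log (1 + c))) := by gcongr
    _ = (Real.exp (-4) / (1 + c)) ^ 2 / 2 := hexp
    _ ≤ P y ^ 2 / 2 := by
      have : 0 < 1 + c := by linarith
      gcongr

theorem natCast_le_rpow_pow {H y r : ℕ} {a : ℝ} (hH : 0 < H) (hy : 0 < y)
    (h : Real.log H ≤ r * (a * Real.log y)) : (H : ℝ) ≤ ((y : ℝ) ^ a) ^ r := by
  rw [← Real.exp_log (by positivity : (0 : ℝ) < H), Real.rpow_def_of_pos (by positivity),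
    ← Real.exp_nat_mul, Real.exp_le_exp]
  linarith

theorem exp_neg_two_le : Real.exp (-2) ≤ 1 / 4 := by
  have htwo : (2 : ℝ) ≤ Real.exp 1 := by linarith [Real.add_one_le_exp (1 : ℝ)]
  calc Real.exp (-2) = (Real.exp 1 * Real.exp 1)⁻¹ := by
        rw [← Real.exp_add, ← Real.exp_neg]; norm_num
    _ ≤ (2 * 2)⁻¹ := by gcongr
    _ = 1 / 4 := by norm_num

theorem mul_P_mul_exp_neg_le_M_of_lt_log {y H : ℕ} {b : ℝ} (hH : 2 ≤ H)
    (hlog : 2 * Real.exp 4 * (1 + Real.log H) ≤ Real.log y) (hb : 2 ≤ b) :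
    H * P y * Real.exp (-b) ≤ M H y := by
  have hHy : H ≤ y := by
    have hlogH : 0 ≤ Real.log H := Real.log_natCast_nonneg H
    have hle : Real.log H < Real.log y := by nlinarith [Real.add_one_le_exp (4 : ℝ)]
    have hy0 : 0 < y := Nat.pos_of_ne_zero fun h => by
      norm_num [h] at hle
      linarith
    exact_mod_cast ((Real.log_lt_log_iff (by positivity) (by positivity)).1 hle).le
  calc H * P y * Real.exp (-b) ≤ H * P y * (1 / 4) := by
        have := P_pos y
        gcongr
        exact (Real.exp_le_exp.2 (by linarith)).trans exp_neg_two_le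
    _ = H * P y / 4 := by ring
    _ ≤ M H y := mul_P_div_four_le_M hH hHy hlog

-- `H` is at most a product of `r ≈ log H / log y` primes near `y`; the integers that are products
-- of `r` such primes already contribute enough to `M`.
theorem mul_P_mul_exp_neg_le_M_of_log_le {y H : ℕ} {η c : ℝ} (hη : 0 ≤ η) (hη' : η ≤ 1 / 4)
    (hy : 2 ≤ y) (hB : 2 ≤ (y : ℝ) ^ (1 - η))
    (hpi : 3 * (y : ℝ) ^ (1 - η) ≤ (y * Real.log 2 - Real.log (y + 1)) / Real.log y)
    (hlogy : 8 ≤ Real.log y) (hlogH : 8 ≤ Real.log H) (hHy : Real.log H ≤ (y : ℝ) ^ (1 - η))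
    (hsmall : Real.log (Real.log H) ≤ η * Real.log H) (hyc : Real.log y ≤ c * Real.log H)
    (hP : Real.log 2 + 8 + 2 * Real.log (1 + c * Real.log H) ≤ η * Real.log H) :
    H * P y * Real.exp (-(logScale y H - Real.log H) - (4 + c) * η * logScale y H) ≤ M H y := by
  have hH0 : 0 < H := Nat.pos_of_ne_zero fun h => by norm_num [h] at hlogH
  have hη1 : 0 < 1 - η := by linarith
  set x := Real.log H / ((1 - η) * Real.log y) with hx
  have hx0 : 0 < x := by positivity
  have hr0 : 0 < ⌈x⌉₊ := Nat.ceil_pos.2 hx0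
  have hr_lt := Nat.ceil_lt_add_one hx0.le
  have hr_ge : Real.log H ≤ ⌈x⌉₊ * ((1 - η) * Real.log y) := by
    have := Nat.le_ceil x
    rwa [hx, div_le_iff₀ (by positivity), ← hx] at this
  set r := ⌈x⌉₊
  have hrl : (r : ℝ) ≤ Real.log H := by
    have : x ≤ Real.log H / 2 := by rw [hx]; gcongr; nlinarith
    linarith
  have hcard := two_mul_le_card_filter_oddPrimesUpTo hB hpi
  set T : Finset ℕ := {p ∈ oddPrimesUpTo y | (y : ℝ) ^ (1 - η) ≤ (p : ℝ)}
  have hcard_nat : 2 * r ≤ #T := by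
    have : 2 * (r : ℝ) ≤ #T := by linarith
    exact_mod_cast this
  have hM := mul_card_div_pow_le_M hy (filter_subset _ _) (by linarith : 0 ≤ (y : ℝ) ^ (1 - η))
    (fun p hp => (mem_filter.1 hp).2) (natCast_le_rpow_pow hH0 (by omega) hr_ge) hcard_nat
  have hexponent := mul_add_log_le hη (by linarith) (by linarith) (by exact_mod_cast hr0)
    (hr_lt.le.trans (add_le_add_left (div_one_sub_mul_le hη (by linarith) (by positivity)) 1))
    hrl hyc hsmall
  refine le_trans ?_ hM
  have hPy := P_pos y
  calc H * P y * Real.exp (-(logScale y H - Real.log H) - (4 + c) * η * logScale y H)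
      ≤ H * P y * (Real.exp (-(η * Real.log H)) *
          Real.exp (-(r * (η * Real.log y + Real.log r)))) := by
        have : 0 ≤ Real.log (Real.log H) := Real.log_nonneg (by linarith)
        have : 0 ≤ η * (Real.log H / Real.log y * Real.log (Real.log H)) := by positivity
        rw [← Real.exp_add, logScale]
        gcongr
        linarith
    _ ≤ H * P y * (P y ^ 2 / 2 * ((#T : ℝ) / (2 * r * y)) ^ r) := by
        gcongr
        · exact exp_neg_le_P_sq_div_two hy hyc hP
        · exact exp_neg_mul_le_div_pow (by omega) hr0 hcard
    _ = H * P y / 2 * (P y ^ 2 * ((#T : ℝ) / (2 * r * y)) ^ r) := by ring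

theorem mul_P_mul_exp_neg_le_M {y H : ℕ} {η : ℝ} (hη : 0 ≤ η) (hη' : η ≤ 1 / 4)
    (hy : 2 ≤ y) (hB : 2 ≤ (y : ℝ) ^ (1 - η))
    (hpi : 3 * (y : ℝ) ^ (1 - η) ≤ (y * Real.log 2 - Real.log (y + 1)) / Real.log y)
    (hlogy : 8 ≤ Real.log y) (hlogH : 8 ≤ Real.log H) (hHy : Real.log H ≤ (y : ℝ) ^ (1 - η))
    (hηH : 2 ≤ (4 + 4 * Real.exp 4) * η * Real.log H)
    (hsmall : Real.log (Real.log H) ≤ η * Real.log H)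
    (hP : Real.log 2 + 8 + 2 * Real.log (1 + 4 * Real.exp 4 * Real.log H) ≤ η * Real.log H) :
    H * P y * Real.exp (-(logScale y H - Real.log H) -
      (4 + 4 * Real.exp 4) * η * logScale y H) ≤ M H y := by
  rcases le_or_gt (2 * Real.exp 4 * (1 + Real.log H)) (Real.log y) with hshort | hlong
  · have hH : 2 ≤ H := by
      by_contra! hH
      interval_cases H <;> norm_num at hlogH
    have hloglogH : 0 ≤ Real.log (Real.log H) := Real.log_nonneg (by linarith)
    have hscale := log_le_logScale (by omega : 1 ≤ y) hloglogH
    rw [← neg_add']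
    refine mul_P_mul_exp_neg_le_M_of_lt_log hH hshort ?_
    have : (4 + 4 * Real.exp 4) * η * Real.log H ≤ (4 + 4 * Real.exp 4) * η * logScale y H := by
      gcongr
    linarith
  · refine mul_P_mul_exp_neg_le_M_of_log_le hη hη' hy hB hpi hlogy hlogH hHy hsmall ?_ hP
    have : 2 * Real.exp 4 * 1 ≤ 2 * Real.exp 4 * Real.log H := by
      gcongr
      linarith
    linarith

/-! ### The first moment in the short range -/

theorem rough_anti (n : ℕ) : Antitone fun s => rough s n := fun s t h => by
  change rough t n ≤ rough s n
  rw [rough, ← prod_sdiff h]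
  exact mul_le_of_le_one_left (rough_nonneg s n) (rough_le_one _ n)

theorem primesUpTo_mono : Monotone primesUpTo := fun a b h p hp => by
  rw [mem_primesUpTo] at *
  exact ⟨hp.1, hp.2.trans h⟩

theorem prod_primesUpTo_one_add_rpow_le {y : ℕ} {σ : ℝ} (hy : 2 ≤ y) (hσ : 0 ≤ σ)
    (hσy : σ * Real.log y ≤ 1) :
    ∏ p ∈ primesUpTo y, (1 + (p : ℝ) ^ (σ - 1)) ≤
      Real.exp (12 + 3 * Real.log (1 + Real.log y)) := by
  have hterm : ∀ p ∈ primesUpTo y, (p : ℝ) ^ (σ - 1) ≤ 3 * (1 / (p : ℝ)) := fun p hp => by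
    have hp0 : (0 : ℝ) < p := by exact_mod_cast (prime_of_mem_primesUpTo p hp).pos
    rw [Real.rpow_sub_one hp0.ne', ← mul_div_assoc, mul_one]
    gcongr
    calc (p : ℝ) ^ σ ≤ (y : ℝ) ^ σ := by gcongr; exact (mem_primesUpTo.1 hp).2
      _ ≤ Real.exp 1 := by
        rw [Real.rpow_def_of_pos (by positivity), mul_comm]
        exact Real.exp_le_exp.2 hσy
      _ ≤ 3 := by linarith [Real.exp_one_lt_d9]
  calc ∏ p ∈ primesUpTo y, (1 + (p : ℝ) ^ (σ - 1))
      ≤ ∏ p ∈ primesUpTo y, Real.exp ((p : ℝ) ^ (σ - 1)) := by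
        gcongr with p
        linarith [Real.add_one_le_exp ((p : ℝ) ^ (σ - 1))]
    _ = Real.exp (∑ p ∈ primesUpTo y, (p : ℝ) ^ (σ - 1)) := (Real.exp_sum _ _).symm
    _ ≤ Real.exp (12 + 3 * Real.log (1 + Real.log y)) := by
      have hsum := sum_le_sum hterm
      rw [← mul_sum] at hsum
      rw [Real.exp_le_exp]
      linarith [sum_one_div_primesUpTo_le hy]

theorem sum_rough_primesUpTo_le {y N : ℕ} (hy : 2 ≤ y) (hN : 1 ≤ N) :
    ∑ n ∈ Icc 1 N, rough (primesUpTo y) n ≤ N / Real.log y + √N +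
      2 * N * Real.exp (12 + 3 * Real.log (1 + Real.log y) -
        Real.log N / (2 * Real.log y)) := by
  have hlogy : 0 < Real.log y := Real.log_pos (by exact_mod_cast hy)
  have hN0 : (0 : ℝ) < N := by exact_mod_cast hN
  have hD : √(N : ℝ) ^ (-(1 / Real.log y)) = Real.exp (-(Real.log N / (2 * Real.log y))) := by
    rw [Real.rpow_def_of_pos (by positivity), Real.log_sqrt hN0.le]
    congr 1; field_simp
  refine (sum_rough_le prime_of_mem_primesUpTo (Real.sqrt_pos.2 hN0)
    (by positivity : 0 ≤ 1 / Real.log y) N).trans ?_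
  rw [density_primesUpTo, hD, sub_eq_neg_add (12 + 3 * Real.log (1 + Real.log y)), Real.exp_add]
  gcongr
  · rw [div_eq_mul_one_div]
    gcongr
    exact P_le_one_div_log hy
  · exact prod_primesUpTo_one_add_rpow_le hy (by positivity) (by field_simp; rfl)

theorem half_le_log_floor_exp {x : ℝ} (hx : 2 ≤ x) : x / 2 ≤ Real.log ⌊Real.exp x⌋₊ := by
  have hexp := Real.add_one_le_exp x
  have hfloor : Real.exp x / 2 ≤ ⌊Real.exp x⌋₊ := by linarith [Nat.lt_floor_add_one (Real.exp x)]
  have hlog := Real.log_le_log (by positivity) hfloor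
  rw [Real.log_div (Real.exp_ne_zero x) two_ne_zero, Real.log_exp] at hlog
  linarith [Real.log_two_lt_d9]

-- Sifting only by the primes up to `exp ((log y) ^ (3 / 4))` costs nothing that matters here and
-- keeps the level of the sieve below `√N`.
theorem sum_rough_primesUpTo_le_of_log_eq {y N : ℕ} {t : ℝ} (ht : 2 ≤ t)
    (hy : Real.log y = t ^ 4) (hy0 : 0 < y) (hyN : y ≤ N) (ht_pow : t ^ 3 ≤ Real.exp (t ^ 4 / 2))
    (ht_exp : 2 * Real.exp (-(t / 2) + (12 + 3 * Real.log (1 + t ^ 4))) ≤ 1 / t ^ 3) :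
    ∑ n ∈ Icc 1 N, rough (primesUpTo y) n ≤ N * (4 / t ^ 3) := by
  have ht3 : 2 ≤ t ^ 3 := ht.trans (le_self_pow₀ (by linarith) three_ne_zero)
  have ht34 : t ^ 3 ≤ t ^ 4 := pow_le_pow_right₀ (by linarith) (by norm_num)
  have hN0 : (0 : ℝ) < N := by exact_mod_cast hy0.trans_le hyN
  have hlogN : t ^ 4 ≤ Real.log N := hy ▸ Real.log_le_log (by positivity) (by exact_mod_cast hyN)
  have hz_le : (⌊Real.exp (t ^ 3)⌋₊ : ℝ) ≤ Real.exp (t ^ 3) := Nat.floor_le (Real.exp_pos _).le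
  have hlog_ge := half_le_log_floor_exp ht3
  have hz2 : 2 ≤ ⌊Real.exp (t ^ 3)⌋₊ :=
    Nat.le_floor (by push_cast; linarith [Real.add_one_le_exp (t ^ 3)])
  set z := ⌊Real.exp (t ^ 3)⌋₊
  have hlog_le : Real.log z ≤ t ^ 3 := (Real.log_le_iff_le_exp (by positivity)).2 hz_le
  have hzy : z ≤ y := by
    have : (z : ℝ) ≤ y := (Real.log_le_log_iff (by positivity) (by positivity)).1 (by linarith)
    exact_mod_cast this
  have hsqrt : √(N : ℝ) ≤ N / t ^ 3 := by
    rw [le_div_iff₀ (by positivity)]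
    calc √(N : ℝ) * t ^ 3 ≤ √(N : ℝ) * √(N : ℝ) := by
          gcongr
          refine ht_pow.trans ?_
          rw [← Real.le_log_iff_exp_le (by positivity), Real.log_sqrt hN0.le]
          linarith
      _ = N := Real.mul_self_sqrt hN0.le
  have htail : 2 * Real.exp (12 + 3 * Real.log (1 + Real.log z) -
      Real.log N / (2 * Real.log z)) ≤ 1 / t ^ 3 := by
    refine le_trans ?_ ht_exp
    have : 0 < Real.log z := by linarith
    have hquot : t / 2 ≤ Real.log N / (2 * Real.log z) := by
      calc t / 2 = t ^ 4 / (2 * t ^ 3) := by field_simp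
        _ ≤ Real.log N / (2 * Real.log z) := by gcongr
    have hlog : Real.log (1 + Real.log z) ≤ Real.log (1 + t ^ 4) :=
      Real.log_le_log (by linarith) (by linarith)
    gcongr
    linarith
  calc ∑ n ∈ Icc 1 N, rough (primesUpTo y) n ≤ ∑ n ∈ Icc 1 N, rough (primesUpTo z) n :=
        sum_le_sum fun n _ => rough_anti n (primesUpTo_mono hzy)
    _ ≤ N / Real.log z + √N + 2 * N * Real.exp (12 + 3 * Real.log (1 + Real.log z) -
          Real.log N / (2 * Real.log z)) := sum_rough_primesUpTo_le hz2 (by omega)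
    _ ≤ N / (t ^ 3 / 2) + N / t ^ 3 + N * (1 / t ^ 3) := by
      rw [mul_comm 2 (N : ℝ), mul_assoc]
      gcongr
    _ = N * (4 / t ^ 3) := by field_simp; norm_num

theorem le_two_mul_sqrt {a M : ℝ} (h : a ^ 2 / 4 ≤ M) : a ≤ 2 * √M := by
  have := Real.le_sqrt_of_sq_le (x := a / 2) (by linarith : (a / 2) ^ 2 ≤ M)
  linarith

theorem sum_abs_roughSum_sub_le_mul (y H X : ℕ) {ρ : ℝ}
    (hρ : ∑ n ∈ Icc 1 (X + H), rough (primesUpTo y) n ≤ (X + H : ℕ) * ρ) :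
    ∑ n ∈ range (X + 1), |roughSum (primesUpTo y) H n - H * P y| ≤
      H * ((X + H : ℕ) * ρ) + (X + 1) * (H * P y) := by
  have hHP : 0 ≤ H * P y := mul_nonneg H.cast_nonneg (P_pos y).le
  calc ∑ n ∈ range (X + 1), |roughSum (primesUpTo y) H n - H * P y|
      ≤ ∑ n ∈ range (X + 1), (roughSum (primesUpTo y) H n + H * P y) := by
        gcongr with n
        have : 0 ≤ roughSum (primesUpTo y) H n := sum_nonneg fun h _ => rough_nonneg _ _
        rw [abs_le]
        constructor <;> linarith
    _ = ∑ n ∈ range (X + 1), roughSum (primesUpTo y) H n + (X + 1) * (H * P y) := by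
        rw [sum_add_distrib, sum_const, nsmul_eq_mul, card_range, Nat.cast_add_one]
    _ ≤ H * ((X + H : ℕ) * ρ) + (X + 1) * (H * P y) := by
        gcongr
        refine (sum_range_sum_shift_le (rough_nonneg (primesUpTo y)) X H).trans ?_
        gcongr

theorem mul_P_div_four_le_M_of_log_eq {y H : ℕ} {t : ℝ} (hy : Real.log y = t ^ 4) (hH : 2 ≤ H)
    (hHt : (H : ℝ) ≤ t) (ht_log : 2 * Real.exp 4 * (1 + Real.log t) ≤ t ^ 4) :
    H ≤ y ∧ H * P y / 4 ≤ M H y := by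
  have hH2 : (2 : ℝ) ≤ H := by exact_mod_cast hH
  have ht0 : 0 < t := by linarith
  have hHy : (H : ℝ) ≤ y := by
    have hlog : 0 < Real.log y := hy ▸ by positivity
    have hy0 : 0 < y := Nat.pos_of_ne_zero fun h => by simp [h] at hlog
    have ht4 : t ≤ t ^ 4 := le_self_pow₀ (by linarith) (by norm_num)
    have := Real.add_one_le_exp (Real.log y)
    rw [Real.exp_log (by positivity)] at this
    linarith
  have hHy : H ≤ y := by exact_mod_cast hHy
  refine ⟨hHy, mul_P_div_four_le_M hH hHy (hy ▸ le_trans ?_ ht_log)⟩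
  gcongr

-- Here `y` is so large in terms of `H` that already `∑ n, roughSum + X H P y` is small enough.
theorem sum_abs_roughSum_sub_le_of_short {y H X : ℕ} {t : ℝ} (hy : Real.log y = t ^ 4)
    (hH : 2 ≤ H) (hHt : (H : ℝ) ≤ t) (hyX : y ≤ X) (ht_pow : t ^ 3 ≤ Real.exp (t ^ 4 / 2))
    (ht_exp : 2 * Real.exp (-(t / 2) + (12 + 3 * Real.log (1 + t ^ 4))) ≤ 1 / t ^ 3)
    (ht_log : 2 * Real.exp 4 * (1 + Real.log t) ≤ t ^ 4)
    (ht_five : Real.exp 4 * (1 + t ^ 4) ≤ t ^ 5) :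
    ∑ n ∈ range (X + 1), |roughSum (primesUpTo y) H n - H * P y| ≤ 20 * X * √(M H y) := by
  have hH2 : (2 : ℝ) ≤ H := by exact_mod_cast hH
  have ht0 : 0 < t := by linarith
  obtain ⟨hHy, hM⟩ := mul_P_div_four_le_M_of_log_eq hy hH hHt ht_log
  have hP0 := P_pos y
  have hP_le : P y ≤ 1 / t ^ 4 := hy ▸ P_le_one_div_log (hH.trans hHy)
  have hP_ge : 1 / t ^ 5 ≤ P y :=
    calc 1 / t ^ 5 ≤ 1 / (Real.exp 4 * (1 + t ^ 4)) := by gcongr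
      _ = Real.exp (-4) / (1 + Real.log y) := by rw [hy, Real.exp_neg]; field_simp
      _ ≤ P y := exp_neg_four_div_le_P (hH.trans hHy)
  have hHP : H * P y ≤ 2 * √(M H y) := by
    refine le_two_mul_sqrt (le_trans ?_ hM)
    have : H * P y ≤ 1 :=
      calc H * P y ≤ t * (1 / t ^ 4) := by gcongr
        _ = 1 / t ^ 3 := by field_simp
        _ ≤ 1 := div_le_one_of_le₀ (one_le_pow₀ (by linarith)) (by positivity)
    gcongr
    rw [sq]
    exact mul_le_of_le_one_left (by positivity) this
  have hHt3 : H / t ^ 3 ≤ 2 * √(M H y) := by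
    refine le_two_mul_sqrt (le_trans ?_ hM)
    gcongr
    calc (H / t ^ 3) ^ 2 = H * (H / t ^ 6) := by field_simp
      _ ≤ H * (t / t ^ 6) := by gcongr
      _ = H * (1 / t ^ 5) := by field_simp
      _ ≤ H * P y := by gcongr
  have hXH : ((X + H : ℕ) : ℝ) ≤ 2 * X := by exact_mod_cast (by omega : X + H ≤ 2 * X)
  have hX1 : (1 : ℝ) ≤ X := by exact_mod_cast (by omega : 1 ≤ X)
  calc ∑ n ∈ range (X + 1), |roughSum (primesUpTo y) H n - H * P y|
      ≤ H * ((X + H : ℕ) * (4 / t ^ 3)) + (X + 1) * (H * P y) :=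
        sum_abs_roughSum_sub_le_mul y H X
          (sum_rough_primesUpTo_le_of_log_eq (by linarith) hy (by omega) (by omega) ht_pow ht_exp)
    _ = 4 * (X + H : ℕ) * (H / t ^ 3) + (X + 1) * (H * P y) := by ring
    _ ≤ 4 * (2 * X) * (2 * √(M H y)) + (X + X) * (2 * √(M H y)) := by gcongr
    _ = 20 * X * √(M H y) := by ring

/-! ### Asymptotic inequalities -/

open Filter Topology MeasureTheory

theorem eventually_add_log_le_mul (K : ℝ) {κ : ℝ} (hκ : 0 < κ) :
    ∀ᶠ t : ℝ in atTop, K + Real.log t ≤ κ * t := by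
  filter_upwards [Real.isLittleO_log_id_atTop.def (half_pos hκ), eventually_ge_atTop 0,
    eventually_ge_atTop (K / (κ / 2))] with t hlog ht hK
  rw [Real.norm_eq_abs, id, Real.norm_of_nonneg ht] at hlog
  rw [div_le_iff₀ (half_pos hκ)] at hK
  linarith [le_abs_self (Real.log t)]

theorem eventually_add_two_mul_log_le_mul (K : ℝ) {c κ : ℝ} (hc : 0 < c) (hκ : 0 < κ) :
    ∀ᶠ t : ℝ in atTop, K + 2 * Real.log (1 + c * t) ≤ κ * t := by
  have hlim : Tendsto (fun t : ℝ => 1 + c * t) atTop atTop :=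
    tendsto_atTop_add_const_left _ _ (tendsto_id.const_mul_atTop hc)
  filter_upwards [hlim.eventually (eventually_add_log_le_mul (K / 2 + κ / (2 * c))
    (by positivity : 0 < κ / (2 * c)))] with t ht
  have : κ / (2 * c) * (1 + c * t) = κ / (2 * c) + κ * t / 2 := by field_simp
  linarith

theorem eventually_mul_pow_le_exp_half {K : ℝ} (hK : 0 < K) (n : ℕ) :
    ∀ᶠ t : ℝ in atTop, K * t ^ n ≤ Real.exp (t / 2) := by
  filter_upwards [(isLittleO_pow_exp_pos_mul_atTop n (by norm_num : (0 : ℝ) < 1 / 2)).def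
    (by positivity : 0 < 1 / K), eventually_ge_atTop 0] with t hpow ht
  rw [Real.norm_of_nonneg (by positivity), Real.norm_of_nonneg (by positivity),
    one_div_mul_eq_div, one_div_mul_eq_div, le_div_iff₀' hK] at hpow
  exact hpow

theorem eventually_mul_rpow_one_sub_le {η : ℝ} (hη : 0 < η) (K : ℝ) :
    ∀ᶠ u : ℝ in atTop, K * u ^ (1 - η) ≤ η * (u * Real.log u) := by
  filter_upwards [eventually_ge_atTop 1, Real.tendsto_log_atTop.eventually_ge_atTop (K / η)]
    with u hu hlog
  rw [div_le_iff₀ hη] at hlog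
  calc K * u ^ (1 - η) ≤ Real.log u * η * u ^ (1 - η) := by gcongr
    _ ≤ Real.log u * η * u := by
      have := Real.log_nonneg hu
      gcongr
      exact Real.rpow_le_self_of_one_le hu (by linarith)
    _ = η * (u * Real.log u) := by ring

theorem eventually_add_log_mul_exp_half_log_le :
    ∀ᶠ u : ℝ in atTop, 24 + 6 * Real.log u * Real.exp (Real.log u / 2) ≤ u * Real.log u := by
  filter_upwards [eventually_gt_atTop 0, Real.tendsto_log_atTop.eventually_ge_atTop 24]
    with u hu hlog
  have hexp : Real.exp (Real.log u / 2) * Real.exp (Real.log u / 2) = u := by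
    rw [← Real.exp_add, add_halves, Real.exp_log hu]
  have hexp_ge : 12 ≤ Real.exp (Real.log u / 2) := by
    linarith [Real.add_one_le_exp (Real.log u / 2)]
  have hle : 6 * Real.exp (Real.log u / 2) ≤ u / 2 := by nlinarith
  have := mul_le_mul_of_nonneg_right hle (by linarith : 0 ≤ Real.log u)
  nlinarith

theorem eventually_three_mul_rpow_one_sub_le {η : ℝ} (hη : 0 < η) :
    ∀ᶠ y : ℝ in atTop,
      3 * y ^ (1 - η) ≤ (y * Real.log 2 - Real.log (y + 1)) / Real.log y := by
  filter_upwards [(isLittleO_log_rpow_atTop hη).def (by norm_num : (0 : ℝ) < 1 / 10),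
    (tendsto_atTop_add_const_right atTop (1 : ℝ) tendsto_id).eventually
      (eventually_add_log_le_mul 0 (by norm_num : (0 : ℝ) < 1 / 10)),
    Real.tendsto_log_atTop.eventually_gt_atTop 0, eventually_ge_atTop 2]
    with y hlog hlog_succ hlog_pos hy2
  have hy : 0 < y := by linarith
  rw [Real.norm_of_nonneg hlog_pos.le, Real.norm_of_nonneg (by positivity)] at hlog
  rw [id] at hlog_succ
  rw [le_div_iff₀ hlog_pos]
  have hprod : y ^ (1 - η) * Real.log y ≤ y / 10 :=
    calc y ^ (1 - η) * Real.log y ≤ y ^ (1 - η) * (1 / 10 * y ^ η) := by gcongr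
      _ = y ^ (1 - η + η) / 10 := by rw [Real.rpow_add hy]; ring
      _ = y / 10 := by rw [sub_add_cancel, Real.rpow_one]
  nlinarith [Real.log_two_gt_d9]

theorem two_mul_exp_neg_half_add_le {t : ℝ} (ht : 1 ≤ t)
    (hexp : 16 * Real.exp 12 * t ^ 15 ≤ Real.exp (t / 2)) :
    2 * Real.exp (-(t / 2) + (12 + 3 * Real.log (1 + t ^ 4))) ≤ 1 / t ^ 3 := by
  have hlog : Real.exp (3 * Real.log (1 + t ^ 4)) ≤ 8 * t ^ 12 := by
    rw [mul_comm, Real.exp_mul, Real.exp_log (by positivity)]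
    calc (1 + t ^ 4) ^ (3 : ℝ) = (1 + t ^ 4) ^ 3 := by norm_cast
      _ ≤ (t ^ 4 + t ^ 4) ^ 3 := by gcongr; exact one_le_pow₀ ht
      _ = 8 * t ^ 12 := by ring
  rw [le_div_iff₀ (by positivity), Real.exp_add, Real.exp_add, Real.exp_neg]
  calc 2 * ((Real.exp (t / 2))⁻¹ * (Real.exp 12 * Real.exp (3 * Real.log (1 + t ^ 4)))) * t ^ 3
      ≤ 2 * ((Real.exp (t / 2))⁻¹ * (Real.exp 12 * (8 * t ^ 12))) * t ^ 3 := by gcongr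
    _ = 16 * Real.exp 12 * t ^ 15 / Real.exp (t / 2) := by ring
    _ ≤ 1 := (div_le_one (Real.exp_pos _)).2 hexp

theorem log_le_rpow_one_sub {l y ε η : ℝ} (hl : 0 ≤ l) (hy : 1 ≤ y) (hε : 0 < ε)
    (hη : η ≤ ε / (1 + ε)) (hly : l ^ (1 + ε) ≤ y) : l ≤ y ^ (1 - η) := by
  calc l = (l ^ (1 + ε)) ^ (1 / (1 + ε)) := by
        rw [← Real.rpow_mul hl, mul_one_div_cancel (by positivity), Real.rpow_one]
    _ ≤ y ^ (1 / (1 + ε)) := by gcongr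
    _ ≤ y ^ (1 - η) := by
      refine Real.rpow_le_rpow_of_exponent_le hy ?_
      have : 1 / (1 + ε) = 1 - ε / (1 + ε) := by field_simp; ring
      linarith

/-! ### The first moment along the sequences -/

section Sequences

variable {ι : Type*} {l : Filter ι} {y H X : ι → ℕ} {δ η : ℝ}

theorem tendsto_log_natCast {a : ι → ℕ} (ha : Tendsto a l atTop) :
    Tendsto (fun k => Real.log (a k)) l atTop :=
  Real.tendsto_log_atTop.comp (tendsto_natCast_atTop_atTop.comp ha)

theorem tendsto_log_div_log (hδ : 0 ≤ δ) (hH : Tendsto H l atTop)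
    (hcond : ∀ᶠ k in l, (1 + Real.log (Real.log (H k)) / Real.log (y k)) *
      (Real.log (H k) / Real.log (Real.log (H k))) ≤
        (1 - δ) * (Real.log (X k) / Real.log (y k))) :
    Tendsto (fun k => Real.log (X k) / Real.log (y k)) l atTop := by
  have hlogH := tendsto_log_natCast hH
  refine tendsto_atTop.2 fun A => ?_
  filter_upwards [hcond, hlogH.eventually (eventually_add_log_le_mul 0
      (by positivity : 0 < 1 / (|A| + 1))),
    (Real.tendsto_log_atTop.comp hlogH).eventually_ge_atTop 1] with k hcond hlogH hlog₂H
  rw [Function.comp_apply] at hlog₂H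
  rw [zero_add, one_div_mul_eq_div, le_div_iff₀ (by positivity)] at hlogH
  have hu : 0 ≤ Real.log (X k) / Real.log (y k) :=
    div_nonneg (Real.log_natCast_nonneg _) (Real.log_natCast_nonneg _)
  have hfactor : 0 ≤ Real.log (Real.log (H k)) / Real.log (y k) :=
    div_nonneg (by linarith) (Real.log_natCast_nonneg _)
  have hquot : |A| + 1 ≤ Real.log (H k) / Real.log (Real.log (H k)) := by
    rw [le_div_iff₀ (by linarith)]
    linarith
  calc A ≤ |A| + 1 := (le_abs_self A).trans (by linarith)
    _ ≤ Real.log (H k) / Real.log (Real.log (H k)) := hquot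
    _ ≤ (1 + Real.log (Real.log (H k)) / Real.log (y k)) *
        (Real.log (H k) / Real.log (Real.log (H k))) :=
      le_mul_of_one_le_left ((by positivity : 0 ≤ |A| + 1).trans hquot) (by linarith)
    _ ≤ (1 - δ) * (Real.log (X k) / Real.log (y k)) := hcond
    _ ≤ Real.log (X k) / Real.log (y k) := mul_le_of_le_one_left hu (by linarith)

theorem eventually_mul_P_mul_exp_neg_le_M (hη : 0 < η) (hη' : η ≤ 1 / 4) (hy : Tendsto y l atTop)
    (hH : Tendsto H l atTop) (hHy : ∀ᶠ k in l, Real.log (H k) ≤ (y k : ℝ) ^ (1 - η)) :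
    ∀ᶠ k in l, H k * P (y k) * Real.exp (-(logScale (y k) (H k) - Real.log (H k)) -
      (4 + 4 * Real.exp 4) * η * logScale (y k) (H k)) ≤ M (H k) (y k) := by
  have hy' : Tendsto (fun k => (y k : ℝ)) l atTop := tendsto_natCast_atTop_atTop.comp hy
  have hlogH := tendsto_log_natCast hH
  filter_upwards [hHy, hy.eventually_ge_atTop 2,
    ((tendsto_rpow_atTop (by linarith : 0 < 1 - η)).comp hy').eventually_ge_atTop 2,
    hy'.eventually (eventually_three_mul_rpow_one_sub_le hη),
    (tendsto_log_natCast hy).eventually_ge_atTop 8, hlogH.eventually_ge_atTop 8,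
    (hlogH.const_mul_atTop (by positivity : 0 < (4 + 4 * Real.exp 4) * η)).eventually_ge_atTop 2,
    hlogH.eventually (eventually_add_log_le_mul 0 hη),
    hlogH.eventually (eventually_add_two_mul_log_le_mul (Real.log 2 + 8)
      (by positivity : 0 < 4 * Real.exp 4) hη)]
    with k hHy hy hB hpi hlogy hlogH hηH hlog₂H hP
  rw [zero_add] at hlog₂H
  exact mul_P_mul_exp_neg_le_M hη.le hη' hy hB hpi hlogy hlogH hHy hηH hlog₂H hP

theorem eventually_sum_abs_roughSum_sub_le_of_long (hη : 0 < η) (hηδ : 8 * η ≤ δ)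
    (hδ : δ ≤ 1 / 2) (hy : Tendsto y l atTop) (hH : Tendsto H l atTop)
    (hHX : ∀ k, H k ≤ X k)
    (hcond : ∀ᶠ k in l, (1 + Real.log (Real.log (H k)) / Real.log (y k)) *
      (Real.log (H k) / Real.log (Real.log (H k))) ≤
        (1 - δ) * (Real.log (X k) / Real.log (y k)))
    (hM : ∀ᶠ k in l, H k * P (y k) * Real.exp (-(logScale (y k) (H k) - Real.log (H k)) -
      η * logScale (y k) (H k)) ≤ M (H k) (y k)) :
    ∀ᶠ k in l, Real.log (Real.log (y k)) ≤ 4 * Real.log (H k) →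
      ∑ n ∈ range (X k + 1), |roughSum (primesUpTo (y k)) (H k) n - H k * P (y k)| ≤
        18 * X k * √(M (H k) (y k)) := by
  have hu := tendsto_log_div_log (by linarith) hH hcond
  have hlogH := tendsto_log_natCast hH
  have hlog₂H := Real.tendsto_log_atTop.comp hlogH
  filter_upwards [hcond, hM, (tendsto_log_natCast hy).eventually_ge_atTop 1,
    hlogH.eventually_ge_atTop 5, hlog₂H.eventually_gt_atTop 0,
    hlog₂H.eventually (eventually_add_log_le_mul 0 hη), hu.eventually_ge_atTop 4,
    (hu.const_mul_atTop (by positivity : 0 < 2 * η)).eventually_ge_atTop 1,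
    hu.eventually (eventually_mul_rpow_one_sub_le hη _),
    hu.eventually eventually_add_log_mul_exp_half_log_le,
    (tendsto_natCast_atTop_atTop.comp hy).eventually
      (eventually_add_log_le_mul 1 (by positivity : 0 < 1 / (4 * Real.exp 4)))]
    with k hcond hM hlogy hlogH hlog₂H hlog₃H hu hηu hu_rpow hu_exp hy_large hloglogy
  rw [zero_add] at hlog₃H
  rw [one_div_mul_eq_div, le_div_iff₀' (by positivity)] at hy_large
  exact sum_abs_roughSum_sub_le_of_long hη hηδ hδ (hHX k)
    (div_mul_cancel₀ _ (by linarith : Real.log (y k) ≠ 0)).symm hcond hloglogy hlogy hlogH hlog₂H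
    hlog₃H hu hηu hu_rpow hu_exp hy_large hM

theorem eventually_sum_abs_roughSum_sub_le_of_short (hy : Tendsto y l atTop)
    (hH : ∀ k, 2 ≤ H k) (hyX : ∀ k, y k ≤ X k) :
    ∀ᶠ k in l, 4 * Real.log (H k) < Real.log (Real.log (y k)) →
      ∑ n ∈ range (X k + 1), |roughSum (primesUpTo (y k)) (H k) n - H k * P (y k)| ≤
        20 * X k * √(M (H k) (y k)) := by
  have hlogy := tendsto_log_natCast hy
  have ht : Tendsto (fun k => Real.log (y k) ^ (1 / 4 : ℝ)) l atTop :=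
    (tendsto_rpow_atTop (by norm_num)).comp hlogy
  filter_upwards [hlogy.eventually_gt_atTop 0, ht.eventually_ge_atTop 1,
    ht.eventually_ge_atTop (2 * Real.exp 4),
    ht.eventually (eventually_mul_pow_le_exp_half one_pos 3),
    ht.eventually (eventually_mul_pow_le_exp_half (by positivity : 0 < 16 * Real.exp 12) 15),
    ht.eventually (eventually_add_log_le_mul 1 (by positivity : 0 < 1 / (2 * Real.exp 4)))]
    with k hlogy ht1 ht2 hpow hexp hlogt hshort
  set t := Real.log (y k) ^ (1 / 4 : ℝ) with ht_def
  have ht4 : t ≤ t ^ 4 := le_self_pow₀ ht1 (by norm_num)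
  rw [one_div_mul_eq_div, le_div_iff₀' (by positivity)] at hlogt
  refine sum_abs_roughSum_sub_le_of_short (t := t) ?_ (hH k) ?_ (hyX k) ?_
    (two_mul_exp_neg_half_add_le ht1 hexp) (hlogt.trans ht4) ?_
  · rw [ht_def, ← Real.rpow_mul_natCast hlogy.le]
    norm_num
  · have hH0 : 0 < H k := zero_lt_two.trans_le (hH k)
    rw [← Real.log_le_log_iff (by positivity) (by positivity), ht_def, Real.log_rpow hlogy]
    linarith
  · rw [one_mul] at hpow
    exact hpow.trans (Real.exp_le_exp.2 (by linarith))
  · calc Real.exp 4 * (1 + t ^ 4) ≤ Real.exp 4 * (t ^ 4 + t ^ 4) := by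
          gcongr; exact one_le_pow₀ ht1
      _ = 2 * Real.exp 4 * t ^ 4 := by ring
      _ ≤ t * t ^ 4 := by gcongr
      _ = t ^ 5 := by ring

theorem eventually_sum_abs_roughSum_sub_le {ε : ℝ} (hε : 0 < ε) (hδ : 0 < δ)
    (hy : Tendsto y l atTop) (hH : Tendsto H l atTop)
    (hyHX : ∀ k, 1 < y k ∧ y k ≤ X k ∧ 1 < H k ∧ H k ≤ X k)
    (hlog : ∀ᶠ k in l, Real.log (H k) ^ (1 + ε) ≤ (y k : ℝ))
    (hcond : ∀ᶠ k in l, (1 + Real.log (Real.log (H k)) / Real.log (y k)) *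
      (Real.log (H k) / Real.log (Real.log (H k))) ≤
        (1 - δ) * (Real.log (X k) / Real.log (y k))) :
    ∀ᶠ k in l, 0 < M (H k) (y k) ∧
      ∑ n ∈ range (X k + 1), |roughSum (primesUpTo (y k)) (H k) n - H k * P (y k)| ≤
        20 * X k * √(M (H k) (y k)) := by
  obtain ⟨δ', hδ'0, hδ'δ, hδ'⟩ : ∃ δ' : ℝ, 0 < δ' ∧ δ' ≤ δ ∧ δ' ≤ 1 / 2 :=
    ⟨min δ (1 / 2), by positivity, min_le_left _ _, min_le_right _ _⟩
  obtain ⟨η, hη0, hη⟩ : ∃ η : ℝ, 0 < η ∧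
      η ≤ min (1 / 4) (min (ε / (1 + ε)) (δ' / (8 * (4 + 4 * Real.exp 4)))) :=
    ⟨_, by positivity, le_rfl⟩
  rw [le_min_iff, le_min_iff, le_div_iff₀ (by positivity : 0 < 8 * (4 + 4 * Real.exp 4))] at hη
  obtain ⟨hη4, hηε, hηδ⟩ := hη
  have hM := eventually_mul_P_mul_exp_neg_le_M hη0 hη4 hy hH <| hlog.mono fun k hk =>
    log_le_rpow_one_sub (Real.log_natCast_nonneg _) (by exact_mod_cast (hyHX k).1.le) hε hηε hk
  have hcond' : ∀ᶠ k in l, (1 + Real.log (Real.log (H k)) / Real.log (y k)) *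
      (Real.log (H k) / Real.log (Real.log (H k))) ≤
        (1 - δ') * (Real.log (X k) / Real.log (y k)) := by
    filter_upwards [hcond] with k hk
    refine hk.trans (mul_le_mul_of_nonneg_right (by linarith) ?_)
    exact div_nonneg (Real.log_natCast_nonneg _) (Real.log_natCast_nonneg _)
  filter_upwards [hM, eventually_sum_abs_roughSum_sub_le_of_long (by positivity) (by linarith) hδ'
      hy hH (fun k => (hyHX k).2.2.2) hcond' hM,
    eventually_sum_abs_roughSum_sub_le_of_short hy (fun k => (hyHX k).2.2.1)
      (fun k => (hyHX k).2.1)] with k hM hlong hshort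
  have hH0 : 0 < H k := one_pos.trans (hyHX k).2.2.1
  have hP := P_pos (y k)
  refine ⟨lt_of_lt_of_le (by positivity) hM, ?_⟩
  rcases le_or_gt (Real.log (Real.log (y k))) (4 * Real.log (H k)) with h | h
  · refine (hlong h).trans ?_
    gcongr
    norm_num
  · exact hshort h

end Sequences

/-! ### From the first moment to almost all `x` -/

theorem alpha_eq_rough (y n : ℕ) : alpha y n = rough (primesUpTo y) n := by
  rw [alpha, rough]
  split_ifs with h
  · refine (prod_eq_one fun p hp => if_neg fun hdvd => ?_).symm
    rw [mem_primesUpTo] at hp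
    exact absurd (h p hp.1 hdvd) (not_lt.2 hp.2)
  · push Not at h
    obtain ⟨p, hp, hdvd, hle⟩ := h
    rw [eq_comm]
    exact prod_eq_zero (i := p) (mem_primesUpTo.2 ⟨hp, hle⟩) (if_pos hdvd)

theorem roughCount_eq_roughSum (y H : ℕ) {x : ℝ} (hx : 0 ≤ x) :
    roughCount y H x = roughSum (primesUpTo y) H ⌊x⌋₊ := by
  have himage : Ioc ⌊x⌋₊ (⌊x⌋₊ + H) = (Icc 1 H).image (⌊x⌋₊ + ·) := by
    rw [image_add_left_Icc, Icc_add_one_left_eq_Ioc]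
  rw [roughCount, roughSum, Nat.floor_add_natCast hx, himage,
    sum_image (add_right_injective _).injOn]
  exact sum_congr rfl fun h _ => alpha_eq_rough y _

theorem card_filter_lt_abs_le {ι : Type*} {T : Finset ι} {f : ι → ℝ} {c S : ℝ} (hc : 0 < c)
    (hsum : ∑ n ∈ T, |f n| ≤ S) : #{n ∈ T | c < |f n|} ≤ S / c := by
  rw [le_div_iff₀ hc]
  calc (#{n ∈ T | c < |f n|} : ℝ) * c ≤ ∑ n ∈ T with c < |f n|, |f n| := by
        rw [← nsmul_eq_mul]
        exact card_nsmul_le_sum _ _ _ fun n hn => (mem_filter.1 hn).2.le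
    _ ≤ ∑ n ∈ T, |f n| :=
      sum_le_sum_of_subset_of_nonneg (filter_subset _ _) fun _ _ _ => abs_nonneg _
    _ ≤ S := hsum

theorem volume_lt_abs_floor_le {f : ℕ → ℝ} {τ : ℝ → ℝ} {X : ℕ} {a c S : ℝ} (ha : 0 ≤ a)
    (hc : 0 < c) (hτ : ∀ x, a ≤ x → c ≤ τ x) (hsum : ∑ n ∈ range (X + 1), |f n| ≤ S) :
    volume {x : ℝ | x ∈ Set.Icc (0 : ℝ) X ∧ τ x < |f ⌊x⌋₊|} ≤ ENNReal.ofReal (a + S / c) := by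
  set T := {n ∈ range (X + 1) | c < |f n|} with hT
  have hsub : {x : ℝ | x ∈ Set.Icc (0 : ℝ) X ∧ τ x < |f ⌊x⌋₊|} ⊆
      Set.Icc 0 a ∪ ⋃ n ∈ T, Set.Ico (n : ℝ) (n + 1) := by
    rintro x ⟨⟨hx0, hxX⟩, hx⟩
    refine (le_total x a).imp (fun hxa => ⟨hx0, hxa⟩) fun hax => Set.mem_iUnion₂.2 ⟨⌊x⌋₊, ?_,
      Nat.floor_le hx0, Nat.lt_floor_add_one x⟩
    rw [hT, mem_filter, mem_range, Nat.lt_succ_iff]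
    exact ⟨Nat.floor_le_of_le hxX, (hτ x hax).trans_lt hx⟩
  calc volume {x : ℝ | x ∈ Set.Icc (0 : ℝ) X ∧ τ x < |f ⌊x⌋₊|}
      ≤ volume (Set.Icc 0 a ∪ ⋃ n ∈ T, Set.Ico (n : ℝ) (n + 1)) := measure_mono hsub
    _ ≤ volume (Set.Icc 0 a) + ∑ n ∈ T, volume (Set.Ico (n : ℝ) (n + 1)) :=
      (measure_union_le _ _).trans (by gcongr; exact measure_biUnion_finset_le _ _)
    _ = ENNReal.ofReal (a + #T) := by simp [ENNReal.ofReal_add ha]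
    _ ≤ ENNReal.ofReal (a + S / c) := by
      gcongr
      exact card_filter_lt_abs_le hc hsum

theorem tendsto_volume_lt_abs_floor_div {ι : Type*} {l : Filter ι} {f : ι → ℕ → ℝ} {s : ι → ℝ}
    {X : ι → ℕ} {w : ℝ → ℝ} {K : ℝ} (hK : 0 < K) (hw : Tendsto w atTop atTop)
    (hX : Tendsto X l atTop)
    (hf : ∀ᶠ k in l, 0 < s k ∧ ∑ n ∈ range (X k + 1), |f k n| ≤ K * X k * s k) :
    Tendsto (fun k => volume {x : ℝ | x ∈ Set.Icc (0 : ℝ) (X k) ∧ s k * w x < |f k ⌊x⌋₊|} /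
      (X k : ENNReal)) l (𝓝 0) := by
  refine ENNReal.tendsto_nhds_zero.2 fun e he => ?_
  obtain ⟨r, hr0, hre⟩ := ENNReal.lt_iff_exists_nnreal_btwn.1 he
  have hr : 0 < (r : ℝ) := by exact_mod_cast hr0
  obtain ⟨a, ha⟩ := eventually_atTop.1 (hw.eventually_ge_atTop (2 * K / r))
  filter_upwards [hf, hX.eventually_gt_atTop 0,
    (tendsto_natCast_atTop_atTop.comp hX).eventually_ge_atTop (2 * max a 0 / (r : ℝ))]
    with k ⟨hs, hsum⟩ hX0 hXa
  rw [Function.comp_apply, div_le_iff₀ hr] at hXa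
  refine le_trans ?_ hre.le
  rw [ENNReal.div_le_iff (by exact_mod_cast hX0.ne') (ENNReal.natCast_ne_top _)]
  have hτ : ∀ x, max a 0 ≤ x → s k * (2 * K / r) ≤ s k * w x := fun x hx =>
    mul_le_mul_of_nonneg_left (ha x ((le_max_left a 0).trans hx)) hs.le
  refine (volume_lt_abs_floor_le (le_max_right a 0) (by positivity) hτ hsum).trans ?_
  rw [← ENNReal.ofReal_coe_nnreal, ← ENNReal.ofReal_natCast, ← ENNReal.ofReal_mul hr.le]
  refine ENNReal.ofReal_le_ofReal ?_
  have : K * X k * s k / (s k * (2 * K / r)) = r * X k / 2 := by field_simp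
  linarith

end SiftedIntervals

open SiftedIntervals in
theorem mainTheorem3 :
    ∃ C : ℝ, 0 < C ∧
      ∀ w : ℝ → ℝ, Filter.Tendsto w Filter.atTop Filter.atTop →
      ∀ ε δ : ℝ, 0 < ε → 0 < δ →
      ∀ y H X : ℕ → ℕ,
        Filter.Tendsto y Filter.atTop Filter.atTop →
        Filter.Tendsto H Filter.atTop Filter.atTop →
        Filter.Tendsto X Filter.atTop Filter.atTop →
        (∀ k, 1 < y k ∧ y k ≤ X k ∧ 1 < H k ∧ H k ≤ X k) →
        (∀ᶠ k in Filter.atTop, Real.log (H k) ^ (1 + ε) ≤ (y k : ℝ)) →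
        (∀ᶠ k in Filter.atTop,
          (1 + Real.log (Real.log (H k)) / Real.log (y k)) *
              (Real.log (H k) / Real.log (Real.log (H k))) ≤
            (1 - δ) * (Real.log (X k) / Real.log (y k))) →
        Filter.Tendsto
          (fun k => MeasureTheory.volume
              {x : ℝ | x ∈ Set.Icc (0 : ℝ) (X k) ∧
                C * (Real.sqrt (SiftedIntervals.M (H k) (y k)) * w x) <
                  |SiftedIntervals.roughCount (y k) (H k) x -
                    (H k : ℝ) * SiftedIntervals.P (y k)|} /
            (X k : ENNReal))
          Filter.atTop (nhds 0) := by
  refine ⟨1, one_pos, fun w hw ε δ hε hδ y H X hy hH hX hyHX hlog hcond => ?_⟩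
  have hmoment := (eventually_sum_abs_roughSum_sub_le hε hδ hy hH hyHX hlog hcond).mono
    fun k hk => And.intro (Real.sqrt_pos.2 hk.1) hk.2
  refine (tendsto_volume_lt_abs_floor_div (by norm_num) hw hX hmoment).congr fun k => ?_
  refine congrArg (fun s => MeasureTheory.volume s / (X k : ENNReal)) (Set.ext fun x => ?_)
  exact and_congr_right fun hx => by rw [one_mul, roughCount_eq_roughSum _ _ hx.1]
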